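/- **Setting.** Let $\Omega>1$. For $j\in\mathbb{N}_0$ define $\bar\varphi_j:\mathbb{R}^3\to\mathbb{R}^3$, with $V=(g,z,\mu)$, by $$\bar\varphi_j(V)=\begin{pmatrix} g-\beta_j g^2\\ z-\theta_j g^2-\zeta_j gz\\ \eta_j g+\gamma_j z+\lambda_j\mu-\upsilon^{gg}_jg^2-\upsilon^{gz}_jgz-\upsilon^{g\mu}_jg\mu-\upsilon^{zz}_jz^2-\upsilon^{z\mu}_jz\mu\end{pmatrix}$$ with real coefficients. Let $n_+=\max(n,0)$, $\|\beta\|_\infty=\sup_j|\beta_j|$, let $j_\Omega\in\mathbb{N}_0\cup\{\infty\}$ be the infimum of the $k\in\mathbb{N}_0$ such that $|\beta_j|\le\Omega^{-(j-k)_+}\|\beta\|_\infty$ for all $j$ ($\inf\emptyset=\infty$), and let $\chi_j=\Omega^{-(j-j_\Omega)_+}$. Let $W_j$ ($j\in\mathbb{N}_0$) be real Banach spaces and $X_j=W_j\oplus\mathbb{R}^3$, with elements $x_j=(K_j,V_j)=(K_j,g_j,z_j,\mu_j)$; $\mathbb{R}^3$ carries the supremum norm. For small $g_0>0$ let $\bar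 V=(\bar g,\bar z,\bar\mu)$ be the unique solution of $\bar V_{j+1}=\bar\varphi_j(\bar V_j)$ for all $j$ with $\bar g_0=g_0$ and $\bar z_j\to0$, $\bar\mu_j\to0$, and for $a,h>0$ let $D_j=D_j(g_0,a,h)$ be the set of $x_j\in X_j$ with $\|K_j\|\le a\chi_j\bar g_j^3$, $|g_j-\bar g_j|\le h\bar g_j^2|\log\bar g_j|$, $|z_j-\bar z_j|\le h\chi_j\bar g_j^2|\log\bar g_j|$, $|\mu_j-\bar\mu_j|\le h\chi_j\bar g_j^2|\log\bar g_j|$. **Assumptions**, with constants $B$, $c>0$, $\lambda>1$, $C_0$, $a>0$, $h>0$, $\kappa\in(0,\Omega^{-1})$, $R\in(0,a(1-\kappa\Omega))$, $M>0$: (A1) $|\beta_j|\le B$ for all $j$, and $\beta_j\ge c$ for all but at most $c^{-1}$ values of $j\le j_\Omega$. (A2) $\lambda_j\ge\lambda$ for all $j$; $\zeta_j\le0$ for all but at most $c^{-1}$ values of $j\le j_\Omega$; each of $\eta_j,\gamma_j,\theta_j,\zeta_j$ and the $\upsilon_j$'s is at most $C_0\chi_j$ in absolute value. (A3) (for a given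 $g_0$) The maps $\psi_j:D_j\to W_{j+1}$ and $\rho_j:D_j\to\mathbb{R}^3$ are three times continuously Fréchet differentiable, and for all $j$ and $x_j=(K_j,V_j)\in D_j$: $\|\psi_j(0,V_j)\|\le R\chi_{j+1}\bar g_{j+1}^3$, $\|\rho_j(x_j)\|\le M\chi_{j+1}\bar g_{j+1}^3$, $\|D_K\psi_j(x_j)\|\le\kappa$, $\|D_K\rho_j(x_j)\|\le M$, and for $\phi=\psi,\rho$ also $\|D_V\phi_j(x_j)\|\le M\chi_{j+1}\bar g_{j+1}^2$ and, for $2\le n+m\le3$, $\|D_V^mD_K^n\phi_j(x_j)\|\le M(\chi_{j+1}\bar g_{j+1}^3)^{1-n}(\bar g_{j+1}^2|\log\bar g_{j+1}|)^{-m}$. Write $\Phi_j=(\psi_j,\bar\varphi_j+\rho_j)$ and $\bar\Phi_j=(\psi_j,\bar\varphi_j)$. A global flow of $\Phi$ (or $\bar\Phi$) is a sequence $x$ with $x_{j+1}=\Phi_j(x_j)$ (or $x_{j+1}=\bar\Phi_j(x_j)$) for all $j\in\mathbb{N}_0$. **Theorem.** Fix $\Omega,B,c,\lambda,C_0,a,\kappa,R,M$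 as above, and let $a_*\in(R/(1-\kappa\Omega),a)$ and $b\in(0,1)$. There exists $h_*>0$ such that for all $h\ge h_*$ there exist $g_*>0$ and a constant $C$ such that, whenever (A1)–(A3) hold with these constants and with $g_0=g_0'\in(0,g_*]$, and $K_0'\in W_0$ satisfies $\|K_0'\|\le a_*(g_0')^3$, the following holds. (So $h_*,g_*,C$ depend only on the constants named before them, not on $j_\Omega$, $g_0'$, the spaces or the maps.) There is an open neighbourhood $N\subset W_0\oplus\mathbb{R}$ of $(K_0',g_0')$ such that: (i) For every $(K_0,g_0)\in N$ there is a unique global flow $\bar x=(\bar K,\bar V)$ of $\bar\Phi$ with $(\bar K_0,\bar g_0)=(K_0,g_0)$ and $\bar z_j\to0$, $\bar\mu_j\to0$, and there is a global flow $x=(K,g,z,\mu)$ of $\Phi$ with the same initial condition $(K_0,g_0)$ and with $z_j\to0$, $\mu_j\to0$, such that for all $j$ $$\|K_j-\bar K_j\|\le b(a-a_*)\chi_j\bar g_j^3,\qquad |g_j-\bar g_j|\le bh\bar g_j^2|\log\bar g_j|,$$ $$|z_j-\bar z_j|\le bh\chi_j\bar g_j^2|\log\bar g_j|,\qquad |\mu_j-\bar\mu_j|\le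 bh\chi_j\bar g_j^2|\log\bar g_j|.$$ Both flows stay in the domains $D_j(g_0',a,h)$, and $x$ is the unique global flow of $\Phi$ that obeys these boundary conditions and these bounds. (ii) For every $j$, the map $(K_0,g_0)\mapsto x_j\in X_j$ is $C^1$ on $N$, and $|\partial z_0/\partial g_0|\le C$, $|\partial\mu_0/\partial g_0|\le C$ on $N$. -/

import Mathlib

namespace RGFlow

open Filter Topology

noncomputable section

universe u

/-- The space `ℝ³` of triples `V = (g, z, μ)`; the product norm is the supremum norm. -/
abbrev VSpace : Type := ℝ × ℝ × ℝ

/-- The space `X_j = W_j ⊕ ℝ³`, with elements `(K, (g, z, μ))`. -/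
abbrev XSpace (W : ℕ → Type u) (j : ℕ) : Type u := W j × VSpace

/-- The real coefficients of the quadratic flow. -/
structure Params where
  β : ℕ → ℝ
  η : ℕ → ℝ
  γ : ℕ → ℝ
  lam : ℕ → ℝ
  θ : ℕ → ℝ
  ζ : ℕ → ℝ
  υgg : ℕ → ℝ
  υgz : ℕ → ℝ
  υgμ : ℕ → ℝ
  υzz : ℕ → ℝ
  υzμ : ℕ → ℝ

/-- The quadratic map `φ̄_j : ℝ³ → ℝ³` (matrix products written out). -/
def quadMap (p : Params) (j : ℕ) (V : VSpace) : VSpace :=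
  let g := V.1
  let z := V.2.1
  let μ := V.2.2
  (g - p.β j * g ^ 2,
   z - (p.θ j * g ^ 2 + p.ζ j * g * z),
   p.η j * g + p.γ j * z + p.lam j * μ
     - (p.υgg j * g ^ 2 + p.υgz j * g * z + p.υgμ j * g * μ
        + p.υzz j * z ^ 2 + p.υzμ j * z * μ))

/-- The cut-off time `j_Ω ∈ ℕ ∪ {∞}` of the sequence `β`: the least `k` such that
`|β_j| ≤ Ω^{-(j-k)_+} ‖β‖_∞` for all `j` (`∞` if there is none).
Truncated subtraction of natural numbers is `(j-k)_+`. -/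
def cutoff (Ω : ℝ) (β : ℕ → ℝ) : ℕ∞ :=
  sInf {k : ℕ∞ | ∃ n : ℕ, k = n ∧ ∀ j : ℕ, |β j| ≤ Ω⁻¹ ^ (j - n) * ⨆ i, |β i|}

/-- `χ_j = Ω^{-(j - j_Ω)_+}`, which is `1` for all `j` if `j_Ω = ∞`. -/
def chi (Ω : ℝ) (β : ℕ → ℝ) (j : ℕ) : ℝ :=
  Ω⁻¹ ^ ((j : ℕ∞) - cutoff Ω β).toNat

/-- Assumption (A1) with constants `B` (bound on `‖β‖_∞`) and `c`. -/
structure AssumptionA1 (Ω B c : ℝ) (p : Params) : Prop where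
  bounded : ∀ j, |p.β j| ≤ B
  exceptions_finite : {j : ℕ | (j : ℕ∞) ≤ cutoff Ω p.β ∧ p.β j < c}.Finite
  exceptions_card :
    (({j : ℕ | (j : ℕ∞) ≤ cutoff Ω p.β ∧ p.β j < c}.ncard : ℕ) : ℝ) ≤ c⁻¹

/-- Assumption (A2) with constants `c`, `lam₀` (lower bound on `λ_j`) and `C₀` (the constant in
the bounds `O(χ_j)`). -/
structure AssumptionA2 (Ω c lam₀ C₀ : ℝ) (p : Params) : Prop where
  lam_ge : ∀ j, lam₀ ≤ p.lam j
  exceptions_finite : {j : ℕ | (j : ℕ∞) ≤ cutoff Ω p.β ∧ 0 < p.ζ j}.Finite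
  exceptions_card :
    (({j : ℕ | (j : ℕ∞) ≤ cutoff Ω p.β ∧ 0 < p.ζ j}.ncard : ℕ) : ℝ) ≤ c⁻¹
  η_le : ∀ j, |p.η j| ≤ C₀ * chi Ω p.β j
  γ_le : ∀ j, |p.γ j| ≤ C₀ * chi Ω p.β j
  θ_le : ∀ j, |p.θ j| ≤ C₀ * chi Ω p.β j
  ζ_le : ∀ j, |p.ζ j| ≤ C₀ * chi Ω p.β j
  υgg_le : ∀ j, |p.υgg j| ≤ C₀ * chi Ω p.β j
  υgz_le : ∀ j, |p.υgz j| ≤ C₀ * chi Ω p.β j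
  υgμ_le : ∀ j, |p.υgμ j| ≤ C₀ * chi Ω p.β j
  υzz_le : ∀ j, |p.υzz j| ≤ C₀ * chi Ω p.β j
  υzμ_le : ∀ j, |p.υzμ j| ≤ C₀ * chi Ω p.β j

/-- `V` is a global flow of `φ̄` with initial condition `g₀` and `(z_∞, μ_∞) = (0, 0)`. -/
structure IsQuadFlow (p : Params) (g₀ : ℝ) (V : ℕ → VSpace) : Prop where
  step : ∀ j, V (j + 1) = quadMap p j (V j)
  init : (V 0).1 = g₀
  z_lim : Tendsto (fun j => (V j).2.1) atTop (𝓝 0)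
  μ_lim : Tendsto (fun j => (V j).2.2) atTop (𝓝 0)

/-- The flow `V̄ = (ḡ, z̄, μ̄)` of `φ̄` with `ḡ_0 = g₀` and `(z̄_∞, μ̄_∞) = (0, 0)`: a sequence
satisfying `IsQuadFlow p g₀` whenever there is one (and an arbitrary sequence otherwise). -/
def quadFlow (p : Params) (g₀ : ℝ) : ℕ → VSpace :=
  Classical.epsilon (IsQuadFlow p g₀)

/-- The sequence `ḡ` with initial condition `g₀`. -/
def gbar (p : Params) (g₀ : ℝ) (j : ℕ) : ℝ := (quadFlow p g₀ j).1

variable {W : ℕ → Type u} [∀ j, NormedAddCommGroup (W j)] [∀ j, NormedSpace ℝ (W j)]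

/-- `‖K - K'‖ ≤ A χ_j ḡ_j³`, `|g - g'| ≤ H ḡ_j² |log ḡ_j|`, and
`|z - z'|, |μ - μ'| ≤ H χ_j ḡ_j² |log ḡ_j|`, where `ḡ` has initial condition `g₀`. -/
structure WeightedClose (p : Params) (Ω A H g₀ : ℝ) (j : ℕ) (x x' : XSpace W j) : Prop where
  K_le : ‖x.1 - x'.1‖ ≤ A * chi Ω p.β j * gbar p g₀ j ^ 3
  g_le : |x.2.1 - x'.2.1| ≤ H * gbar p g₀ j ^ 2 * |Real.log (gbar p g₀ j)|
  z_le : |x.2.2.1 - x'.2.2.1| ≤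
    H * chi Ω p.β j * gbar p g₀ j ^ 2 * |Real.log (gbar p g₀ j)|
  μ_le : |x.2.2.2 - x'.2.2.2| ≤
    H * chi Ω p.β j * gbar p g₀ j ^ 2 * |Real.log (gbar p g₀ j)|

/-- The domain `D_j(g₀, a, h) ⊆ X_j`, centred at `(0, V̄_j)`. -/
def domain (W : ℕ → Type u) [∀ j, NormedAddCommGroup (W j)]
    (p : Params) (Ω a h g₀ : ℝ) (j : ℕ) : Set (XSpace W j) :=
  {x | WeightedClose p Ω a h g₀ j x (0, quadFlow p g₀ j)}

section Derivatives

variable {E F : Type*} [NormedAddCommGroup E] [NormedSpace ℝ E]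
  [NormedAddCommGroup F] [NormedSpace ℝ F]

/-- The partial Fréchet derivative `D_K φ(x)` of `φ : D → F`, `D ⊆ E ⊕ ℝ³`. -/
def derivK (φ : E × VSpace → F) (D : Set (E × VSpace)) (x : E × VSpace) : E →L[ℝ] F :=
  (fderivWithin ℝ φ D x).comp (ContinuousLinearMap.inl ℝ E VSpace)

/-- The partial Fréchet derivative `D_V φ(x)` of `φ : D → F`, `D ⊆ E ⊕ ℝ³`. -/
def derivV (φ : E × VSpace → F) (D : Set (E × VSpace)) (x : E × VSpace) : VSpace →L[ℝ] F :=
  (fderivWithin ℝ φ D x).comp (ContinuousLinearMap.inr ℝ E VSpace)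

/-- The mixed derivative `D_V^m D_K^n φ(x)` of `φ : D → F`, `D ⊆ E ⊕ ℝ³`, as a bounded
`(m+n)`-linear map on `E ⊕ ℝ³`: the total derivative of order `m + n`, whose first `m` arguments
are projected to `ℝ³` and whose last `n` arguments are projected to `E`. -/
def derivVK (m n : ℕ) (φ : E × VSpace → F) (D : Set (E × VSpace)) (x : E × VSpace) :
    ContinuousMultilinearMap ℝ (fun _ : Fin (m + n) => E × VSpace) F :=
  (iteratedFDerivWithin ℝ (m + n) φ D x).compContinuousLinearMap fun i =>
    if (i : ℕ) < m then
      (ContinuousLinearMap.inr ℝ E VSpace).comp (ContinuousLinearMap.snd ℝ E VSpace)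
    else
      (ContinuousLinearMap.inl ℝ E VSpace).comp (ContinuousLinearMap.fst ℝ E VSpace)

end Derivatives

/-- Assumption (A3) on the maps `ψ_j : D_j → W_{j+1}` and `ρ_j : D_j → ℝ³`, where
`D_j = D_j(g₀, a, h)`. The values of `ψ_j` and `ρ_j` outside `D_j` play no role. -/
structure AssumptionA3 (p : Params) (Ω a h κ R M g₀ : ℝ)
    (ψ : ∀ j, XSpace W j → W (j + 1)) (ρ : ∀ j, XSpace W j → VSpace) : Prop where
  ψ_smooth : ∀ j, ContDiffOn ℝ 3 (ψ j) (domain W p Ω a h g₀ j)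
  ρ_smooth : ∀ j, ContDiffOn ℝ 3 (ρ j) (domain W p Ω a h g₀ j)
  ψ_le : ∀ j, ∀ x ∈ domain W p Ω a h g₀ j,
    ‖ψ j (0, x.2)‖ ≤ R * chi Ω p.β (j + 1) * gbar p g₀ (j + 1) ^ 3
  ρ_le : ∀ j, ∀ x ∈ domain W p Ω a h g₀ j,
    ‖ρ j x‖ ≤ M * chi Ω p.β (j + 1) * gbar p g₀ (j + 1) ^ 3
  ψ_derivK_le : ∀ j, ∀ x ∈ domain W p Ω a h g₀ j,
    ‖derivK (ψ j) (domain W p Ω a h g₀ j) x‖ ≤ κ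
  ρ_derivK_le : ∀ j, ∀ x ∈ domain W p Ω a h g₀ j,
    ‖derivK (ρ j) (domain W p Ω a h g₀ j) x‖ ≤ M
  ψ_derivV_le : ∀ j, ∀ x ∈ domain W p Ω a h g₀ j,
    ‖derivV (ψ j) (domain W p Ω a h g₀ j) x‖ ≤
      M * chi Ω p.β (j + 1) * gbar p g₀ (j + 1) ^ 2
  ρ_derivV_le : ∀ j, ∀ x ∈ domain W p Ω a h g₀ j,
    ‖derivV (ρ j) (domain W p Ω a h g₀ j) x‖ ≤
      M * chi Ω p.β (j + 1) * gbar p g₀ (j + 1) ^ 2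
  ψ_derivVK_le : ∀ m n : ℕ, 2 ≤ n + m → n + m ≤ 3 →
    ∀ j, ∀ x ∈ domain W p Ω a h g₀ j,
      ‖derivVK m n (ψ j) (domain W p Ω a h g₀ j) x‖ ≤
        M * (chi Ω p.β (j + 1) * gbar p g₀ (j + 1) ^ 3) ^ (1 - (n : ℤ))
          * (gbar p g₀ (j + 1) ^ 2 * |Real.log (gbar p g₀ (j + 1))|) ^ (-(m : ℤ))
  ρ_derivVK_le : ∀ m n : ℕ, 2 ≤ n + m → n + m ≤ 3 →
    ∀ j, ∀ x ∈ domain W p Ω a h g₀ j,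
      ‖derivVK m n (ρ j) (domain W p Ω a h g₀ j) x‖ ≤
        M * (chi Ω p.β (j + 1) * gbar p g₀ (j + 1) ^ 3) ^ (1 - (n : ℤ))
          * (gbar p g₀ (j + 1) ^ 2 * |Real.log (gbar p g₀ (j + 1))|) ^ (-(m : ℤ))

/-- `Φ = (ψ, φ̄ + ρ)`. -/
def evolution (p : Params) (ψ : ∀ j, XSpace W j → W (j + 1)) (ρ : ∀ j, XSpace W j → VSpace)
    (j : ℕ) (x : XSpace W j) : XSpace W (j + 1) :=
  (ψ j x, quadMap p j x.2 + ρ j x)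

/-- `Φ̄ = (ψ, φ̄)`. -/
def evolutionBar (p : Params) (ψ : ∀ j, XSpace W j → W (j + 1))
    (j : ℕ) (x : XSpace W j) : XSpace W (j + 1) :=
  (ψ j x, quadMap p j x.2)

/-- `x` solves `x_{j+1} = Φ_j(x_j)` for all `j`, with initial condition `(K_0, g_0) = u` and final
condition `(z_∞, μ_∞) = (0, 0)`. -/
structure IsFlow (Φ : ∀ j, XSpace W j → XSpace W (j + 1)) (u : W 0 × ℝ)
    (x : ∀ j, XSpace W j) : Prop where
  step : ∀ j, x (j + 1) = Φ j (x j)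
  K_init : (x 0).1 = u.1
  g_init : (x 0).2.1 = u.2
  z_lim : Tendsto (fun j => (x j).2.2.1) atTop (𝓝 0)
  μ_lim : Tendsto (fun j => (x j).2.2.2) atTop (𝓝 0)

/-- The sequence `K̄_{j+1} = ψ_j(K̄_j, V̄_j)`, `K̄_0 = K_0`, for the initial condition
`u = (K_0, g_0)`. -/
def Kbar (p : Params) (ψ : ∀ j, XSpace W j → W (j + 1)) (u : W 0 × ℝ) : ∀ j, W j
  | 0 => u.1
  | j + 1 => ψ j (Kbar p ψ u j, quadFlow p u.2 j)

/-- The approximate flow `x̄ = (K̄, V̄)` with initial condition `u = (K_0, g_0)`. -/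
def approxFlow (p : Params) (ψ : ∀ j, XSpace W j → W (j + 1)) (u : W 0 × ℝ) (j : ℕ) :
    XSpace W j :=
  (Kbar p ψ u j, quadFlow p u.2 j)

end

end RGFlow

open RGFlow

/-! ### The cut-off `χ` and the exceptional times of (A1) and (A2) -/

namespace RGFlow

open Filter Topology Finset

/-! The quadratic flow is triangular: `g` is a scalar recursion, `z` is then linear with multipliers
`1 - ζ g`, and `μ` is linear with multipliers close to `λ_j > 1`. So `g` runs forward from time
zero, while `z` and `μ` are solved backward from infinity (`exists_baseFlow`). The `K`-part of the
approximate flow is then a forward iteration.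

A flow of `Φ` near the approximate flow `x̄` with initial condition `u₀ = (K₀', g₀')` is written as
`x = x̄ + up y`, where `up` multiplies the components by weights: `χ g³` for `K`, `g² |log g|` for
`g`, and `χ g² |log g|` for `z` and `μ`. Subtracting the equation of `x̄` leaves linear recursions
that are decoupled, plus a forcing that collects `ρ`, the variation of `ψ`, the off-diagonal linear
terms and the quadratic terms. Solving the linear recursions turns the problem into a fixed point
equation `y = G y + L (u - u₀)` in a space of bounded sequences (`eq_solve_add_init_iff`,
`evolution_iff_recursion`); the conditions at infinity are encoded in the boundedness of `y`. The
map `G` is a contraction of class `C¹`, so existence, uniqueness in a box, smoothness in `u` and the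
derivative bound all follow from `exists_smooth_fixedPoint` and `contDiffOn_nemytskii`, combined in
`exists_perturbed_flow`.

The linear solution operator is bounded because of sums along `ḡ`, obtained by telescoping: `∑ χ g²`
over `l ≥ j` is `O(χ_j g_j)`, its consequence for `∑ χ g³ |log g|` is `O(χ_j g_j² |log g_j|)`, and
`∑ χ g` over `l < j` is `O(|log g_j|)`. The last sum is the origin of the logarithm in the weights.
Exceptional times, and times beyond the cut-off, enter through defects of total mass `O(χ_j)`, which
small `g₀` makes harmless.

The forcing is a contraction for different reasons in its different parts. The `K`-equation
contracts since one step costs at most `κ Ω (1 + t) < 1` in the weight. The linear couplings of `g`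
to `z` and of `g, z` to `μ` are not small in `g`, but become small by a hierarchy `rg`, `rz`, `rμ`
of increasing constants in the weights. Everything else, including the quadratic terms on a box of
size proportional to `h`, carries a positive power of `g` and is small for small `g₀`. Thus the
weights are fixed before `h`, and `g_*` after it.

The contraction is centred at the single initial condition `u₀`, whereas the bounds compare `x(u)`
with `x̄(u)` in weights that depend on `u`. Applying the same theorem with `ρ = 0` shows that
`x̄(u)` is close to `x̄(u₀)` uniformly in time (`approxFlow_close`), and `exists_comparable`
compares the weights. Since the fixed point has norm at most `1/2`, there is room for both changes.
-/

lemma sum_Ico_telescope (f : ℕ → ℝ) {j n : ℕ} (h : j ≤ n) :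
    ∑ l ∈ Ico j n, (f l - f (l + 1)) = f j - f n := by
  induction n, h using Nat.le_induction with
  | base => simp
  | succ n hn ih => rw [sum_Ico_succ_top hn, ih]; ring

/-- Control of the coefficients `β` by `χ` up to a defect `d` of small total mass. -/
structure Control (Ω B c D : ℝ) (β χ d : ℕ → ℝ) : Prop where
  pos : ∀ j, 0 < χ j
  zero : χ 0 = 1
  anti : ∀ j, χ (j + 1) ≤ χ j
  ratio : ∀ j, χ j ≤ Ω * χ (j + 1)
  β_le : ∀ j, |β j| ≤ B * χ j
  d_nonneg : ∀ j, 0 ≤ d j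
  low : ∀ j, c * χ j ≤ β j + d j
  low' : ∀ j, c * χ j ≤ χ j * β j + d j
  d_sum : ∀ j n, ∑ l ∈ Ico j n, d l ≤ D * χ j

lemma chi_of_le {Ω : ℝ} {β : ℕ → ℝ} {j : ℕ} (h : (j : ℕ∞) ≤ cutoff Ω β) : chi Ω β j = 1 := by
  simp [chi, tsub_eq_zero_of_le h]

lemma chi_of_eq {Ω : ℝ} {β : ℕ → ℝ} {n : ℕ} (h : cutoff Ω β = n) (j : ℕ) :
    chi Ω β j = Ω⁻¹ ^ (j - n) := by
  rw [chi, h]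
  norm_cast

lemma chi_pos {Ω : ℝ} (hΩ : 1 < Ω) (β : ℕ → ℝ) (j : ℕ) : 0 < chi Ω β j := by
  unfold chi; positivity

lemma chi_zero (Ω : ℝ) (β : ℕ → ℝ) : chi Ω β 0 = 1 := by simp [chi]

/-- The infimum of a nonempty set in the well-ordered `ℕ∞` is attained, so a finite cut-off
satisfies its defining bound. -/
lemma cutoff_cases (Ω : ℝ) (β : ℕ → ℝ) : cutoff Ω β = ⊤ ∨ ∃ n : ℕ, cutoff Ω β = n ∧
    ∀ j, |β j| ≤ Ω⁻¹ ^ (j - n) * ⨆ i, |β i| := by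
  by_cases h : {k : ℕ∞ | ∃ n : ℕ, k = n ∧
      ∀ j : ℕ, |β j| ≤ Ω⁻¹ ^ (j - n) * ⨆ i, |β i|}.Nonempty
  · obtain ⟨n, hn, hj⟩ := csInf_mem h
    exact Or.inr ⟨n, hn, hj⟩
  · left
    rw [cutoff, Set.not_nonempty_iff_eq_empty.mp h, sInf_empty]

lemma chi_succ {Ω : ℝ} (hΩ : 1 < Ω) (β : ℕ → ℝ) (j : ℕ) :
    ((j : ℕ∞) ≤ cutoff Ω β → chi Ω β j = 1) ∧
    (¬ (j : ℕ∞) ≤ cutoff Ω β → chi Ω β (j + 1) = Ω⁻¹ * chi Ω β j) ∧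
    chi Ω β (j + 1) ≤ chi Ω β j ∧ chi Ω β j ≤ Ω * chi Ω β (j + 1) := by
  have h1 : Ω⁻¹ ≤ 1 := inv_le_one_of_one_le₀ hΩ.le
  have h0 : 0 < Ω⁻¹ := by positivity
  refine ⟨chi_of_le, ?_⟩
  rcases cutoff_cases Ω β with h | ⟨n, h, -⟩
  · have e : ∀ j, chi Ω β j = 1 := fun j => chi_of_le (by simp [h])
    simp only [e, h, le_top, not_true_eq_false, false_imp_iff, true_and]
    exact ⟨le_rfl, by linarith⟩
  · simp only [chi_of_eq h, h, Nat.cast_le, not_le]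
    rcases le_or_gt (j + 1) n with hj | hj
    · have e1 : j + 1 - n = 0 := by omega
      have e2 : j - n = 0 := by omega
      simp only [e1, e2, pow_zero]
      exact ⟨fun h => by omega, le_rfl, by linarith⟩
    · have e1 : j + 1 - n = (j - n) + 1 := by omega
      have : (0 : ℝ) < Ω⁻¹ ^ (j - n) := by positivity
      rw [e1, pow_succ]
      refine ⟨fun _ => by ring, by nlinarith, ?_⟩
      rw [mul_comm (_ ^ _), ← mul_assoc, mul_inv_cancel₀ (by positivity), one_mul]

lemma chi_le_one {Ω : ℝ} (hΩ : 1 < Ω) (β : ℕ → ℝ) (j : ℕ) : chi Ω β j ≤ 1 := by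
  unfold chi
  exact pow_le_one₀ (by positivity) (inv_le_one_of_one_le₀ hΩ.le)

lemma abs_le_chi {Ω B : ℝ} (hΩ : 1 < Ω) {β : ℕ → ℝ} (hB : ∀ j, |β j| ≤ B) (j : ℕ) :
    |β j| ≤ B * chi Ω β j := by
  rcases cutoff_cases Ω β with h | ⟨n, h, hn⟩
  · rw [chi_of_le (by simp [h]), mul_one]
    exact hB j
  · rw [chi_of_eq h, mul_comm]
    exact (hn j).trans (mul_le_mul_of_nonneg_left (ciSup_le hB) (by positivity))

open Classical in
/-- The indicator of a set of exceptional times up to the cut-off, plus `χ` beyond the cut-off. -/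
noncomputable def defect (Ω : ℝ) (β : ℕ → ℝ) (X : Set ℕ) (l : ℕ) : ℝ :=
  (if l ∈ X then 1 else 0) + if (l : ℕ∞) ≤ cutoff Ω β then 0 else chi Ω β l

lemma defect_nonneg {Ω : ℝ} (hΩ : 1 < Ω) (β : ℕ → ℝ) (X : Set ℕ) (l : ℕ) :
    0 ≤ defect Ω β X l := by
  have := (chi_pos hΩ β l).le
  unfold defect
  split_ifs <;> linarith

/-- At most `c⁻¹` exceptional times contribute, and past the cut-off `χ` is a geometric series. The
factor `χ_j` survives because no exceptional time lies beyond the cut-off. -/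
lemma defect_sum_le {Ω c : ℝ} (hΩ : 1 < Ω) (hc : 0 < c) (β : ℕ → ℝ) {X : Set ℕ}
    (hX : ∀ l ∈ X, (l : ℕ∞) ≤ cutoff Ω β) (hfin : X.Finite) (hcard : (X.ncard : ℝ) ≤ c⁻¹)
    (j n : ℕ) : ∑ l ∈ Ico j n, defect Ω β X l ≤ (c⁻¹ + Ω / (Ω - 1)) * chi Ω β j := by
  classical
  have hΩ1 : 0 < Ω - 1 := by linarith
  have hχ := chi_pos hΩ β
  unfold defect
  rw [sum_add_distrib, add_mul]
  refine add_le_add ?_ ?_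
  · by_cases hj : (j : ℕ∞) ≤ cutoff Ω β
    · rw [chi_of_le hj, mul_one]
      refine le_trans ?_ hcard
      rw [sum_ite, sum_const_zero, add_zero, sum_const, nsmul_eq_mul, mul_one,
        Set.ncard_eq_toFinset_card X hfin]
      gcongr
      intro l hl
      simp only [mem_filter] at hl
      simpa using hl.2
    -- Here `χ_j` may be tiny, but all exceptional times are already over.
    · have : ∑ l ∈ Ico j n, (if l ∈ X then (1 : ℝ) else 0) = 0 := by
        refine sum_eq_zero fun l hl => ?_
        rw [if_neg]
        intro hlX
        refine hj (le_trans ?_ (hX l hlX))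
        exact_mod_cast (mem_Ico.mp hl).1
      rw [this]
      have := hχ j
      positivity
  -- Beyond the cut-off `χ_l - χ_{l+1} = (1 - Ω⁻¹) χ_l`, which makes the geometric series telescope.
  · have step : ∀ l : ℕ, (if (l : ℕ∞) ≤ cutoff Ω β then 0 else chi Ω β l) ≤
        Ω / (Ω - 1) * chi Ω β l - Ω / (Ω - 1) * chi Ω β (l + 1) := by
      intro l
      obtain ⟨-, h1, h2, -⟩ := chi_succ hΩ β l
      split_ifs with hl
      · have : 0 < Ω / (Ω - 1) := by positivity
        nlinarith
      · rw [h1 hl]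
        have : Ω / (Ω - 1) * chi Ω β l - Ω / (Ω - 1) * (Ω⁻¹ * chi Ω β l) = chi Ω β l := by
          field_simp
        rw [this]
    rcases le_total n j with hnj | hnj
    · rw [Ico_eq_empty_of_le hnj, sum_empty]
      have := hχ j
      positivity
    · refine (sum_le_sum fun l _ => step l).trans ?_
      rw [sum_Ico_telescope (fun l => Ω / (Ω - 1) * chi Ω β l) hnj]
      have := hχ n
      have : 0 ≤ Ω / (Ω - 1) * chi Ω β n := by positivity
      linarith

/-- Wherever `β_j ≥ c χ_j` may fail, it fails by at most `(c + B) χ_j`. These are exactly the times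
at which the defect is nonzero. -/
lemma exists_control {Ω B c : ℝ} (hΩ : 1 < Ω) (hc : 0 < c) {p : Params}
    (h : AssumptionA1 Ω B c p) :
    ∃ d, Control Ω B c ((c + B) * (c⁻¹ + Ω / (Ω - 1))) p.β (chi Ω p.β) d := by
  classical
  have hB : 0 ≤ B := (abs_nonneg _).trans (h.bounded 0)
  have hβ := abs_le_chi hΩ h.bounded
  set X := {j : ℕ | (j : ℕ∞) ≤ cutoff Ω p.β ∧ p.β j < c} with hX
  have key : ∀ j, c * chi Ω p.β j ≤ p.β j + (c + B) * defect Ω p.β X j ∧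
      c * chi Ω p.β j ≤ chi Ω p.β j * p.β j + (c + B) * defect Ω p.β X j := by
    intro j
    have hχ := chi_pos hΩ p.β j
    have hχ1 := chi_le_one hΩ p.β j
    have h1 := abs_le.mp (hβ j)
    unfold defect
    by_cases hj : (j : ℕ∞) ≤ cutoff Ω p.β
    · rw [chi_of_le hj] at h1 ⊢
      by_cases hjX : j ∈ X
      · simp only [hjX, hj, if_true]
        constructor <;> linarith
      · have : c ≤ p.β j := not_lt.mp fun hh => hjX ⟨hj, hh⟩
        simp only [hjX, hj, if_true, if_false]
        constructor <;> linarith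
    · have hjX : j ∉ X := fun hh => hj hh.1
      simp only [hjX, hj, if_false]
      constructor <;> nlinarith
  refine ⟨fun l => (c + B) * defect Ω p.β X l, chi_pos hΩ _, chi_zero _ _,
    fun j => (chi_succ hΩ _ j).2.2.1, fun j => (chi_succ hΩ _ j).2.2.2, hβ,
    fun j => mul_nonneg (by linarith) (defect_nonneg hΩ _ _ _), fun j => (key j).1,
    fun j => (key j).2, fun j n => ?_⟩
  rw [← mul_sum, mul_assoc]
  exact mul_le_mul_of_nonneg_left (defect_sum_le hΩ hc _ (fun l hl => hl.1)
    h.exceptions_finite h.exceptions_card j n) (by linarith)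

lemma exists_zeta_defect {Ω c lam₀ C₀ : ℝ} (hΩ : 1 < Ω) (hc : 0 < c) {p : Params}
    (h : AssumptionA2 Ω c lam₀ C₀ p) :
    ∃ e : ℕ → ℝ, (∀ j, 0 ≤ e j) ∧ (∀ j, p.ζ j ≤ e j) ∧
      ∀ j n, ∑ l ∈ Ico j n, e l ≤ C₀ * (c⁻¹ + Ω / (Ω - 1)) * chi Ω p.β j := by
  classical
  have hC : 0 ≤ C₀ := by
    have := (abs_nonneg _).trans (h.ζ_le 0)
    rwa [chi_zero, mul_one] at this
  set X := {j : ℕ | (j : ℕ∞) ≤ cutoff Ω p.β ∧ 0 < p.ζ j} with hX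
  refine ⟨fun l => C₀ * defect Ω p.β X l, fun j => mul_nonneg hC (defect_nonneg hΩ _ _ _),
    fun j => ?_, fun j n => ?_⟩
  · have h1 := (le_abs_self _).trans (h.ζ_le j)
    unfold defect
    by_cases hj : (j : ℕ∞) ≤ cutoff Ω p.β
    · rw [chi_of_le hj] at h1
      by_cases hjX : j ∈ X
      · simpa [hjX, hj] using h1
      · have : p.ζ j ≤ 0 := not_lt.mp fun hh => hjX ⟨hj, hh⟩
        simpa [hjX, hj] using this
    · have hjX : j ∉ X := fun hh => hj hh.1
      simpa [hjX, hj] using h1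
  · rw [← mul_sum, mul_assoc]
    exact mul_le_mul_of_nonneg_left (defect_sum_le hΩ hc _ (fun l hl => hl.1)
      h.exceptions_finite h.exceptions_card j n) hC

end RGFlow

/-! ### The sequence `ḡ`: growth and summation estimates -/

namespace RGFlow

open Filter Topology Finset

/-- `x (log x)²` and `|log x|⁻¹` are small on `(0, x₀]`. -/
def Small (A x₀ : ℝ) : Prop :=
  ∀ x, 0 < x → x ≤ x₀ → A * (x * Real.log x ^ 2) ≤ 1 ∧ Real.log x ≤ -2

lemma exists_small (A : ℝ) : ∃ x₀, 0 < x₀ ∧ Small A x₀ := by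
  have h1 : Tendsto (fun x : ℝ => A * (x * Real.log x ^ 2)) (𝓝[>] 0) (𝓝 0) := by
    have h := ((tendsto_log_mul_rpow_nhdsGT_zero (r := 1 / 2) (by norm_num)).pow 2).const_mul A
    simp only [ne_eq, OfNat.ofNat_ne_zero, not_false_eq_true, zero_pow, mul_zero] at h
    refine h.congr' ?_
    filter_upwards [self_mem_nhdsWithin] with x hx
    have : (x ^ (1 / 2 : ℝ)) ^ 2 = x := by
      rw [← Real.sqrt_eq_rpow, Real.sq_sqrt (le_of_lt hx)]
    rw [mul_pow, this]
    ring
  have h2 := Real.tendsto_log_nhdsGT_zero.eventually_le_atBot (-2)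
  have h3 := (h1.eventually_le_const (u := 1) one_pos).and h2
  rw [eventually_nhdsWithin_iff, Metric.eventually_nhds_iff] at h3
  obtain ⟨ε, hε, h⟩ := h3
  refine ⟨ε / 2, by positivity, fun x hx hx' => h ?_ hx⟩
  rw [Real.dist_eq, sub_zero, abs_of_pos hx]
  linarith

lemma Small.mono {A A' x₀ x₀' : ℝ} (h : Small A x₀) (hA : A' ≤ A) (hx : x₀' ≤ x₀) :
    Small A' x₀' := fun x h0 h1 =>
  ⟨(mul_le_mul_of_nonneg_right hA (by positivity)).trans (h x h0 (h1.trans hx)).1,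
    (h x h0 (h1.trans hx)).2⟩

lemma Small.linear {A x₀ x : ℝ} (h : Small A x₀) (hA : 0 ≤ A) (h0 : 0 < x) (hx : x ≤ x₀) :
    A * x ≤ 1 / 4 ∧ A * (x * -Real.log x) ≤ 1 / 2 := by
  obtain ⟨h1, h2⟩ := h x h0 hx
  have hAx : 0 ≤ A * x := by positivity
  constructor <;> nlinarith [mul_nonneg hAx (by linarith : 0 ≤ -Real.log x - 2)]

/-- The function `-t log t` increases up to `1/e`, so it may be evaluated at `2 x` instead of `y`.
The monotonicity is proved from `log t ≥ 1 - 1/t` at `t = y / (2 x)`. -/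
lemma mul_neg_log_le {x y : ℝ} (hy : 0 < y) (hx : 0 < x) (hyx : y ≤ 2 * x)
    (hl : Real.log (2 * x) ≤ -1) : y * -Real.log y ≤ 2 * (x * -Real.log x) := by
  have ht : 0 < y / (2 * x) := by positivity
  have ht1 : y / (2 * x) ≤ 1 := by rw [div_le_one (by positivity)]; exact hyx
  have h1 := Real.one_sub_inv_le_log_of_pos ht
  rw [Real.log_div hy.ne' (by positivity)] at h1
  have h2 : Real.log (2 * x) = Real.log 2 + Real.log x := Real.log_mul (by norm_num) hx.ne'
  have h3 : 0 < Real.log 2 := Real.log_pos (by norm_num)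
  have h4 : y * (1 - (y / (2 * x))⁻¹) = y - 2 * x := by field_simp
  have h5 := mul_le_mul_of_nonneg_left h1 hy.le
  rw [h4] at h5
  nlinarith

section Sequence

variable {Ω B c D g₀ : ℝ} {β χ d g : ℕ → ℝ}

lemma Control.chi_anti (hC : Control Ω B c D β χ d) : Antitone χ := antitone_nat_of_succ_le hC.anti

lemma Control.chi_le_one (hC : Control Ω B c D β χ d) (j : ℕ) : χ j ≤ 1 :=
  hC.zero ▸ hC.chi_anti (Nat.zero_le j)

lemma Control.B_nonneg (hC : Control Ω B c D β χ d) : 0 ≤ B := by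
  have := (abs_nonneg _).trans (hC.β_le 0)
  rwa [hC.zero, mul_one] at this

lemma Control.D_nonneg (hC : Control Ω B c D β χ d) : 0 ≤ D := by
  simpa [hC.zero] using hC.d_sum 0 0

/-- `g` is the sequence `g_{j+1} = g_j - β_j g_j²` with a small positive initial condition. -/
structure IsGSeq (B D g₀ : ℝ) (β g : ℕ → ℝ) : Prop where
  pos₀ : 0 < g₀
  init : g 0 = g₀
  step : ∀ j, g (j + 1) = g j - β j * g j ^ 2
  smallB : 8 * B * g₀ ≤ 1
  smallD : 8 * D * g₀ ≤ 1
  small_log : Real.log (4 * g₀) ≤ -1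

variable (hc : 0 < c) (hC : Control Ω B c D β χ d) (hg : IsGSeq B D g₀ β g)

include hc hC hg

/-- Since `-β_j ≤ d_j`, the sequence can grow only through the defect, by a factor of at most `exp
(2 g₀ d_j)` per step. The bound by `2 g₀` used for one step is the one proved by the exponential
bound up to that step. -/
lemma IsGSeq.aux (j : ℕ) :
    0 < g j ∧ g j ≤ g₀ * Real.exp (2 * g₀ * ∑ l ∈ Ico 0 j, d l) ∧ g j ≤ 2 * g₀ := by
  have hg0 := hg.pos₀
  have hexp : ∀ j, Real.exp (2 * g₀ * ∑ l ∈ Ico 0 j, d l) ≤ 2 := by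
    intro j
    have h1 := hC.d_sum 0 j
    rw [hC.zero, mul_one] at h1
    have h2 : 2 * g₀ * ∑ l ∈ Ico 0 j, d l ≤ 1 / 2 := by
      have := hg.smallD
      nlinarith
    refine (Real.exp_le_exp.mpr h2).trans ?_
    have := Real.exp_one_lt_d9
    rw [show (1 / 2 : ℝ) = 1 * (1 / 2) by ring, Real.exp_mul, ← Real.sqrt_eq_rpow,
      Real.sqrt_le_left (by norm_num)]
    linarith
  suffices h : 0 < g j ∧ g j ≤ g₀ * Real.exp (2 * g₀ * ∑ l ∈ Ico 0 j, d l) from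
    ⟨h.1, h.2, by nlinarith [hexp j]⟩
  induction j with
  | zero => simp [hg.init, hg0]
  | succ j ih =>
    obtain ⟨ih1, ih2⟩ := ih
    have h2 : g j ≤ 2 * g₀ := by nlinarith [hexp j]
    have hβ := abs_le.mp (hC.β_le j)
    have hχ := hC.pos j
    have hχ1 := hC.chi_le_one j
    have hB := hC.B_nonneg
    have hlow := hC.low j
    have hd : -β j ≤ d j := by nlinarith
    have e : g (j + 1) = g j * (1 - β j * g j) := by rw [hg.step]; ring
    have hβB : β j ≤ B := by nlinarith
    have h3 : β j * g j ≤ 1 / 4 := by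
      have := hg.smallB
      nlinarith
    rw [e]
    refine ⟨mul_pos ih1 (by linarith), ?_⟩
    rw [sum_Ico_succ_top (Nat.zero_le j), mul_add, Real.exp_add, ← mul_assoc]
    refine mul_le_mul ih2 ?_ (by linarith) (by positivity)
    have h4 := Real.add_one_le_exp (2 * g₀ * d j)
    have h5 := hC.d_nonneg j
    nlinarith

lemma IsGSeq.pos (j : ℕ) : 0 < g j := (hg.aux hc hC j).1

lemma IsGSeq.le_two (j : ℕ) : g j ≤ 2 * g₀ := (hg.aux hc hC j).2.2

/-- The growth argument of `IsGSeq.aux`, started at time `j`: the total mass of the remaining defect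
allows only a bounded factor. -/
lemma IsGSeq.almost_anti {j l : ℕ} (hjl : j ≤ l) : g l ≤ 2 * g j := by
  have hg0 := hg.pos₀
  have key : g l ≤ g j * Real.exp (2 * g₀ * ∑ k ∈ Ico j l, d k) := by
    induction l, hjl using Nat.le_induction with
    | base => simp
    | succ l hl ih =>
      have hp := hg.pos hc hC l
      have h2 := hg.le_two hc hC l
      have hχ := hC.pos l
      have hlow := hC.low l
      have hd : -β l ≤ d l := by nlinarith
      have hpj := hg.pos hc hC j
      rw [sum_Ico_succ_top hl, mul_add, Real.exp_add, ← mul_assoc,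
        show g (l + 1) = g l * (1 - β l * g l) by rw [hg.step]; ring]
      have h4 := Real.add_one_le_exp (2 * g₀ * d l)
      have h5 := hC.d_nonneg l
      have h6 : 1 - β l * g l ≤ Real.exp (2 * g₀ * d l) := by nlinarith
      refine (mul_le_mul_of_nonneg_left h6 hp.le).trans ?_
      exact mul_le_mul_of_nonneg_right ih (Real.exp_pos _).le
  have hpj := hg.pos hc hC j
  have h1 := hC.d_sum j l
  have h2 : 2 * g₀ * ∑ k ∈ Ico j l, d k ≤ 1 / 2 := by
    have := hg.smallD
    have := hC.D_nonneg
    have := hC.chi_le_one j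
    have := hC.pos j
    have h7 : ∑ k ∈ Ico j l, d k ≤ D := by nlinarith
    nlinarith
  have h3 : Real.exp (2 * g₀ * ∑ k ∈ Ico j l, d k) ≤ 2 := by
    refine (Real.exp_le_exp.mpr h2).trans ?_
    have := Real.exp_one_lt_d9
    rw [show (1 / 2 : ℝ) = 1 * (1 / 2) by ring, Real.exp_mul, ← Real.sqrt_eq_rpow,
      Real.sqrt_le_left (by norm_num)]
    linarith
  nlinarith

lemma IsGSeq.le_succ (j : ℕ) : (1 - B * g j) * g j ≤ g (j + 1) := by
  have hp := hg.pos hc hC j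
  have hβ := abs_le.mp (hC.β_le j)
  have hB := hC.B_nonneg
  have hβB : β j ≤ B := by nlinarith [hC.chi_le_one j, hC.pos j]
  rw [hg.step]
  nlinarith [mul_pos hp hp]

lemma IsGSeq.le_two_succ (j : ℕ) : g j ≤ 2 * g (j + 1) := by
  have h1 := hg.le_succ hc hC j
  have hp := hg.pos hc hC j
  have h2 := hg.le_two hc hC j
  have := hg.smallB
  have := hC.B_nonneg
  have h3 : B * g j ≤ 1 / 4 := by nlinarith
  nlinarith

/-- The decrease of `χ g` in one step is at least `χ β g²`, hence at least `c χ g²` up to the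
defect. The defect costs `O(g_j²) D χ_j`, which smallness of `D g₀` absorbs into `χ_j g_j`. -/
lemma IsGSeq.sum_sq_le (j n : ℕ) : ∑ l ∈ Ico j n, χ l * g l ^ 2 ≤ 2 / c * (χ j * g j) := by
  have hpj := hg.pos hc hC j
  have hχj := hC.pos j
  rcases le_total n j with hnj | hnj
  · rw [Ico_eq_empty_of_le hnj, sum_empty]
    positivity
  have step : ∀ l ∈ Ico j n,
      c * (χ l * g l ^ 2) ≤ (χ l * g l - χ (l + 1) * g (l + 1)) + 4 * g j ^ 2 * d l := by
    intro l hl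
    have hp := hg.pos hc hC l
    have hp1 := hg.pos hc hC (l + 1)
    have h1 := mul_le_mul_of_nonneg_right (hC.low' l) (sq_nonneg (g l))
    have h2 := mul_le_mul_of_nonneg_right (hC.anti l) hp1.le
    have h3 : χ l * g (l + 1) = χ l * g l - χ l * β l * g l ^ 2 := by rw [hg.step]; ring
    have h4 : g l ^ 2 ≤ 4 * g j ^ 2 := by
      have := hg.almost_anti hc hC (mem_Ico.mp hl).1
      nlinarith
    have h5 := mul_le_mul_of_nonneg_right h4 (hC.d_nonneg l)
    nlinarith
  have h := sum_le_sum step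
  rw [← mul_sum, sum_add_distrib, ← mul_sum, sum_Ico_telescope (fun l => χ l * g l) hnj] at h
  have h1 : 4 * g j ^ 2 * ∑ l ∈ Ico j n, d l ≤ 4 * g j ^ 2 * (D * χ j) :=
    mul_le_mul_of_nonneg_left (hC.d_sum j n) (by positivity)
  have h2 : 0 < χ n * g n := mul_pos (hC.pos n) (hg.pos hc hC n)
  have h3 : 4 * g j ^ 2 * (D * χ j) ≤ χ j * g j := by
    have h4 : 4 * D * g j ≤ 1 := by
      nlinarith [hg.le_two hc hC j, hC.D_nonneg, hg.smallD]
    have : 4 * g j ^ 2 * (D * χ j) = (4 * D * g j) * (χ j * g j) := by ring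
    rw [this]
    have : 0 < χ j * g j := by positivity
    nlinarith
  have h4 : 2 / c * (χ j * g j) = (2 * (χ j * g j)) / c := by ring
  rw [h4, le_div_iff₀ hc]
  linarith

/-- The decrease of `log g` in one step is `-log (1 - β g) ≥ β g`, which is at least `c χ g` up to
the defect; the sum telescopes. -/
lemma IsGSeq.sum_le_log (n : ℕ) : ∑ l ∈ range n, χ l * g l ≤ 1 / c * -Real.log (g n) := by
  have hg0 := hg.pos₀
  have step : ∀ l ∈ range n,
      c * (χ l * g l) ≤ (Real.log (g l) - Real.log (g (l + 1))) + 2 * g₀ * d l := by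
    intro l _
    have hp := hg.pos hc hC l
    have hp1 := hg.pos hc hC (l + 1)
    have h1 := mul_le_mul_of_nonneg_right (hC.low l) hp.le
    have e : g (l + 1) = g l * (1 - β l * g l) := by rw [hg.step]; ring
    have hq : 0 < 1 - β l * g l := by
      rw [e] at hp1
      exact (pos_iff_pos_of_mul_pos hp1).mp hp
    rw [e, Real.log_mul hp.ne' hq.ne']
    have h2 := Real.log_le_sub_one_of_pos hq
    have h3 := mul_le_mul_of_nonneg_right (hg.le_two hc hC l) (hC.d_nonneg l)
    nlinarith
  have h := sum_le_sum step
  rw [← mul_sum, sum_add_distrib, ← mul_sum, sum_range_sub' (fun l => Real.log (g l))] at h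
  have h1 := hC.d_sum 0 n
  rw [hC.zero, mul_one, ← range_eq_Ico] at h1
  -- The whole defect is at most one and is paid for by the boundary term `log g₀ ≤ -1`.
  have h2 : 2 * g₀ * ∑ l ∈ range n, d l ≤ 1 := by
    have := hg.smallD
    nlinarith
  have h3 : Real.log g₀ ≤ -1 :=
    (Real.log_le_log hg0 (by linarith)).trans hg.small_log
  rw [hg.init] at h
  rw [one_div, ← div_eq_inv_mul, le_div_iff₀ hc]
  linarith

lemma IsGSeq.log_two_le (j : ℕ) : Real.log (2 * g j) ≤ -1 :=
  (Real.log_le_log (by have := hg.pos hc hC j; positivity)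
    (by have := hg.le_two hc hC j; linarith)).trans hg.small_log

lemma IsGSeq.mul_log_almost_anti {j l : ℕ} (hjl : j ≤ l) :
    g l * -Real.log (g l) ≤ 2 * (g j * -Real.log (g j)) :=
  mul_neg_log_le (hg.pos hc hC l) (hg.pos hc hC j) (hg.almost_anti hc hC hjl)
    (hg.log_two_le hc hC j)

lemma IsGSeq.log_le (j : ℕ) : Real.log (g j) ≤ -1 :=
  (Real.log_le_log (hg.pos hc hC j) (by have := hg.pos hc hC j; linarith)).trans
    (hg.log_two_le hc hC j)

lemma IsGSeq.log_init_le (j : ℕ) : -Real.log g₀ ≤ 2 * -Real.log (g j) := by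
  have h1 := Real.log_le_log (hg.pos hc hC j) (hg.le_two hc hC j)
  have h2 := hg.small_log
  have h3 : Real.log (4 * g₀) = Real.log 4 + Real.log g₀ :=
    Real.log_mul (by norm_num) hg.pos₀.ne'
  rw [Real.log_mul (by norm_num) hg.pos₀.ne'] at h1
  have h4 : Real.log 4 = 2 * Real.log 2 := by
    rw [show (4 : ℝ) = 2 ^ 2 by norm_num, Real.log_pow]; norm_num
  linarith

/-- The factor `g_l |log g_l|` is at most twice its value at `j`, which reduces the sum to
`IsGSeq.sum_sq_le`. -/
lemma IsGSeq.sum_cube_log_le (j n : ℕ) :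
    ∑ l ∈ Ico j n, χ l * g l ^ 3 * -Real.log (g l) ≤
      4 / c * (χ j * g j ^ 2 * -Real.log (g j)) := by
  have hpj := hg.pos hc hC j
  have hlj := hg.log_le hc hC j
  have h : ∀ l ∈ Ico j n, χ l * g l ^ 3 * -Real.log (g l) ≤
      χ l * g l ^ 2 * (2 * (g j * -Real.log (g j))) := by
    intro l hl
    have h1 := hg.mul_log_almost_anti hc hC (mem_Ico.mp hl).1
    have h2 : 0 ≤ χ l * g l ^ 2 := mul_nonneg (hC.pos l).le (sq_nonneg _)
    calc _ = χ l * g l ^ 2 * (g l * -Real.log (g l)) := by ring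
      _ ≤ _ := mul_le_mul_of_nonneg_left h1 h2
  refine (sum_le_sum h).trans ?_
  rw [← sum_mul]
  have h3 : 0 ≤ 2 * (g j * -Real.log (g j)) := by nlinarith
  refine (mul_le_mul_of_nonneg_right (hg.sum_sq_le hc hC j n) h3).trans (le_of_eq ?_)
  ring

lemma IsGSeq.summable_sq : Summable fun l => χ l * g l ^ 2 := by
  refine summable_of_sum_range_le (c := 2 / c * (χ 0 * g 0))
    (fun l => mul_nonneg (hC.pos l).le (sq_nonneg _)) fun n => ?_
  rw [range_eq_Ico]
  exact hg.sum_sq_le hc hC 0 n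

/-- The sequence `g` alone need not tend to zero when the cut-off is finite. The product does,
because `(χ g)² ≤ χ g²` is summable. -/
lemma IsGSeq.tendsto_chi_mul : Tendsto (fun l => χ l * g l) atTop (𝓝 0) := by
  have h := (hg.summable_sq hc hC).tendsto_atTop_zero
  have h2 : Tendsto (fun l => (χ l * g l) ^ 2) atTop (𝓝 0) := by
    refine squeeze_zero (fun l => sq_nonneg _) (fun l => ?_) h
    rw [mul_pow]
    refine mul_le_mul_of_nonneg_right ?_ (sq_nonneg _)
    have := hC.pos l
    have := hC.chi_le_one l
    nlinarith
  have h3 := h2.sqrt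
  rw [Real.sqrt_zero] at h3
  refine h3.congr fun l => ?_
  rw [Real.sqrt_sq (mul_pos (hC.pos l) (hg.pos hc hC l)).le]

end Sequence

end RGFlow

/-! ### Scalar linear recursions, solved forward and backward -/

namespace RGFlow

open Filter Topology Finset

/-- The partial products of the multipliers `a`. -/
noncomputable def partialProd (a : ℕ → ℝ) (j : ℕ) : ℝ := ∏ k ∈ range j, a k

section Solver

variable {a R Y : ℕ → ℝ}

lemma partialProd_zero (a : ℕ → ℝ) : partialProd a 0 = 1 := by simp [partialProd]

lemma partialProd_succ (a : ℕ → ℝ) (j : ℕ) : partialProd a (j + 1) = a j * partialProd a j := by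
  rw [partialProd, prod_range_succ, mul_comm, partialProd]

lemma partialProd_pos (ha : ∀ k, 0 < a k) (j : ℕ) : 0 < partialProd a j :=
  prod_pos fun k _ => ha k

lemma div_partialProd_succ (ha : ∀ k, 0 < a k) (h : ∀ j, Y (j + 1) = a j * Y j + R j) (j : ℕ) :
    Y (j + 1) / partialProd a (j + 1) =
      Y j / partialProd a j + R j / partialProd a (j + 1) := by
  have h1 := partialProd_pos ha j
  have h2 := ha j
  rw [h, partialProd_succ]
  field_simp

lemma forward_eq (ha : ∀ k, 0 < a k) (h : ∀ j, Y (j + 1) = a j * Y j + R j) (j : ℕ) :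
    Y j = partialProd a j * (Y 0 + ∑ l ∈ range j, R l / partialProd a (l + 1)) := by
  have h1 : Y j / partialProd a j = Y 0 + ∑ l ∈ range j, R l / partialProd a (l + 1) := by
    induction j with
    | zero => simp [partialProd_zero]
    | succ j ih => rw [div_partialProd_succ ha h, ih, sum_range_succ, add_assoc]
  rw [← h1, mul_div_cancel₀ _ (partialProd_pos ha j).ne']

lemma forward_step (ha : ∀ k, 0 < a k) {y₀ : ℝ}
    (h : ∀ j, Y j = partialProd a j * (y₀ + ∑ l ∈ range j, R l / partialProd a (l + 1))) (j : ℕ) :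
    Y (j + 1) = a j * Y j + R j := by
  have h1 := (partialProd_pos ha (j + 1)).ne'
  rw [h (j + 1), h j, sum_range_succ, ← add_assoc, mul_add, mul_div_cancel₀ _ h1,
    partialProd_succ]
  ring

/-- The solution of `Y_{j+1} = a_j Y_j + R_j` that vanishes at infinity. -/
noncomputable def backSol (a R : ℕ → ℝ) (j : ℕ) : ℝ :=
  -(partialProd a j * ∑' l, if j ≤ l then R l / partialProd a (l + 1) else 0)

lemma tsum_tail_eq {s : ℕ → ℝ} (hs : Summable s) (j : ℕ) :
    ∑' l, (if j ≤ l then s l else 0) = ∑' l, s l - ∑ l ∈ range j, s l := by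
  have h1 : ∑ l ∈ range j, s l = ∑' l, (if j ≤ l then 0 else s l) := by
    rw [tsum_eq_sum (s := range j)]
    · exact sum_congr rfl fun l hl => by simp [mem_range.mp hl]
    · intro l hl
      have : j ≤ l := by simpa using hl
      simp [this]
  have hs1 : Summable fun l => if j ≤ l then (0 : ℝ) else s l :=
    summable_of_ne_finset_zero (s := range j) fun l hl => by
      have : j ≤ l := by simpa using hl
      simp [this]
  rw [h1, ← hs.tsum_sub hs1]
  refine tsum_congr fun l => ?_
  split_ifs <;> simp

lemma backSol_step (ha : ∀ k, 0 < a k) (hs : Summable fun l => R l / partialProd a (l + 1))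
    (j : ℕ) : backSol a R (j + 1) = a j * backSol a R j + R j := by
  have h1 := (partialProd_pos ha (j + 1)).ne'
  unfold backSol
  rw [tsum_tail_eq hs, tsum_tail_eq hs, sum_range_succ, ← mul_neg, ← mul_neg,
    ← mul_assoc, ← partialProd_succ]
  field_simp
  ring

/-- Dividing by the partial products turns the recursion into a sum, and the vanishing limit
determines `Y 0`. -/
lemma eq_backSol (ha : ∀ k, 0 < a k) (hs : Summable fun l => R l / partialProd a (l + 1))
    (h : ∀ j, Y (j + 1) = a j * Y j + R j)
    (hlim : Tendsto (fun n => Y n / partialProd a n) atTop (𝓝 0)) (j : ℕ) :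
    Y j = backSol a R j := by
  have h1 : ∀ n, Y n / partialProd a n = Y 0 + ∑ l ∈ range n, R l / partialProd a (l + 1) := by
    intro n
    rw [forward_eq ha h n, mul_div_cancel_left₀ _ (partialProd_pos ha n).ne']
  have h2 : Y 0 + ∑' l, R l / partialProd a (l + 1) = 0 := by
    refine tendsto_nhds_unique ?_ hlim
    simp_rw [h1]
    exact hs.hasSum.tendsto_sum_nat.const_add _
  rw [forward_eq ha h j, backSol, tsum_tail_eq hs, ← mul_neg]
  congr 1
  linarith

lemma summable_div_partialProd (ha : ∀ k, 0 < a k) {K : ℝ}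
    (h : ∀ n, ∑ l ∈ range n, |R l| * (1 / partialProd a (l + 1)) ≤ K) :
    Summable fun l => R l / partialProd a (l + 1) := by
  refine Summable.of_norm (summable_of_sum_range_le (c := K) (fun l => norm_nonneg _) fun n => ?_)
  refine le_trans (le_of_eq (sum_congr rfl fun l _ => ?_)) (h n)
  rw [norm_div, Real.norm_eq_abs, Real.norm_eq_abs, abs_of_pos (partialProd_pos ha _)]
  ring

lemma abs_backSol_le (ha : ∀ k, 0 < a k) {j : ℕ} {K : ℝ}
    (h : ∀ n, ∑ l ∈ Ico j n, |R l| * (partialProd a j / partialProd a (l + 1)) ≤ K) :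
    |backSol a R j| ≤ K := by
  have hp := partialProd_pos ha
  unfold backSol
  rw [abs_neg, ← tsum_mul_left]
  have hterm : ∀ l, ‖partialProd a j * (if j ≤ l then R l / partialProd a (l + 1) else 0)‖ =
      if j ≤ l then |R l| * (partialProd a j / partialProd a (l + 1)) else 0 := by
    intro l
    split_ifs
    · rw [norm_mul, norm_div, Real.norm_eq_abs, Real.norm_eq_abs, Real.norm_eq_abs,
        abs_of_pos (hp j), abs_of_pos (hp _)]
      ring
    · simp
  have hfin : ∀ n, ∑ l ∈ range n,
      ‖partialProd a j * (if j ≤ l then R l / partialProd a (l + 1) else 0)‖ ≤ K := by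
    intro n
    simp_rw [hterm]
    refine le_trans (le_of_eq ?_) (h n)
    rw [← sum_filter]
    refine sum_congr ?_ fun _ _ => rfl
    ext l
    simp [and_comm]
  have hsum := summable_of_sum_range_le (fun l => norm_nonneg _) hfin
  refine (norm_tsum_le_tsum_norm hsum).trans ?_
  exact hsum.tsum_le_of_sum_range_le hfin

/-- Each term, multiplied by `lam - 1`, is at most a difference of consecutive ratios `partialProd a
j / partialProd a l`. -/
lemma sum_ratio_le {lam : ℝ} (hlam : 1 < lam) (ha : ∀ k, lam ≤ a k) (j n : ℕ) :
    ∑ l ∈ Ico j n, partialProd a j / partialProd a (l + 1) ≤ 1 / (lam - 1) := by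
  have ha0 : ∀ k, 0 < a k := fun k => by linarith [ha k]
  have hp := partialProd_pos ha0
  have h1 : 0 < lam - 1 := by linarith
  rcases le_total n j with hnj | hnj
  · rw [Ico_eq_empty_of_le hnj, sum_empty]
    positivity
  rw [le_div_iff₀ h1, sum_mul]
  have step : ∀ l ∈ Ico j n, partialProd a j / partialProd a (l + 1) * (lam - 1) ≤
      partialProd a j / partialProd a l - partialProd a j / partialProd a (l + 1) := by
    intro l _
    have e : partialProd a j / partialProd a l =
        a l * (partialProd a j / partialProd a (l + 1)) := by
      have := (hp l).ne'
      have := (ha0 l).ne'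
      rw [partialProd_succ]
      field_simp
    rw [e]
    have : 0 < partialProd a j / partialProd a (l + 1) := div_pos (hp _) (hp _)
    nlinarith [ha l]
  refine (sum_le_sum step).trans ?_
  rw [sum_Ico_telescope (fun l => partialProd a j / partialProd a l) hnj, div_self (hp j).ne']
  have : 0 < partialProd a j / partialProd a n := div_pos (hp _) (hp _)
  linarith

lemma one_le_partialProd (ha : ∀ k, 1 ≤ a k) (j : ℕ) : 1 ≤ partialProd a j := by
  induction j with
  | zero => simp [partialProd_zero]
  | succ j ih => rw [partialProd_succ]; nlinarith [ha j]

/-- The product of the factors `1 - e_k` is at least `1 - ∑ e_k ≥ 1/2`. -/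
lemma partialProd_le_two_mul {e : ℕ → ℝ} {j l : ℕ} (hjl : j ≤ l) (ha : ∀ k, 0 < a k)
    (he : ∀ k, 1 - e k ≤ a k) (he0 : ∀ k, 0 ≤ e k)
    (hsum : ∀ n, ∑ k ∈ Ico j n, e k ≤ 1 / 2) :
    partialProd a j ≤ 2 * partialProd a l := by
  have hp := partialProd_pos ha
  suffices h : partialProd a j * (1 - ∑ k ∈ Ico j l, e k) ≤ partialProd a l by
    nlinarith [hsum l, hp j]
  induction l, hjl using Nat.le_induction with
  | base => simp
  | succ l hl ih =>
    rw [sum_Ico_succ_top hl, partialProd_succ]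
    have h1 := hsum l
    have h2 := hsum (l + 1)
    rw [sum_Ico_succ_top hl] at h2
    have h3 : 0 ≤ ∑ k ∈ Ico j l, e k := sum_nonneg fun k _ => he0 k
    have h4 := he0 l
    have h5 : (1 - e l) * (partialProd a j * (1 - ∑ k ∈ Ico j l, e k)) ≤
        a l * partialProd a l :=
      mul_le_mul (he l) ih (mul_nonneg (hp j).le (by linarith)) (ha l).le
    refine le_trans ?_ h5
    have := mul_nonneg (hp j).le (mul_nonneg h4 h3)
    nlinarith

end Solver

end RGFlow

/-! ### The quadratic flow: existence, uniqueness and a priori bounds -/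

namespace RGFlow

open Filter Topology Finset

/-- The consequences of (A1) and (A2) in terms of defects `d`, `e` of small total mass. -/
structure FlowControl (Ω B c D lam₀ C₀ : ℝ) (p : Params) (d e : ℕ → ℝ) : Prop where
  ctl : Control Ω B c D p.β (chi Ω p.β) d
  A2 : AssumptionA2 Ω c lam₀ C₀ p
  e_nonneg : ∀ j, 0 ≤ e j
  ζ_le_e : ∀ j, p.ζ j ≤ e j
  e_sum : ∀ j n, ∑ l ∈ Ico j n, e l ≤ D * chi Ω p.β j

/-- The total mass of the defects. -/
noncomputable def defectMass (Ω B c C₀ : ℝ) : ℝ := (c + B + C₀) * (c⁻¹ + Ω / (Ω - 1))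

lemma exists_flowControl {Ω B c lam₀ C₀ : ℝ} (hΩ : 1 < Ω) (hc : 0 < c) {p : Params}
    (h1 : AssumptionA1 Ω B c p) (h2 : AssumptionA2 Ω c lam₀ C₀ p) :
    ∃ d e, FlowControl Ω B c (defectMass Ω B c C₀) lam₀ C₀ p d e := by
  obtain ⟨d, hd⟩ := exists_control hΩ hc h1
  obtain ⟨e, he0, he1, he2⟩ := exists_zeta_defect hΩ hc h2
  have hC : 0 ≤ C₀ := by
    have := (abs_nonneg _).trans (h2.ζ_le 0)
    rwa [chi_zero, mul_one] at this
  have hB := hd.B_nonneg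
  have hK : 0 ≤ c⁻¹ + Ω / (Ω - 1) := by
    have : 0 < Ω - 1 := by linarith
    positivity
  refine ⟨d, e, ⟨hd.pos, hd.zero, hd.anti, hd.ratio, hd.β_le, hd.d_nonneg, hd.low, hd.low',
    fun j n => (hd.d_sum j n).trans ?_⟩, h2, he0, he1, fun j n => (he2 j n).trans ?_⟩
  · refine mul_le_mul_of_nonneg_right (mul_le_mul_of_nonneg_right ?_ hK) (hd.pos j).le
    linarith
  · refine mul_le_mul_of_nonneg_right (mul_le_mul_of_nonneg_right ?_ hK) (hd.pos j).le
    linarith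

lemma FlowControl.C₀_nonneg {Ω B c D lam₀ C₀ : ℝ} {p : Params} {d e : ℕ → ℝ}
    (h : FlowControl Ω B c D lam₀ C₀ p d e) : 0 ≤ C₀ := by
  have := (abs_nonneg _).trans (h.A2.ζ_le 0)
  rwa [chi_zero, mul_one] at this

/-- The constant in `|z̄_j| ≤ C χ_j ḡ_j`. -/
noncomputable def zConst (c C₀ : ℝ) : ℝ := 4 * C₀ / c

/-- The constant in `|μ̄_j| ≤ C χ_j ḡ_j`. -/
noncomputable def μConst (c lam₀ C₀ : ℝ) : ℝ := 4 * C₀ * (3 + 2 * zConst c C₀) / (lam₀ - 1)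

/-- The smallness constant for the existence of the quadratic flow. -/
noncomputable def flowConst (B c D lam₀ C₀ : ℝ) : ℝ :=
  8 * B + 8 * D + 4 + 4 * zConst c C₀ + 8 * (C₀ * (1 + zConst c C₀)) / (lam₀ - 1)

/-- A flow of `φ̄` with vanishing final condition, together with its a priori bounds. -/
structure BaseFlow (Ω B c D lam₀ C₀ : ℝ) (p : Params) (g₀ : ℝ) (V : ℕ → VSpace) : Prop where
  isFlow : IsQuadFlow p g₀ V
  gseq : IsGSeq B D g₀ p.β fun j => (V j).1
  z_le : ∀ j, |(V j).2.1| ≤ zConst c C₀ * (chi Ω p.β j * (V j).1)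
  μ_le : ∀ j, |(V j).2.2| ≤ μConst c lam₀ C₀ * (chi Ω p.β j * (V j).1)

/-- The sequence `g_{j+1} = g_j - β_j g_j²`. -/
noncomputable def gSeq (β : ℕ → ℝ) (g₀ : ℝ) : ℕ → ℝ
  | 0 => g₀
  | j + 1 => gSeq β g₀ j - β j * gSeq β g₀ j ^ 2

section

variable {Ω B c D lam₀ C₀ g₀ : ℝ} {p : Params} {d e g : ℕ → ℝ}

/-- A nonpositive `ζ_k` gives a multiplier at least one, which helps when solving backward. Positive
`ζ_k` are bounded by the defect `e`, whose total effect is `O(D g₀)`. -/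
lemma zeta_mult_bounds (hc : 0 < c) (hF : FlowControl Ω B c D lam₀ C₀ p d e)
    (hg : IsGSeq B D g₀ p.β g) :
    (∀ k, 0 < 1 - p.ζ k * g k) ∧ ∀ j l, j ≤ l →
      partialProd (fun k => 1 - p.ζ k * g k) j ≤
        2 * partialProd (fun k => 1 - p.ζ k * g k) l := by
  have hg0 := hg.pos₀
  have hD := hg.smallD
  have hmul : ∀ k, 1 - 2 * g₀ * e k ≤ 1 - p.ζ k * g k := by
    intro k
    have h1 := hg.pos hc hF.ctl k
    have h2 := hg.le_two hc hF.ctl k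
    have h3 := hF.e_nonneg k
    have h4 := hF.ζ_le_e k
    nlinarith
  have hD0 := hF.ctl.D_nonneg
  have hsum : ∀ j n, ∑ k ∈ Ico j n, 2 * g₀ * e k ≤ 1 / 2 := by
    intro j n
    rw [← mul_sum]
    have h1 := hF.e_sum j n
    have h2 := hF.ctl.chi_le_one j
    have h3 : ∑ k ∈ Ico j n, e k ≤ D := by nlinarith
    nlinarith
  have hpos : ∀ k, 0 < 1 - p.ζ k * g k := by
    intro k
    have := hsum k (k + 1)
    simp only [Nat.Ico_succ_singleton, sum_singleton] at this
    linarith [hmul k]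
  refine ⟨hpos, fun j l hjl => partialProd_le_two_mul hjl hpos hmul
    (fun k => mul_nonneg (by linarith) (hF.e_nonneg k)) (hsum j)⟩

/-- Backward sums with the `z`-multipliers are controlled by sums without multipliers. -/
lemma sum_zeta_ratio_le (hc : 0 < c) (hF : FlowControl Ω B c D lam₀ C₀ p d e)
    (hg : IsGSeq B D g₀ p.β g) {v : ℕ → ℝ} (hv : ∀ l, 0 ≤ v l) (j n : ℕ) :
    ∑ l ∈ Ico j n, v l * (partialProd (fun k => 1 - p.ζ k * g k) j /
      partialProd (fun k => 1 - p.ζ k * g k) (l + 1)) ≤ 2 * ∑ l ∈ Ico j n, v l := by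
  obtain ⟨hpos, h2⟩ := zeta_mult_bounds hc hF hg
  rw [mul_sum]
  refine sum_le_sum fun l hl => ?_
  rw [mul_comm 2]
  refine mul_le_mul_of_nonneg_left ?_ (hv l)
  rw [div_le_iff₀ (partialProd_pos hpos _)]
  exact h2 j (l + 1) (by have := (mem_Ico.mp hl).1; omega)

/-- Backward sums with expanding multipliers. -/
lemma sum_expanding_ratio_le {lam M : ℝ} {a v : ℕ → ℝ} (hlam : 1 < lam) (ha : ∀ k, lam ≤ a k)
    {j : ℕ} (hv : ∀ l, j ≤ l → v l ≤ M) (hM : 0 ≤ M) (n : ℕ) :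
    ∑ l ∈ Ico j n, v l * (partialProd a j / partialProd a (l + 1)) ≤ M * (1 / (lam - 1)) := by
  have hp := partialProd_pos (a := a) fun k => by linarith [ha k]
  refine le_trans (sum_le_sum fun l hl => mul_le_mul_of_nonneg_right
    (hv l (mem_Ico.mp hl).1) (div_pos (hp _) (hp _)).le) ?_
  rw [← mul_sum]
  exact mul_le_mul_of_nonneg_left (sum_ratio_le hlam ha j n) hM

lemma tendsto_div_partialProd {a Y : ℕ → ℝ} {K : ℝ} (hK : 0 < K)
    (ha : ∀ j, K ≤ partialProd a j) (hY : Tendsto Y atTop (𝓝 0)) :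
    Tendsto (fun n => Y n / partialProd a n) atTop (𝓝 0) := by
  have h1 := hY.abs.div_const K
  rw [abs_zero, zero_div] at h1
  refine squeeze_zero_norm (fun n => ?_) h1
  have h2 : 0 < partialProd a n := hK.trans_le (ha n)
  rw [norm_div, Real.norm_eq_abs, Real.norm_eq_abs, abs_of_pos h2]
  exact div_le_div_of_nonneg_left (abs_nonneg _) hK (ha n)

/-- By triangularity each component solves a scalar linear recursion once the preceding ones are
known. The terms `υgμ g μ` and `υzμ z μ` are linear in `μ` and go into its multipliers. Backward
solvability of `z` rests on `∑ χ g²`, that of `μ` on expansion; uniqueness is `eq_backSol`. -/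
theorem exists_baseFlow (hc : 0 < c) (hlam : 1 < lam₀)
    (hF : FlowControl Ω B c D lam₀ C₀ p d e) (hg₀ : 0 < g₀)
    (hS : Small (flowConst B c D lam₀ C₀) (4 * g₀)) :
    ∃ V, BaseFlow Ω B c D lam₀ C₀ p g₀ V ∧ ∀ V', IsQuadFlow p g₀ V' → V' = V := by
  have hC₀ := hF.C₀_nonneg
  have hB := hF.ctl.B_nonneg
  have hD := hF.ctl.D_nonneg
  have hl : 0 < lam₀ - 1 := by linarith
  set Cz := zConst c C₀ with hCz
  have hCz0 : 0 ≤ Cz := by rw [hCz, zConst]; positivity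
  set Q := C₀ * (1 + Cz) / (lam₀ - 1) with hQ
  have hQ0 : 0 ≤ Q := by rw [hQ]; positivity
  have hAe : flowConst B c D lam₀ C₀ = 8 * B + 8 * D + 4 + 4 * Cz + 8 * Q := by
    rw [flowConst, hQ]; ring
  have hA0 : 0 ≤ flowConst B c D lam₀ C₀ := by rw [hAe]; positivity
  obtain ⟨-, hlog⟩ := hS (4 * g₀) (by linarith) le_rfl
  have hlin := (hS.linear hA0 (by linarith : 0 < 4 * g₀) le_rfl).1
  rw [hAe] at hlin
  have nB := mul_nonneg hB hg₀.le
  have nD := mul_nonneg hD hg₀.le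
  have nz := mul_nonneg hCz0 hg₀.le
  have nQ := mul_nonneg hQ0 hg₀.le
  set g := gSeq p.β g₀ with hgdef
  have hg : IsGSeq B D g₀ p.β g :=
    ⟨hg₀, rfl, fun j => rfl, by nlinarith, by nlinarith, by linarith⟩
  have hgp := hg.pos hc hF.ctl
  have hg2 := hg.le_two hc hF.ctl
  have hχ := hF.ctl.pos
  have hχ1 := hF.ctl.chi_le_one
  obtain ⟨hzpos, hz2⟩ := zeta_mult_bounds hc hF hg
  -- the sequence `z`
  set az : ℕ → ℝ := fun k => 1 - p.ζ k * g k with haz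
  set Rz : ℕ → ℝ := fun k => -(p.θ k * g k ^ 2) with hRz
  have hRzle : ∀ l, |Rz l| ≤ C₀ * (chi Ω p.β l * g l ^ 2) := by
    intro l
    rw [hRz]
    simp only [abs_neg, abs_mul, abs_of_nonneg (sq_nonneg (g l)), ← mul_assoc]
    exact mul_le_mul_of_nonneg_right (hF.A2.θ_le l) (sq_nonneg _)
  have hzsum : ∀ j n, ∑ l ∈ Ico j n, |Rz l| * (partialProd az j / partialProd az (l + 1)) ≤
      Cz * (chi Ω p.β j * g j) := by
    intro j n
    refine (sum_zeta_ratio_le hc hF hg (fun l => abs_nonneg (Rz l)) j n).trans ?_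
    have h1 := sum_le_sum fun l (_ : l ∈ Ico j n) => hRzle l
    rw [← mul_sum] at h1
    have h2 := mul_le_mul_of_nonneg_left (hg.sum_sq_le hc hF.ctl j n) hC₀
    have : Cz * (chi Ω p.β j * g j) = 2 * (C₀ * (2 / c * (chi Ω p.β j * g j))) := by
      rw [hCz, zConst]; ring
    linarith
  have hzsummable : Summable fun l => Rz l / partialProd az (l + 1) := by
    refine summable_div_partialProd hzpos (K := Cz * (chi Ω p.β 0 * g 0)) fun n => ?_
    have := hzsum 0 n
    rwa [partialProd_zero, ← range_eq_Ico] at this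
  set z := backSol az Rz with hzdef
  have hzle : ∀ j, |z j| ≤ Cz * (chi Ω p.β j * g j) := fun j =>
    abs_backSol_le hzpos (hzsum j)
  have hχg : ∀ j, chi Ω p.β j * g j ≤ g j := fun j => by nlinarith [hχ1 j, hgp j]
  have hχg0 : ∀ j, 0 < chi Ω p.β j * g j := fun j => mul_pos (hχ j) (hgp j)
  have hzg : ∀ j, |z j| ≤ Cz * g j := fun j =>
    (hzle j).trans (mul_le_mul_of_nonneg_left (hχg j) hCz0)
  have hzg1 : ∀ j, Cz * g j ≤ 1 := fun j => by nlinarith [hg2 j]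
  have hg1 : ∀ j, g j ≤ 1 := fun j => by nlinarith [hg2 j]
  -- the sequence `μ`
  set aμ : ℕ → ℝ := fun k => p.lam k - p.υgμ k * g k - p.υzμ k * z k with haμ
  set Rμ : ℕ → ℝ := fun k => p.η k * g k + p.γ k * z k
    - (p.υgg k * g k ^ 2 + p.υgz k * g k * z k + p.υzz k * z k ^ 2) with hRμ
  -- Half of the gap `lam₀ - 1` is given up to the corrections, which are of order `g`.
  have haμle : ∀ k, (1 + lam₀) / 2 ≤ aμ k := by
    intro k
    have h1 := hF.A2.lam_ge k
    have h2 : |p.υgμ k * g k| ≤ C₀ * g k := by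
      rw [abs_mul, abs_of_pos (hgp k)]
      refine mul_le_mul_of_nonneg_right ((hF.A2.υgμ_le k).trans ?_) (hgp k).le
      exact mul_le_of_le_one_right hC₀ (hχ1 k)
    have h3 : |p.υzμ k * z k| ≤ C₀ * (Cz * g k) := by
      rw [abs_mul]
      refine mul_le_mul ((hF.A2.υzμ_le k).trans ?_) (hzg k) (abs_nonneg _) hC₀
      exact mul_le_of_le_one_right hC₀ (hχ1 k)
    have h4 : C₀ * (1 + Cz) = Q * (lam₀ - 1) := by rw [hQ]; field_simp
    have h5 : Q * g k ≤ 1 / 2 := by nlinarith [hg2 k]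
    have h6 : C₀ * g k + C₀ * (Cz * g k) ≤ (lam₀ - 1) / 2 := by
      have : C₀ * g k + C₀ * (Cz * g k) = (Q * g k) * (lam₀ - 1) := by
        rw [mul_right_comm, ← h4]; ring
      rw [this]
      nlinarith
    have := (abs_le.mp h2).2
    have := (abs_le.mp h3).2
    simp only [haμ]
    linarith
  have hlam' : 1 < (1 + lam₀) / 2 := by linarith
  have haμpos : ∀ k, 0 < aμ k := fun k => by linarith [haμle k]
  set Cr := C₀ * (3 + 2 * Cz) with hCr
  have hCr0 : 0 ≤ Cr := by rw [hCr]; positivity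
  have hRμle : ∀ k, |Rμ k| ≤ Cr * (chi Ω p.β k * g k) := by
    intro k
    have hX : 0 ≤ C₀ * chi Ω p.β k := mul_nonneg hC₀ (hχ k).le
    have t1 : |p.η k * g k| ≤ C₀ * chi Ω p.β k * g k := by
      rw [abs_mul, abs_of_pos (hgp k)]
      exact mul_le_mul_of_nonneg_right (hF.A2.η_le k) (hgp k).le
    have t2 : |p.γ k * z k| ≤ C₀ * chi Ω p.β k * (Cz * g k) := by
      rw [abs_mul]
      exact mul_le_mul (hF.A2.γ_le k) (hzg k) (abs_nonneg _) hX
    have t3 : |p.υgg k * g k ^ 2| ≤ C₀ * chi Ω p.β k * g k := by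
      rw [abs_mul, abs_of_nonneg (sq_nonneg (g k))]
      refine mul_le_mul (hF.A2.υgg_le k) ?_ (sq_nonneg _) hX
      nlinarith [hg1 k, hgp k]
    have t4 : |p.υgz k * g k * z k| ≤ C₀ * chi Ω p.β k * g k := by
      rw [abs_mul, abs_mul, abs_of_pos (hgp k), mul_assoc]
      refine mul_le_mul (hF.A2.υgz_le k) ?_ (by have := hgp k; positivity) hX
      have := (hzg k).trans (hzg1 k)
      nlinarith [hgp k]
    have t5 : |p.υzz k * z k ^ 2| ≤ C₀ * chi Ω p.β k * (Cz * g k) := by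
      rw [abs_mul, abs_of_nonneg (sq_nonneg (z k))]
      refine mul_le_mul (hF.A2.υzz_le k) ?_ (sq_nonneg _) hX
      have h1 := hzg k
      have h2 := (hzg k).trans (hzg1 k)
      rw [← sq_abs]
      nlinarith [abs_nonneg (z k)]
    have e : Cr * (chi Ω p.β k * g k) = C₀ * chi Ω p.β k * g k + C₀ * chi Ω p.β k * (Cz * g k) +
        C₀ * chi Ω p.β k * g k + C₀ * chi Ω p.β k * g k + C₀ * chi Ω p.β k * (Cz * g k) := by
      rw [hCr]; ring
    rw [e]
    simp only [hRμ]
    rw [abs_le] at *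
    constructor <;> linarith [t1.1, t1.2, t2.1, t2.2, t3.1, t3.2, t4.1, t4.2, t5.1, t5.2]
  have hμsum : ∀ j n, ∑ l ∈ Ico j n, |Rμ l| * (partialProd aμ j / partialProd aμ (l + 1)) ≤
      μConst c lam₀ C₀ * (chi Ω p.β j * g j) := by
    intro j n
    refine (sum_expanding_ratio_le (M := 2 * Cr * (chi Ω p.β j * g j)) hlam' haμle
      (fun l hl => (hRμle l).trans ?_) (mul_nonneg (by linarith) (hχg0 j).le) n).trans
        (le_of_eq ?_)
    · have h1 := hg.almost_anti hc hF.ctl hl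
      have h2 : chi Ω p.β l * g l ≤ chi Ω p.β j * (2 * g j) :=
        mul_le_mul (hF.ctl.chi_anti hl) h1 (hgp l).le (hχ j).le
      nlinarith
    · rw [μConst, ← hCz, show (1 + lam₀) / 2 - 1 = (lam₀ - 1) / 2 by ring, hCr]
      field_simp
      ring
  have hμsummable : Summable fun l => Rμ l / partialProd aμ (l + 1) := by
    refine summable_div_partialProd haμpos (K := μConst c lam₀ C₀ * (chi Ω p.β 0 * g 0))
      fun n => ?_
    have := hμsum 0 n
    rwa [partialProd_zero, ← range_eq_Ico] at this
  set μ := backSol aμ Rμ with hμdef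
  have hμle : ∀ j, |μ j| ≤ μConst c lam₀ C₀ * (chi Ω p.β j * g j) := fun j =>
    abs_backSol_le haμpos (hμsum j)
  have hlim0 := hg.tendsto_chi_mul hc hF.ctl
  -- Lower bounds on the partial products turn convergence of `z` and `μ` to zero into the limit
  -- that `eq_backSol` requires.
  have hPz : ∀ j, (1 : ℝ) / 2 ≤ partialProd az j := fun j => by
    have := hz2 0 j (Nat.zero_le j)
    rw [partialProd_zero] at this
    linarith
  have hPμ : ∀ j, (1 : ℝ) ≤ partialProd aμ j := fun j =>
    one_le_partialProd (fun k => by linarith [haμle k]) j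
  refine ⟨fun j => (g j, z j, μ j), ⟨⟨fun j => ?_, rfl, ?_, ?_⟩, hg, hzle, hμle⟩, fun V' hV' => ?_⟩
  · simp only [quadMap]
    refine Prod.ext rfl (Prod.ext ?_ ?_)
    · simp only [hzdef]
      rw [backSol_step hzpos hzsummable]
      simp only [haz, hRz]
      ring
    · simp only [hμdef]
      rw [backSol_step haμpos hμsummable]
      simp only [haμ, hRμ]
      ring
  · refine squeeze_zero_norm hzle ?_
    simpa using hlim0.const_mul Cz
  · refine squeeze_zero_norm hμle ?_
    simpa using hlim0.const_mul (μConst c lam₀ C₀)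
  · have e1 : ∀ j, (V' j).1 = g j := by
      intro j
      induction j with
      | zero => exact hV'.init
      | succ j ih =>
        rw [hV'.step, quadMap]
        simp only [ih]
        rfl
    have e2 : ∀ j, (V' j).2.1 = z j := by
      refine eq_backSol hzpos hzsummable (fun j => ?_)
        (tendsto_div_partialProd (by norm_num) hPz hV'.z_lim)
      simp only [hV'.step j, quadMap, e1, haz, hRz]
      ring
    have e3 : ∀ j, (V' j).2.2 = μ j := by
      refine eq_backSol haμpos hμsummable (fun j => ?_)
        (tendsto_div_partialProd one_pos hPμ hV'.μ_lim)
      simp only [hV'.step j, quadMap, e1, e2, haμ, hRμ]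
      ring
    funext j
    exact Prod.ext (e1 j) (Prod.ext (e2 j) (e3 j))

/-- For small `g₀`, `quadFlow p g₀` is the unique flow and satisfies the a priori bounds. -/
theorem quadFlow_spec (hc : 0 < c) (hlam : 1 < lam₀)
    (hF : FlowControl Ω B c D lam₀ C₀ p d e) (hg₀ : 0 < g₀)
    (hS : Small (flowConst B c D lam₀ C₀) (4 * g₀)) :
    BaseFlow Ω B c D lam₀ C₀ p g₀ (quadFlow p g₀) ∧
      ∀ V', IsQuadFlow p g₀ V' → V' = quadFlow p g₀ := by
  obtain ⟨V, hV, huniq⟩ := exists_baseFlow hc hlam hF hg₀ hS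
  have h1 : IsQuadFlow p g₀ (quadFlow p g₀) := Classical.epsilon_spec ⟨V, hV.isFlow⟩
  have h2 := huniq _ h1
  rw [h2]
  exact ⟨hV, huniq⟩

end

end RGFlow

/-! ### Contractions with a parameter -/

namespace RGFlow

open Filter Topology Metric

section FixedPoint

variable {E P : Type*} [NormedAddCommGroup E] [NormedSpace ℝ E] [CompleteSpace E]
  [NormedAddCommGroup P] [NormedSpace ℝ P]

/-- The map `y - G y` differs from the identity by a `θ`-Lipschitz map, so it sends the ball of
radius `1/2` onto a set that contains the ball of radius `(1 - θ)/2` about its value at zero. -/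
lemma exists_fixedPoint {G : E → E} {θ : ℝ} (hθ : 0 ≤ θ)
    (hLip : ∀ y ∈ closedBall (0 : E) (1 / 2), ∀ y' ∈ closedBall (0 : E) (1 / 2),
      ‖G y - G y'‖ ≤ θ * ‖y - y'‖) {w : E}
    (hw : ‖G 0 + w‖ ≤ (1 - θ) / 2) : ∃ y ∈ closedBall (0 : E) (1 / 2), y = G y + w := by
  have happ : ApproximatesLinearOn (fun y => y - G y) (ContinuousLinearMap.id ℝ E)
      (closedBall (0 : E) (1 / 2)) ⟨θ, hθ⟩ := by
    intro y hy y' hy'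
    have e : y - G y - (y' - G y') - (ContinuousLinearMap.id ℝ E) (y - y') = -(G y - G y') := by
      simp only [ContinuousLinearMap.id_apply]
      abel
    rw [e, norm_neg]
    exact hLip y hy y' hy'
  let inv : (ContinuousLinearMap.id ℝ E).NonlinearRightInverse :=
    ⟨id, 1, fun y => by simp, fun y => by simp⟩
  obtain ⟨y, hy, hyw⟩ := happ.surjOn_closedBall_of_nonlinearRightInverse inv
    (by norm_num : (0 : ℝ) ≤ 1 / 2) le_rfl (show w ∈ _ by
      rw [mem_closedBall, dist_eq_norm, zero_sub, sub_neg_eq_add, add_comm]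
      refine hw.trans (le_of_eq ?_)
      change _ = (((1 : NNReal) : ℝ)⁻¹ - θ) * (1 / 2)
      norm_num
      ring)
  exact ⟨y, hy, sub_eq_iff_eq_add'.mp hyw⟩

/-- The solution `Y u` of `y = G y + L u` for a contraction `G` of class `C¹`. -/
theorem exists_smooth_fixedPoint {G : E → E} {Box : Set E} {θ : ℝ} (hθ : 0 ≤ θ) (hθ1 : θ < 1)
    (hLip : ∀ y ∈ Box, ∀ y' ∈ Box, ‖G y - G y'‖ ≤ θ * ‖y - y'‖)
    (hBox : ball (0 : E) 1 ⊆ Box) (hG : ContDiffOn ℝ 1 G (ball 0 1))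
    (h0 : ‖G 0‖ ≤ (1 - θ) / 4) (L : P →L[ℝ] E) :
    ∃ Y : P → E, (∀ u, ‖L u‖ < (1 - θ) / 4 →
        ‖Y u‖ ≤ 1 / 2 ∧ Y u = G (Y u) + L u ∧ (∀ y ∈ Box, y = G y + L u → y = Y u) ∧
        ∀ v, ‖fderiv ℝ Y u v‖ ≤ ‖L v‖ / (1 - θ)) ∧
      (∀ u u', ‖L u‖ < (1 - θ) / 4 → ‖L u'‖ < (1 - θ) / 4 →
        ‖Y u - Y u'‖ ≤ ‖L (u - u')‖ / (1 - θ)) ∧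
      ContDiffOn ℝ 1 Y {u | ‖L u‖ < (1 - θ) / 4} := by
  have h1θ : 0 < 1 - θ := by linarith
  have hcb : closedBall (0 : E) (1 / 2) ⊆ ball 0 1 := closedBall_subset_ball (by norm_num)
  have hex : ∀ u, ‖L u‖ < (1 - θ) / 4 → ∃ y ∈ closedBall (0 : E) (1 / 2), y = G y + L u := by
    intro u hu
    refine exists_fixedPoint hθ (fun y hy y' hy' => hLip y (hBox (hcb hy)) y' (hBox (hcb hy'))) ?_
    refine (norm_add_le _ _).trans ?_
    linarith
  choose! Y hY1 hY2 using hex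
  -- Stability gives both uniqueness in `Box` (take `u = u'`) and Lipschitz dependence on the
  -- parameter.
  have hstab : ∀ u u' y y', y ∈ Box → y' ∈ Box → y = G y + L u → y' = G y' + L u' →
      ‖y - y'‖ ≤ ‖L (u - u')‖ / (1 - θ) := by
    intro u u' y y' hy hy' e e'
    have h1 : y - y' = (G y - G y') + L (u - u') := by
      conv_lhs => rw [e, e']
      rw [map_sub]
      abel
    have h2 : ‖y - y'‖ ≤ ‖G y - G y'‖ + ‖L (u - u')‖ := by
      conv_lhs => rw [h1]
      exact norm_add_le _ _
    rw [le_div_iff₀ h1θ]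
    nlinarith [hLip y hy y' hy']
  have huniq : ∀ u, ‖L u‖ < (1 - θ) / 4 → ∀ y ∈ Box, y = G y + L u → y = Y u := by
    intro u hu y hy e
    have := hstab u u y (Y u) hy (hBox (hcb (hY1 u hu))) e (hY2 u hu)
    rw [sub_self, map_zero, norm_zero, zero_div] at this
    exact sub_eq_zero.mp (norm_le_zero_iff.mp this)
  have hopen : IsOpen {u | ‖L u‖ < (1 - θ) / 4} := isOpen_lt (by fun_prop) continuous_const
  have hGd : ∀ y ∈ ball (0 : E) 1, ‖fderiv ℝ G y‖ ≤ θ := fun y hy =>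
    norm_fderiv_le_of_lip' ℝ hθ (by
      filter_upwards [isOpen_ball.mem_nhds hy] with x hx using hLip x (hBox hx) y (hBox hy))
  have hsmooth : ∀ u, ‖L u‖ < (1 - θ) / 4 → ContDiffAt ℝ 1 Y u := by
    intro u hu
    have hyb := hcb (hY1 u hu)
    have hGat : ContDiffAt ℝ 1 G (Y u) := hG.contDiffAt (isOpen_ball.mem_nhds hyb)
    set T := fderiv ℝ G (Y u) with hT
    have hTn : ‖T‖ < 1 := (hGd _ hyb).trans_lt hθ1
    set A : E ≃L[ℝ] E := ContinuousLinearEquiv.ofUnit (Units.oneSub T hTn) with hA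
    have hFat : ContDiffAt ℝ 1 (fun y => y - G y) (Y u) := contDiffAt_id.sub hGat
    have hFd : HasFDerivAt (fun y => y - G y) (A : E →L[ℝ] E) (Y u) := by
      have h := (hasFDerivAt_id (𝕜 := ℝ) (Y u)).sub
        (hGat.differentiableAt one_ne_zero).hasFDerivAt
      exact h
    have hFs : HasStrictFDerivAt (fun y => y - G y) (A : E →L[ℝ] E) (Y u) :=
      hFat.hasStrictFDerivAt' hFd one_ne_zero
    have e0 : Y u - G (Y u) = L u := sub_eq_iff_eq_add'.mpr (hY2 u hu)
    have hinv := hFat.to_localInverse hFd one_ne_zero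
    rw [e0] at hinv
    have hr := hFs.eventually_right_inverse
    have hcont := hFs.localInverse_continuousAt
    have himg := hFs.localInverse_apply_image
    simp only [e0] at hr hcont himg
    have hLc : ContinuousAt L u := L.continuous.continuousAt
    -- The derivative `1 - T` of `y - G y` is invertible as `‖T‖ ≤ θ < 1`. By uniqueness in `Box`,
    -- the solution is locally the `C¹` inverse function composed with `L`.
    have ev : Y =ᶠ[𝓝 u] fun u' => hFs.localInverse _ _ _ (L u') := by
      have hb : ∀ᶠ w in 𝓝 (L u), hFs.localInverse _ _ _ w ∈ ball (0 : E) 1 :=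
        hcont.eventually (by rw [himg]; exact isOpen_ball.mem_nhds hyb)
      filter_upwards [hLc.eventually hr, hLc.eventually hb, hopen.mem_nhds hu] with u' h1 h2 h3
      exact (huniq u' h3 _ (hBox h2) (sub_eq_iff_eq_add'.mp h1)).symm
    refine ContDiffAt.congr_of_eventuallyEq ?_ ev
    exact ContDiffAt.comp u hinv L.contDiff.contDiffAt
  refine ⟨Y, fun u hu => ⟨by simpa using hY1 u hu, hY2 u hu, huniq u hu, fun v => ?_⟩,
    fun u u' hu hu' => hstab u u' _ _ (hBox (hcb (hY1 u hu))) (hBox (hcb (hY1 u' hu')))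
      (hY2 u hu) (hY2 u' hu'), fun u hu => (hsmooth u hu).contDiffWithinAt⟩
  have hyb := hcb (hY1 u hu)
  have hGat : DifferentiableAt ℝ G (Y u) :=
    (hG.contDiffAt (isOpen_ball.mem_nhds hyb)).differentiableAt one_ne_zero
  have hYat : DifferentiableAt ℝ Y u := (hsmooth u hu).differentiableAt one_ne_zero
  have hd : HasFDerivAt Y ((fderiv ℝ G (Y u)).comp (fderiv ℝ Y u) + L) u := by
    have h := (hGat.hasFDerivAt.comp u hYat.hasFDerivAt).add L.hasFDerivAt
    refine h.congr_of_eventuallyEq ?_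
    filter_upwards [hopen.mem_nhds hu] with u' hu' using hY2 u' hu'
  have he : fderiv ℝ Y u v = fderiv ℝ G (Y u) (fderiv ℝ Y u v) + L v := by
    conv_lhs => rw [hd.fderiv]
    rfl
  have h1 : ‖fderiv ℝ Y u v‖ ≤ ‖fderiv ℝ G (Y u) (fderiv ℝ Y u v)‖ + ‖L v‖ := by
    conv_lhs => rw [he]
    exact norm_add_le _ _
  have h2 : ‖fderiv ℝ G (Y u) (fderiv ℝ Y u v)‖ ≤ θ * ‖fderiv ℝ Y u v‖ :=
    ContinuousLinearMap.le_of_opNorm_le _ (hGd _ hyb) _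
  rw [le_div_iff₀ h1θ]
  nlinarith

end FixedPoint

/-! ### Componentwise maps on spaces of bounded sequences -/

section Nemytskii

open scoped ENNReal

variable {E F : ℕ → Type*} [∀ j, NormedAddCommGroup (E j)] [∀ j, NormedAddCommGroup (F j)]

lemma memℓp_infty_of_le {f : ∀ j, E j} {C : ℝ} (h : ∀ j, ‖f j‖ ≤ C) : Memℓp f ∞ :=
  memℓp_infty ⟨C, by rintro _ ⟨j, rfl⟩; exact h j⟩

open Classical in
/-- The componentwise action of `f` on bounded sequences (zero where it is unbounded). -/
noncomputable def nemytskii (f : ∀ j, E j → F j) (y : lp E ∞) : lp F ∞ :=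
  if h : Memℓp (fun j => f j (y j)) ∞ then ⟨_, h⟩ else 0

lemma nemytskii_apply {f : ∀ j, E j → F j} {y : lp E ∞} {C : ℝ} (h : ∀ j, ‖f j (y j)‖ ≤ C)
    (j : ℕ) : nemytskii f y j = f j (y j) := by
  rw [nemytskii, dif_pos (memℓp_infty_of_le h)]

variable [∀ j, NormedSpace ℝ (E j)] [∀ j, NormedSpace ℝ (F j)]

/-- The diagonal operator on bounded sequences. -/
noncomputable def diagonalCLM (A : ∀ j, E j →L[ℝ] F j) (C : ℝ) (hA : ∀ j, ‖A j‖ ≤ C) :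
    lp E ∞ →L[ℝ] lp F ∞ :=
  have hC : 0 ≤ C := (norm_nonneg _).trans (hA 0)
  have hle : ∀ (y : lp E ∞) (j : ℕ), ‖A j (y j)‖ ≤ C * ‖y‖ := fun y j =>
    ((A j).le_of_opNorm_le (hA j) _).trans
      (mul_le_mul_of_nonneg_left (lp.norm_apply_le_norm ENNReal.top_ne_zero y j) hC)
  LinearMap.mkContinuous
    { toFun := fun y => ⟨fun j => A j (y j), memℓp_infty_of_le (hle y)⟩
      map_add' := fun y y' => by ext j; simp; rfl
      map_smul' := fun r y => by ext j; simp }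
    C (fun y => lp.norm_le_of_forall_le (by positivity) (hle y))

@[simp] lemma diagonalCLM_apply (A : ∀ j, E j →L[ℝ] F j) (C : ℝ) (hA : ∀ j, ‖A j‖ ≤ C)
    (y : lp E ∞) (j : ℕ) : diagonalCLM A C hA y j = A j (y j) := rfl

/-- Differentiability on the unit balls with uniformly Lipschitz derivative. -/
structure UniformC11 (f : ∀ j, E j → F j) (C : ℝ) : Prop where
  diff : ∀ j, ∀ y ∈ ball (0 : E j) 1, DifferentiableAt ℝ (f j) y
  lip : ∀ j, ∀ y ∈ ball (0 : E j) 1, ∀ y' ∈ ball (0 : E j) 1,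
    ‖fderiv ℝ (f j) y - fderiv ℝ (f j) y'‖ ≤ C * ‖y - y'‖

lemma UniformC11.add {f f' : ∀ j, E j → F j} {C C' : ℝ} (h : UniformC11 f C)
    (h' : UniformC11 f' C') : UniformC11 (fun j y => f j y + f' j y) (C + C') := by
  refine ⟨fun j y hy => (h.diff j y hy).add (h'.diff j y hy), fun j y hy y' hy' => ?_⟩
  rw [fderiv_fun_add (h.diff j y hy) (h'.diff j y hy),
    fderiv_fun_add (h.diff j y' hy') (h'.diff j y' hy'), add_sub_add_comm, add_mul]
  exact (norm_add_le _ _).trans (add_le_add (h.lip j y hy y' hy') (h'.lip j y hy y' hy'))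

/-- The candidate derivative acts diagonally. In the supremum norm, differentiability requires
Taylor remainders that are uniform in the component; the common Lipschitz constant of the
derivatives provides them and also makes the derivative Lipschitz. -/
theorem contDiffOn_nemytskii {f : ∀ j, E j → F j} {C₀ C₁ C : ℝ} (h0 : ∀ j, ‖f j 0‖ ≤ C₀)
    (h1 : ∀ j, ∀ y ∈ ball (0 : E j) 1, ‖fderiv ℝ (f j) y‖ ≤ C₁) (hf : UniformC11 f C) :
    ContDiffOn ℝ 1 (nemytskii f) (ball 0 1) := by
  have hC₁ : 0 ≤ C₁ := (norm_nonneg _).trans (h1 0 0 (by simp))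
  have hmem : ∀ y ∈ ball (0 : lp E ∞) 1, ∀ j, y j ∈ ball (0 : E j) 1 := by
    intro y hy j
    rw [mem_ball_zero_iff] at hy ⊢
    exact (lp.norm_apply_le_norm ENNReal.top_ne_zero y j).trans_lt hy
  have hmv : ∀ j, ∀ y ∈ ball (0 : E j) 1, ‖f j y‖ ≤ C₀ + C₁ := by
    intro j y hy
    have h2 := (convex_ball (0 : E j) 1).norm_image_sub_le_of_norm_fderiv_le (hf.diff j) (h1 j)
      (show (0 : E j) ∈ ball 0 1 by simp) hy
    have h3 : ‖f j y‖ ≤ ‖f j 0‖ + ‖f j y - f j 0‖ := by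
      simpa using norm_add_le (f j 0) (f j y - f j 0)
    rw [mem_ball_zero_iff] at hy
    rw [sub_zero] at h2
    nlinarith [h0 j]
  have hN : ∀ y ∈ ball (0 : lp E ∞) 1, ∀ j, nemytskii f y j = f j (y j) := fun y hy =>
    nemytskii_apply fun j => hmv j _ (hmem y hy j)
  have hderiv : ∀ y, ∀ hy : y ∈ ball (0 : lp E ∞) 1, HasFDerivAt (nemytskii f)
      (diagonalCLM (fun j => fderiv ℝ (f j) (y j)) C₁ fun j => h1 j _ (hmem y hy j)) y := by
    intro y hy
    have hC : 0 ≤ max C 0 := le_max_right _ _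
    rw [hasFDerivAt_iff_isLittleO_nhds_zero]
    have hO : (fun v : lp E ∞ => nemytskii f (y + v) - nemytskii f y -
        diagonalCLM (fun j => fderiv ℝ (f j) (y j)) C₁ (fun j => h1 j _ (hmem y hy j)) v)
        =O[𝓝 0] fun v => ‖v‖ ^ 2 := by
      refine Asymptotics.IsBigO.of_bound (max C 0) ?_
      have hev : ∀ᶠ v in 𝓝 (0 : lp E ∞), y + v ∈ ball (0 : lp E ∞) 1 := by
        have : ContinuousAt (fun v : lp E ∞ => y + v) 0 := by fun_prop
        exact this.eventually (by simp only [add_zero]; exact isOpen_ball.mem_nhds hy)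
      filter_upwards [hev] with v hv
      rw [norm_pow, norm_norm]
      refine lp.norm_le_of_forall_le (by positivity) fun j => ?_
      simp only [lp.coeFn_sub, Pi.sub_apply, diagonalCLM_apply, hN _ hv, hN _ hy]
      have hy1 := hmem y hy j
      have hv1 := hmem _ hv j
      have hvj := lp.norm_apply_le_norm ENNReal.top_ne_zero v j
      have hseg : segment ℝ (y j) ((y + v) j) ⊆ ball 0 1 :=
        (convex_ball (0 : E j) 1).segment_subset hy1 hv1
      -- The mean value inequality for `f j` minus its linearisation: on the segment the derivative
      -- varies by at most `max C 0 * ‖v j‖`, so the remainder is quadratic in `v`.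
      have key := (convex_segment (y j) ((y + v) j)).norm_image_sub_le_of_norm_hasFDerivWithin_le'
        (f := f j) (f' := fun x => fderiv ℝ (f j) x) (φ := fderiv ℝ (f j) (y j))
        (C := max C 0 * ‖v j‖)
        (fun x hx => (hf.diff j x (hseg hx)).hasFDerivAt.hasFDerivWithinAt)
        (fun x hx => by
          refine (hf.lip j x (hseg hx) _ hy1).trans ?_
          have hxy : ‖x - y j‖ ≤ ‖v j‖ := by
            obtain ⟨t, ht, rfl⟩ := (segment_eq_image' ℝ (y j) ((y + v) j)) ▸ hx
            simp only [add_sub_cancel_left, lp.coeFn_add, Pi.add_apply, norm_smul,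
              Real.norm_eq_abs, abs_of_nonneg ht.1]
            exact mul_le_of_le_one_left (norm_nonneg _) ht.2
          exact mul_le_mul (le_max_left _ _) hxy (norm_nonneg _) hC)
        (left_mem_segment ℝ _ _) (right_mem_segment ℝ _ _)
      have e : (y + v) j - y j = v j := by simp
      rw [e] at key
      refine key.trans ?_
      rw [mul_assoc, sq]
      exact mul_le_mul_of_nonneg_left
        (mul_le_mul hvj hvj (norm_nonneg _) (norm_nonneg _)) hC
    refine hO.trans_isLittleO ?_
    have := Asymptotics.isLittleO_norm_pow_id (E' := lp E ∞) (n := 2) (by norm_num)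
    exact this
  rw [show (1 : WithTop ℕ∞) = 0 + 1 from rfl, contDiffOn_succ_iff_fderiv_of_isOpen isOpen_ball]
  refine ⟨fun y hy => (hderiv y hy).differentiableAt.differentiableWithinAt, by simp, ?_⟩
  rw [contDiffOn_zero]
  have hlip : LipschitzOnWith (Real.toNNReal (max C 0)) (fderiv ℝ (nemytskii f))
      (ball (0 : lp E ∞) 1) := by
    refine LipschitzOnWith.of_dist_le_mul fun y hy y' hy' => ?_
    rw [dist_eq_norm, dist_eq_norm, Real.coe_toNNReal _ (le_max_right _ _), (hderiv y hy).fderiv,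
      (hderiv y' hy').fderiv]
    refine ContinuousLinearMap.opNorm_le_bound _ (by positivity) fun v =>
      lp.norm_le_of_forall_le (by positivity) fun j => ?_
    have e : (diagonalCLM (fun j => fderiv ℝ (f j) (y j)) C₁ (fun j => h1 j _ (hmem y hy j)) -
        diagonalCLM (fun j => fderiv ℝ (f j) (y' j)) C₁ (fun j => h1 j _ (hmem y' hy' j))) v j =
        (fderiv ℝ (f j) (y j) - fderiv ℝ (f j) (y' j)) (v j) := by
      simp
    rw [e]
    have h2 : ‖y j - y' j‖ ≤ ‖y - y'‖ := by
      simpa using lp.norm_apply_le_norm ENNReal.top_ne_zero (y - y') j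
    have h3 := lp.norm_apply_le_norm ENNReal.top_ne_zero v j
    refine (ContinuousLinearMap.le_of_opNorm_le _ ((hf.lip j _ (hmem y hy j) _
      (hmem y' hy' j)).trans (mul_le_mul (le_max_left C 0) h2 (norm_nonneg _)
        (le_max_right _ _))) _).trans ?_
    gcongr
  exact hlip.continuousOn

end Nemytskii

end RGFlow

/-! ### The linear problem in weighted variables -/

namespace RGFlow

open Filter Topology Metric Finset
open scoped ENNReal

universe u

/-- The weights `w` of the unknowns, the weights `v` of the forcing terms, and the multipliers `a`
of the decoupled linear equations. -/
structure Scale where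
  wK : ℕ → ℝ
  wg : ℕ → ℝ
  wz : ℕ → ℝ
  wμ : ℕ → ℝ
  vg : ℕ → ℝ
  vz : ℕ → ℝ
  vμ : ℕ → ℝ
  ag : ℕ → ℝ
  az : ℕ → ℝ
  aμ : ℕ → ℝ

/-- The kernel that solves `Y_{j+1} = a_j Y_j + R_j` from `Y_0 = 0`, in weighted variables. -/
noncomputable def forwardKernel (w v a : ℕ → ℝ) (j l : ℕ) : ℝ :=
  if l < j then partialProd a j / w j * (v l / partialProd a (l + 1)) else 0

/-- The kernel that solves `Y_{j+1} = a_j Y_j + R_j` from `Y_∞ = 0`, in weighted variables. -/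
noncomputable def backwardKernel (w v a : ℕ → ℝ) (j l : ℕ) : ℝ :=
  if j ≤ l then -(partialProd a j / w j * (v l / partialProd a (l + 1))) else 0

/-- The rows of the kernel are bounded by one in `ℓ¹`. -/
def KernelBound (k : ℕ → ℕ → ℝ) : Prop := ∀ j n, ∑ l ∈ range n, |k j l| ≤ 1

section Kernel

variable {k : ℕ → ℕ → ℝ} {r : ℕ → ℝ} {C : ℝ}

lemma KernelBound.sum_norm_le (hk : KernelBound k) (hr : ∀ l, |r l| ≤ C) (j n : ℕ) :
    ∑ l ∈ range n, ‖k j l * r l‖ ≤ C := by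
  have hC : 0 ≤ C := (abs_nonneg _).trans (hr 0)
  calc ∑ l ∈ range n, ‖k j l * r l‖ ≤ ∑ l ∈ range n, |k j l| * C := by
        refine sum_le_sum fun l _ => ?_
        rw [norm_mul, Real.norm_eq_abs, Real.norm_eq_abs]
        exact mul_le_mul_of_nonneg_left (hr l) (abs_nonneg _)
    _ ≤ C := by
        rw [← sum_mul]
        exact mul_le_of_le_one_left hC (hk j n)

lemma KernelBound.summable (hk : KernelBound k) (hr : ∀ l, |r l| ≤ C) (j : ℕ) :
    Summable fun l => k j l * r l :=
  Summable.of_norm (summable_of_sum_range_le (fun _ => norm_nonneg _) (hk.sum_norm_le hr j))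

lemma KernelBound.abs_tsum_le (hk : KernelBound k) (hr : ∀ l, |r l| ≤ C) (j : ℕ) :
    |∑' l, k j l * r l| ≤ C := by
  have h := summable_of_sum_range_le (fun _ => norm_nonneg _) (hk.sum_norm_le hr j)
  exact (norm_tsum_le_tsum_norm h).trans (h.tsum_le_of_sum_range_le (hk.sum_norm_le hr j))

variable {w v a y : ℕ → ℝ}

lemma forwardKernel_tsum (ha : ∀ j, 0 < a j) (hw : ∀ j, 0 < w j) (r : ℕ → ℝ) (j : ℕ) :
    w j * ∑' l, forwardKernel w v a j l * r l =
      partialProd a j * ∑ l ∈ range j, v l * r l / partialProd a (l + 1) := by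
  rw [tsum_eq_sum (s := range j)]
  · rw [mul_sum, mul_sum]
    refine sum_congr rfl fun l hl => ?_
    rw [forwardKernel, if_pos (mem_range.mp hl)]
    have := (hw j).ne'
    have := (partialProd_pos ha (l + 1)).ne'
    field_simp
  · intro l hl
    rw [forwardKernel, if_neg (by simpa using hl), zero_mul]

/-- Variation of constants for `w y`. The series are finite, so no bound on the forcing is needed.
-/
lemma forward_kernel_iff (ha : ∀ j, 0 < a j) (hw : ∀ j, 0 < w j) {g : ℝ} :
    (∀ j, y j = ∑' l, forwardKernel w v a j l * r l + partialProd a j / w j * g) ↔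
      (w 0 * y 0 = g ∧ ∀ j, w (j + 1) * y (j + 1) = a j * (w j * y j) + v j * r j) := by
  have e : ∀ j, (y j = ∑' l, forwardKernel w v a j l * r l + partialProd a j / w j * g ↔
      w j * y j = partialProd a j * (g + ∑ l ∈ range j, v l * r l / partialProd a (l + 1))) := by
    intro j
    have hwj := (hw j).ne'
    rw [mul_add, ← forwardKernel_tsum ha hw, ← mul_right_inj' hwj, mul_add,
      show w j * (partialProd a j / w j * g) = partialProd a j * g by field_simp, add_comm]
  simp_rw [e]
  constructor
  · intro h
    refine ⟨by simpa [partialProd_zero] using h 0, fun j => ?_⟩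
    exact forward_step (Y := fun j => w j * y j) (R := fun j => v j * r j) ha h j
  · rintro ⟨h0, h⟩ j
    have := forward_eq (Y := fun j => w j * y j) (R := fun j => v j * r j) ha h j
    simp only [h0] at this
    exact this

lemma backwardKernel_tsum (hw : ∀ j, 0 < w j) (r : ℕ → ℝ) (j : ℕ) :
    w j * ∑' l, backwardKernel w v a j l * r l = backSol a (fun l => v l * r l) j := by
  rw [backSol, ← tsum_mul_left, ← tsum_mul_left, ← tsum_neg]
  refine tsum_congr fun l => ?_
  have := (hw j).ne'
  rw [backwardKernel]
  split_ifs
  · field_simp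
  · simp

/-- The condition at infinity is implicit: `y` is bounded and `w / partialProd a` tends to zero,
which excludes every nonzero homogeneous solution. -/
lemma backward_kernel_iff (ha : ∀ j, 0 < a j) (hw : ∀ j, 0 < w j)
    (hk : KernelBound (backwardKernel w v a))
    (hr : ∀ l, |r l| ≤ C) {C' : ℝ} (hy : ∀ j, |y j| ≤ C')
    (hlim : Tendsto (fun j => w j / partialProd a j) atTop (𝓝 0)) :
    (∀ j, y j = ∑' l, backwardKernel w v a j l * r l) ↔
      ∀ j, w (j + 1) * y (j + 1) = a j * (w j * y j) + v j * r j := by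
  -- Up to the factor `-w 0`, this is the series of row zero of the kernel.
  have hs : Summable fun l => v l * r l / partialProd a (l + 1) := by
    have h := (hk.summable hr 0).mul_left (-w 0)
    refine h.congr fun l => ?_
    have := (hw 0).ne'
    rw [backwardKernel, if_pos (Nat.zero_le l), partialProd_zero]
    field_simp
  constructor
  · intro h j
    have e : ∀ j, w j * y j = backSol a (fun l => v l * r l) j := fun j => by
      rw [h j, backwardKernel_tsum hw]
    rw [e, e]
    exact backSol_step ha hs j
  · intro h j
    have hl : Tendsto (fun n => w n * y n / partialProd a n) atTop (𝓝 0) := by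
      have h1 := hlim.const_mul C'
      rw [mul_zero] at h1
      refine squeeze_zero_norm (fun n => ?_) h1
      have hp := partialProd_pos ha n
      rw [show w n * y n / partialProd a n = y n * (w n / partialProd a n) by ring, norm_mul,
        Real.norm_eq_abs, Real.norm_eq_abs, abs_of_pos (div_pos (hw n) hp)]
      exact mul_le_mul_of_nonneg_right (hy n) (div_pos (hw n) hp).le
    have h2 := eq_backSol (Y := fun j => w j * y j) ha hs h hl j
    have hwj := (hw j).ne'
    rw [← mul_right_inj' hwj, backwardKernel_tsum hw]
    exact h2

end Kernel

/-- The properties of the scales that make the linear problem well posed. -/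
structure Scale.Good (σ : Scale) : Prop where
  wK_pos : ∀ j, 0 < σ.wK j
  wg_pos : ∀ j, 0 < σ.wg j
  wz_pos : ∀ j, 0 < σ.wz j
  wμ_pos : ∀ j, 0 < σ.wμ j
  vg_pos : ∀ j, 0 < σ.vg j
  vz_pos : ∀ j, 0 < σ.vz j
  vμ_pos : ∀ j, 0 < σ.vμ j
  ag_pos : ∀ j, 0 < σ.ag j
  az_pos : ∀ j, 0 < σ.az j
  aμ_pos : ∀ j, 0 < σ.aμ j
  kg : KernelBound (forwardKernel σ.wg σ.vg σ.ag)
  kz : KernelBound (backwardKernel σ.wz σ.vz σ.az)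
  kμ : KernelBound (backwardKernel σ.wμ σ.vμ σ.aμ)
  z_lim : Tendsto (fun j => σ.wz j / partialProd σ.az j) atTop (𝓝 0)
  μ_lim : Tendsto (fun j => σ.wμ j / partialProd σ.aμ j) atTop (𝓝 0)

section Solve

variable {W : ℕ → Type u} [∀ j, NormedAddCommGroup (W j)]

/-- Shift of the `K`-components by one time step. -/
def shiftK (r : ∀ j, XSpace W (j + 1)) : ∀ j, W j
  | 0 => 0
  | j + 1 => (r j).1

lemma norm_xspace_le {V : Type*} [NormedAddCommGroup V] {x : V × VSpace} {C : ℝ} :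
    ‖x‖ ≤ C ↔ ‖x.1‖ ≤ C ∧ |x.2.1| ≤ C ∧ |x.2.2.1| ≤ C ∧ |x.2.2.2| ≤ C := by
  simp only [Prod.norm_def, sup_le_iff, Real.norm_eq_abs]

lemma abs_comp_le {V : Type*} [NormedAddCommGroup V] (x : V × VSpace) :
    ‖x.1‖ ≤ ‖x‖ ∧ |x.2.1| ≤ ‖x‖ ∧ |x.2.2.1| ≤ ‖x‖ ∧ |x.2.2.2| ≤ ‖x‖ :=
  norm_xspace_le.mp le_rfl

/-- The solution of the decoupled linear equations with forcing `r`, in weighted variables. -/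
noncomputable def solveFun (σ : Scale) (r : ∀ j, XSpace W (j + 1)) (j : ℕ) : XSpace W j :=
  (shiftK r j, ∑' l, forwardKernel σ.wg σ.vg σ.ag j l * (r l).2.1,
    ∑' l, backwardKernel σ.wz σ.vz σ.az j l * (r l).2.2.1,
    ∑' l, backwardKernel σ.wμ σ.vμ σ.aμ j l * (r l).2.2.2)

lemma norm_solveFun_le {σ : Scale} (hσ : σ.Good) {r : ∀ j, XSpace W (j + 1)} {C : ℝ}
    (hr : ∀ j, ‖r j‖ ≤ C) (j : ℕ) : ‖solveFun σ r j‖ ≤ C := by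
  have hC : 0 ≤ C := (norm_nonneg _).trans (hr 0)
  refine norm_xspace_le.mpr ⟨?_, hσ.kg.abs_tsum_le (fun l => ?_) j,
    hσ.kz.abs_tsum_le (fun l => ?_) j, hσ.kμ.abs_tsum_le (fun l => ?_) j⟩
  · cases j with
    | zero => simpa [solveFun, shiftK] using hC
    | succ j => exact (abs_comp_le (r j)).1.trans (hr j)
  · exact (abs_comp_le (r l)).2.1.trans (hr l)
  · exact (abs_comp_le (r l)).2.2.1.trans (hr l)
  · exact (abs_comp_le (r l)).2.2.2.trans (hr l)

variable [∀ j, NormedSpace ℝ (W j)]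

/-- `solveFun` as a bounded operator. -/
noncomputable def solveCLM (σ : Scale) (hσ : σ.Good) :
    lp (fun j => XSpace W (j + 1)) ∞ →L[ℝ] lp (fun j => XSpace W j) ∞ :=
  have hle : ∀ (r : lp (fun j => XSpace W (j + 1)) ∞) (j : ℕ), ‖solveFun σ r j‖ ≤ 1 * ‖r‖ :=
    fun r j => by
      rw [one_mul]
      exact norm_solveFun_le hσ (lp.norm_apply_le_norm ENNReal.top_ne_zero r) j
  LinearMap.mkContinuous
    { toFun := fun r => ⟨solveFun σ r, memℓp_infty_of_le (hle r)⟩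
      map_add' := fun r r' => by
        have h1 := fun l => lp.norm_apply_le_norm ENNReal.top_ne_zero r l
        have h2 := fun l => lp.norm_apply_le_norm ENNReal.top_ne_zero r' l
        ext j : 2
        change solveFun σ (r + r' : ∀ j, XSpace W (j + 1)) j = solveFun σ r j + solveFun σ r' j
        refine Prod.ext ?_ (Prod.ext ?_ (Prod.ext ?_ ?_))
        · cases j <;> simp [solveFun, shiftK]
        · simp only [solveFun, Pi.add_apply, Prod.fst_add, Prod.snd_add, mul_add]
          exact (hσ.kg.summable (fun l => (abs_comp_le (r l)).2.1.trans (h1 l)) j).tsum_add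
            (hσ.kg.summable (fun l => (abs_comp_le (r' l)).2.1.trans (h2 l)) j)
        · simp only [solveFun, Pi.add_apply, Prod.fst_add, Prod.snd_add, mul_add]
          exact (hσ.kz.summable (fun l => (abs_comp_le (r l)).2.2.1.trans (h1 l)) j).tsum_add
            (hσ.kz.summable (fun l => (abs_comp_le (r' l)).2.2.1.trans (h2 l)) j)
        · simp only [solveFun, Pi.add_apply, Prod.snd_add, mul_add]
          exact (hσ.kμ.summable (fun l => (abs_comp_le (r l)).2.2.2.trans (h1 l)) j).tsum_add
            (hσ.kμ.summable (fun l => (abs_comp_le (r' l)).2.2.2.trans (h2 l)) j)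
      map_smul' := fun t r => by
        ext j : 2
        change solveFun σ (t • r : ∀ j, XSpace W (j + 1)) j = t • solveFun σ r j
        refine Prod.ext ?_ (Prod.ext ?_ (Prod.ext ?_ ?_))
        · cases j <;> simp [solveFun, shiftK]
        all_goals
          simp only [solveFun, Pi.smul_apply, Prod.smul_fst, Prod.smul_snd, smul_eq_mul,
            mul_left_comm _ t, tsum_mul_left] }
    1 (fun r => lp.norm_le_of_forall_le (by positivity) (hle r))

lemma norm_solveCLM_apply_le {σ : Scale} (hσ : σ.Good)
    (r : lp (fun j => XSpace W (j + 1)) ∞) : ‖solveCLM σ hσ r‖ ≤ ‖r‖ :=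
  lp.norm_le_of_forall_le (norm_nonneg _) fun j =>
    norm_solveFun_le hσ (lp.norm_apply_le_norm ENNReal.top_ne_zero r) j

/-- The `K`-component of a sequence supported at time zero. -/
def initK (k : W 0) : ∀ j, W j
  | 0 => k
  | _ + 1 => 0

/-- The contribution of the initial condition `u = (K, g)`, in weighted variables. -/
noncomputable def initFun (σ : Scale) (u : W 0 × ℝ) (j : ℕ) : XSpace W j :=
  ((σ.wK 0)⁻¹ • initK u.1 j, partialProd σ.ag j / σ.wg j * u.2, 0, 0)

lemma norm_initFun_le {σ : Scale} (hσ : σ.Good) {Q : ℝ}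
    (hQ : ∀ j, partialProd σ.ag j / σ.wg j ≤ Q) (u : W 0 × ℝ) (j : ℕ) :
    ‖initFun σ u j‖ ≤ max ((σ.wK 0)⁻¹ * ‖u.1‖) (Q * |u.2|) := by
  have h0 : 0 ≤ max ((σ.wK 0)⁻¹ * ‖u.1‖) (Q * |u.2|) :=
    le_max_of_le_left (mul_nonneg (inv_pos.mpr (hσ.wK_pos 0)).le (norm_nonneg _))
  refine norm_xspace_le.mpr ⟨?_, ?_, by simpa [initFun] using h0, by simpa [initFun] using h0⟩
  · cases j with
    | zero =>
      simp only [initFun, initK, norm_smul, norm_inv, Real.norm_eq_abs, abs_of_pos (hσ.wK_pos 0)]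
      exact le_max_left _ _
    | succ j => simpa [initFun, initK] using h0
  · simp only [initFun]
    have hp : 0 < partialProd σ.ag j / σ.wg j := div_pos (partialProd_pos hσ.ag_pos j) (hσ.wg_pos j)
    rw [abs_mul, abs_of_pos hp]
    exact le_max_of_le_right (mul_le_mul_of_nonneg_right (hQ j) (abs_nonneg _))

/-- `initFun` as a bounded operator. -/
noncomputable def initCLM (σ : Scale) (hσ : σ.Good) (Q : ℝ)
    (hQ : ∀ j, partialProd σ.ag j / σ.wg j ≤ Q) : W 0 × ℝ →L[ℝ] lp (fun j => XSpace W j) ∞ :=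
  have hle : ∀ (u : W 0 × ℝ) (j : ℕ), ‖initFun σ u j‖ ≤ max (σ.wK 0)⁻¹ Q * ‖u‖ := fun u j => by
    refine (norm_initFun_le hσ hQ u j).trans (max_le ?_ ?_)
    · exact mul_le_mul (le_max_left _ _) (norm_fst_le u) (norm_nonneg _)
        (le_max_of_le_left (inv_pos.mpr (hσ.wK_pos 0)).le)
    · exact mul_le_mul (le_max_right _ _) (norm_snd_le u) (abs_nonneg _)
        (le_max_of_le_left (inv_pos.mpr (hσ.wK_pos 0)).le)
  LinearMap.mkContinuous
    { toFun := fun u => ⟨initFun σ u, memℓp_infty_of_le (hle u)⟩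
      map_add' := fun u u' => by
        ext j : 2
        change initFun σ (u + u') j = initFun σ u j + initFun σ u' j
        refine Prod.ext ?_ (Prod.ext ?_ (Prod.ext ?_ ?_))
        · cases j <;> simp [initFun, initK]
        · simp [initFun, mul_add]
        · simp [initFun]
        · simp [initFun]
      map_smul' := fun t u => by
        ext j : 2
        change initFun σ (t • u) j = t • initFun σ u j
        refine Prod.ext ?_ (Prod.ext ?_ (Prod.ext ?_ ?_))
        · cases j <;> simp [initFun, initK, smul_comm t]
        · simp [initFun, mul_left_comm]
        · simp [initFun]
        · simp [initFun] }
    (max (σ.wK 0)⁻¹ Q) (fun u => lp.norm_le_of_forall_le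
      (mul_nonneg (le_max_of_le_left (inv_pos.mpr (hσ.wK_pos 0)).le) (norm_nonneg _)) (hle u))

/-- The fixed point equation is equivalent to the recursion with boundary conditions. -/
theorem eq_solve_add_init_iff {σ : Scale} (hσ : σ.Good) {Q : ℝ}
    (hQ : ∀ j, partialProd σ.ag j / σ.wg j ≤ Q) (y : lp (fun j => XSpace W j) ∞)
    (r : lp (fun j => XSpace W (j + 1)) ∞) (u : W 0 × ℝ) :
    y = solveCLM σ hσ r + initCLM σ hσ Q hQ u ↔
      σ.wK 0 • (y 0).1 = u.1 ∧ σ.wg 0 * (y 0).2.1 = u.2 ∧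
      ∀ j, (y (j + 1)).1 = (r j).1 ∧
        σ.wg (j + 1) * (y (j + 1)).2.1 = σ.ag j * (σ.wg j * (y j).2.1) + σ.vg j * (r j).2.1 ∧
        σ.wz (j + 1) * (y (j + 1)).2.2.1 =
          σ.az j * (σ.wz j * (y j).2.2.1) + σ.vz j * (r j).2.2.1 ∧
        σ.wμ (j + 1) * (y (j + 1)).2.2.2 =
          σ.aμ j * (σ.wμ j * (y j).2.2.2) + σ.vμ j * (r j).2.2.2 := by
  have hr := fun l => lp.norm_apply_le_norm ENNReal.top_ne_zero r l
  have hy := fun l => lp.norm_apply_le_norm ENNReal.top_ne_zero y l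
  have hg := forward_kernel_iff (y := fun j => (y j).2.1) (r := fun j => (r j).2.1) (v := σ.vg)
    hσ.ag_pos hσ.wg_pos (g := u.2)
  have hz := backward_kernel_iff (y := fun j => (y j).2.2.1) (r := fun j => (r j).2.2.1)
    hσ.az_pos hσ.wz_pos hσ.kz (fun l => (abs_comp_le (r l)).2.2.1.trans (hr l))
    (fun l => (abs_comp_le (y l)).2.2.1.trans (hy l)) hσ.z_lim
  have hμ := backward_kernel_iff (y := fun j => (y j).2.2.2) (r := fun j => (r j).2.2.2)
    hσ.aμ_pos hσ.wμ_pos hσ.kμ (fun l => (abs_comp_le (r l)).2.2.2.trans (hr l))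
    (fun l => (abs_comp_le (y l)).2.2.2.trans (hy l)) hσ.μ_lim
  have hw0 := (hσ.wK_pos 0).ne'
  have hcomp : y = solveCLM σ hσ r + initCLM σ hσ Q hQ u ↔
      ∀ j, y j = solveFun σ r j + initFun σ u j := by
    refine ⟨fun h j => ?_, fun h => lp.ext (funext h)⟩
    conv_lhs => rw [h]
    rfl
  rw [hcomp]
  constructor
  · intro h
    obtain ⟨g0, g1⟩ := hg.mp fun j => congrArg (fun x => x.2.1) (h j)
    have z1 := hz.mp fun j => by
      have := congrArg (fun x => x.2.2.1) (h j)
      simpa [initFun, solveFun] using this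
    have μ1 := hμ.mp fun j => by
      have := congrArg (fun x => x.2.2.2) (h j)
      simpa [initFun, solveFun] using this
    refine ⟨?_, g0, fun j => ⟨?_, g1 j, z1 j, μ1 j⟩⟩
    · rw [h 0]
      simp [solveFun, initFun, shiftK, initK, smul_smul, hw0]
    · rw [h (j + 1)]
      simp [solveFun, initFun, shiftK, initK]
  · rintro ⟨k0, g0, h⟩ j
    have g1 := hg.mpr ⟨g0, fun j => (h j).2.1⟩ j
    have z1 := hz.mpr (fun j => (h j).2.2.1) j
    have μ1 := hμ.mpr (fun j => (h j).2.2.2) j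
    refine Prod.ext ?_ (Prod.ext g1 (Prod.ext ?_ ?_))
    · cases j with
      | zero => simp [solveFun, initFun, shiftK, initK, ← k0, smul_smul, hw0]
      | succ j => simp [solveFun, initFun, shiftK, initK, (h j).1]
    · simpa [initFun, solveFun] using z1
    · simpa [initFun, solveFun] using μ1

end Solve

end RGFlow

/-! ### Mean value estimates and polynomial remainders -/

namespace RGFlow

open Filter Topology Metric Finset
open scoped ENNReal

section Calculus

variable {E F : Type*} [NormedAddCommGroup E] [NormedSpace ℝ E]
  [NormedAddCommGroup F] [NormedSpace ℝ F] {φ : E × VSpace → F} {D : Set (E × VSpace)}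

lemma norm_prod_zero_left {E : Type*} [NormedAddCommGroup E] (v : VSpace) : ‖((0 : E), v)‖ = ‖v‖ := by
  rw [Prod.norm_def, norm_zero, max_eq_right (norm_nonneg _)]

/-- The mean value inequality on the segment from `x'` to `x`. Derivatives within `D` suffice, so
boundary points are allowed. -/
lemma norm_sub_le_of_partial_derivs (hD : Convex ℝ D) (hφ : DifferentiableOn ℝ φ D) {bK bV : ℝ}
    (hK : ∀ x ∈ D, ‖derivK φ D x‖ ≤ bK) (hV : ∀ x ∈ D, ‖derivV φ D x‖ ≤ bV)
    {x x' : E × VSpace} (hx : x ∈ D) (hx' : x' ∈ D) :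
    ‖φ x - φ x'‖ ≤ bK * ‖x.1 - x'.1‖ + bV * ‖x.2 - x'.2‖ := by
  have hmem : ∀ t ∈ Set.Icc (0 : ℝ) 1, x' + t • (x - x') ∈ D := fun t ht =>
    hD.add_smul_sub_mem hx' hx ht
  have hline : ∀ t : ℝ, HasDerivWithinAt (fun t : ℝ => x' + t • (x - x')) (x - x')
      (Set.Icc 0 1) t := fun t => by
    have h := ((hasDerivAt_id t).smul_const (x - x')).const_add x'
    rw [one_smul] at h
    exact h.hasDerivWithinAt
  have hcomp : ∀ t ∈ Set.Icc (0 : ℝ) 1, HasDerivWithinAt (fun t : ℝ => φ (x' + t • (x - x')))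
      (fderivWithin ℝ φ D (x' + t • (x - x')) (x - x')) (Set.Icc 0 1) t := fun t ht =>
    (hφ _ (hmem t ht)).hasFDerivWithinAt.comp_hasDerivWithinAt t (hline t) hmem
  have h := norm_image_sub_le_of_norm_deriv_le_segment_01' hcomp
    (C := bK * ‖x.1 - x'.1‖ + bV * ‖x.2 - x'.2‖) (fun t ht => by
      have hm := hmem t ⟨ht.1, ht.2.le⟩
      have e : fderivWithin ℝ φ D (x' + t • (x - x')) (x - x') =
          derivK φ D (x' + t • (x - x')) (x.1 - x'.1) +
            derivV φ D (x' + t • (x - x')) (x.2 - x'.2) := by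
        simp only [derivK, derivV, ContinuousLinearMap.comp_apply, ContinuousLinearMap.inl_apply,
          ContinuousLinearMap.inr_apply, ← map_add]
        congr 1
        simp [Prod.ext_iff]
      rw [e]
      exact (norm_add_le _ _).trans (add_le_add
        (ContinuousLinearMap.le_of_opNorm_le _ (hK _ hm) _)
        (ContinuousLinearMap.le_of_opNorm_le _ (hV _ hm) _)))
  simpa using h

lemma norm_snd_fderiv_le (hφ : ContDiffOn ℝ 2 φ D) {x : E × VSpace} (hx : D ∈ 𝓝 x)
    {b02 b11 b20 : ℝ} (h02 : ‖derivVK 0 2 φ D x‖ ≤ b02) (h11 : ‖derivVK 1 1 φ D x‖ ≤ b11)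
    (h20 : ‖derivVK 2 0 φ D x‖ ≤ b20) (v q : E × VSpace) :
    ‖fderiv ℝ (fderiv ℝ φ) x v q‖ ≤ b02 * (‖v.1‖ * ‖q.1‖) +
      b11 * (‖v.2‖ * ‖q.1‖ + ‖v.1‖ * ‖q.2‖) + b20 * (‖v.2‖ * ‖q.2‖) := by
  have hat : ContDiffAt ℝ 2 φ x := hφ.contDiffAt hx
  have hsymm : IsSymmSndFDerivAt ℝ φ x := hat.isSymmSndFDerivAt (by simp)
  have hit : ∀ m : Fin 2 → E × VSpace, iteratedFDerivWithin ℝ 2 φ D x m =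
      fderiv ℝ (fderiv ℝ φ) x (m 0) (m 1) := by
    intro m
    rw [iteratedFDerivWithin_congr_set (eventuallyEq_univ.mpr hx), iteratedFDerivWithin_univ,
      iteratedFDeriv_two_apply]
  have a02 : ∀ k k' : E, ‖fderiv ℝ (fderiv ℝ φ) x (k, 0) (k', 0)‖ ≤ b02 * (‖k‖ * ‖k'‖) := by
    intro k k'
    have h := ContinuousMultilinearMap.le_of_opNorm_le h02 ![(k, 0), (k', 0)]
    have e : derivVK 0 2 φ D x ![(k, 0), (k', 0)] = fderiv ℝ (fderiv ℝ φ) x (k, 0) (k', 0) := by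
      rw [derivVK, ContinuousMultilinearMap.compContinuousLinearMap_apply]
      refine (hit _).trans ?_
      simp
    rw [e, Fin.prod_univ_two] at h
    simpa using h
  have a11 : ∀ (k : E) (v : VSpace),
      ‖fderiv ℝ (fderiv ℝ φ) x (0, v) (k, 0)‖ ≤ b11 * (‖v‖ * ‖k‖) := by
    intro k v
    have h := ContinuousMultilinearMap.le_of_opNorm_le h11 ![(0, v), (k, 0)]
    have e : derivVK 1 1 φ D x ![(0, v), (k, 0)] = fderiv ℝ (fderiv ℝ φ) x (0, v) (k, 0) := by
      rw [derivVK, ContinuousMultilinearMap.compContinuousLinearMap_apply]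
      refine (hit _).trans ?_
      simp
    rw [e, Fin.prod_univ_two] at h
    simpa [norm_prod_zero_left] using h
  have a20 : ∀ v v' : VSpace,
      ‖fderiv ℝ (fderiv ℝ φ) x (0, v) (0, v')‖ ≤ b20 * (‖v‖ * ‖v'‖) := by
    intro v v'
    have h := ContinuousMultilinearMap.le_of_opNorm_le h20 ![(0, v), (0, v')]
    have e : derivVK 2 0 φ D x ![(0, v), (0, v')] = fderiv ℝ (fderiv ℝ φ) x (0, v) (0, v') := by
      rw [derivVK, ContinuousMultilinearMap.compContinuousLinearMap_apply]
      refine (hit _).trans ?_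
      simp
    rw [e, Fin.prod_univ_two] at h
    simpa [norm_prod_zero_left] using h
  -- Splitting both arguments gives two mixed terms. Symmetry brings each to the order covered by
  -- the bound `b11`, first in `V` and then in `K`.
  have e : fderiv ℝ (fderiv ℝ φ) x v q =
      fderiv ℝ (fderiv ℝ φ) x (v.1, 0) (q.1, 0) +
      (fderiv ℝ (fderiv ℝ φ) x (0, v.2) (q.1, 0) + fderiv ℝ (fderiv ℝ φ) x (0, q.2) (v.1, 0)) +
      fderiv ℝ (fderiv ℝ φ) x (0, v.2) (0, q.2) := by
    rw [hsymm (0, q.2) (v.1, 0)]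
    have hv : v = (v.1, 0) + (0, v.2) := by simp
    have hq : q = (q.1, 0) + (0, q.2) := by simp
    conv_lhs => rw [hv, hq]
    simp only [map_add, add_apply]
    abel
  rw [e]
  have h1 := a02 v.1 q.1
  have h2 := a11 q.1 v.2
  have h3 := a11 v.1 q.2
  have h4 := a20 v.2 q.2
  refine norm_add₃_le.trans ?_
  refine add_le_add (add_le_add h1 ((norm_add_le _ _).trans ?_)) h4
  nlinarith

lemma norm_fderiv_sub_apply_le (hφ : ContDiffOn ℝ 2 φ D) {U : Set (E × VSpace)} (hU : Convex ℝ U)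
    (hUD : ∀ x ∈ U, D ∈ 𝓝 x) {b02 b11 b20 : ℝ} (h02 : ∀ x ∈ D, ‖derivVK 0 2 φ D x‖ ≤ b02)
    (h11 : ∀ x ∈ D, ‖derivVK 1 1 φ D x‖ ≤ b11) (h20 : ∀ x ∈ D, ‖derivVK 2 0 φ D x‖ ≤ b20)
    {x x' : E × VSpace} (hx : x ∈ U) (hx' : x' ∈ U) (q : E × VSpace) :
    ‖(fderiv ℝ φ x - fderiv ℝ φ x') q‖ ≤ b02 * (‖(x - x').1‖ * ‖q.1‖) +
      b11 * (‖(x - x').2‖ * ‖q.1‖ + ‖(x - x').1‖ * ‖q.2‖) + b20 * (‖(x - x').2‖ * ‖q.2‖) := by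
  have hmem : ∀ t ∈ Set.Icc (0 : ℝ) 1, x' + t • (x - x') ∈ U := fun t ht =>
    hU.add_smul_sub_mem hx' hx ht
  have hd : ∀ t ∈ Set.Icc (0 : ℝ) 1, HasDerivWithinAt
      (fun t : ℝ => fderiv ℝ φ (x' + t • (x - x')) q)
      (fderiv ℝ (fderiv ℝ φ) (x' + t • (x - x')) (x - x') q) (Set.Icc 0 1) t := by
    intro t ht
    have hat : ContDiffAt ℝ 2 φ (x' + t • (x - x')) := hφ.contDiffAt (hUD _ (hmem t ht))
    have h1 : DifferentiableAt ℝ (fderiv ℝ φ) (x' + t • (x - x')) :=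
      (hat.fderiv_right (m := 1) (by norm_num)).differentiableAt one_ne_zero
    have h2 : HasDerivAt (fun t : ℝ => x' + t • (x - x')) (x - x') t := by
      have h := ((hasDerivAt_id t).smul_const (x - x')).const_add x'
      rwa [one_smul] at h
    have h3 := h1.hasFDerivAt.comp_hasDerivAt t h2
    have h4 := h3.clm_apply (hasDerivAt_const t q)
    simp only [map_zero, add_zero] at h4
    exact h4.hasDerivWithinAt
  have h := norm_image_sub_le_of_norm_deriv_le_segment_01' hd
    (fun t ht => by
      have hm := hUD _ (hmem t ⟨ht.1, ht.2.le⟩)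
      have hD := mem_of_mem_nhds hm
      exact norm_snd_fderiv_le hφ hm (h02 _ hD) (h11 _ hD) (h20 _ hD) (x - x') q)
  simpa using h

end Calculus

/-- The polynomial maps that occur as remainders of the quadratic flow. -/
def polyMap (c : Fin 12 → ℝ) (v : VSpace) : VSpace :=
  (c 0 * v.1 ^ 2,
   c 1 * v.1 + c 2 * v.1 ^ 2 + c 3 * (v.1 * v.2.1),
   c 4 * v.1 + c 5 * v.2.1 + c 6 * v.2.2 + c 7 * v.1 ^ 2 + c 8 * (v.1 * v.2.1)
     + c 9 * (v.1 * v.2.2) + c 10 * v.2.1 ^ 2 + c 11 * (v.2.1 * v.2.2))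

lemma abs_mul_sub_mul_le {H δ s t s' t' : ℝ} (hs : |s| ≤ H) (ht' : |t'| ≤ H)
    (hds : |s - s'| ≤ δ) (hdt : |t - t'| ≤ δ) : |s * t - s' * t'| ≤ 2 * H * δ := by
  have e : s * t - s' * t' = s * (t - t') + (s - s') * t' := by ring
  rw [e]
  refine (abs_add_le _ _).trans ?_
  rw [abs_mul, abs_mul]
  have hH : 0 ≤ H := (abs_nonneg _).trans hs
  have hδ : 0 ≤ δ := (abs_nonneg _).trans hds
  have h1 := mul_le_mul hs hdt (abs_nonneg _) hH
  have h2 := mul_le_mul hds ht' (abs_nonneg _) hδ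
  nlinarith

/-- The coefficients 1, 4 and 5 are the off-diagonal linear ones. The last component is the worst:
two such terms, one further linear term, and five quadratic terms with Lipschitz constant `2 H`
each. -/
lemma norm_polyMap_sub_le {c : Fin 12 → ℝ} {ε₁ ε₂ H : ℝ} (h1 : |c 1| ≤ ε₁) (h4 : |c 4| ≤ ε₁)
    (h5 : |c 5| ≤ ε₁) (hc : ∀ i, i ≠ 1 → i ≠ 4 → i ≠ 5 → |c i| ≤ ε₂)
    {v v' : VSpace} (hv : ‖v‖ ≤ H) (hv' : ‖v'‖ ≤ H) :
    ‖polyMap c v - polyMap c v'‖ ≤ (2 * ε₁ + ε₂ * (1 + 10 * H)) * ‖v - v'‖ := by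
  obtain ⟨g, z, m⟩ := v
  obtain ⟨g', z', m'⟩ := v'
  simp only [Prod.norm_def, sup_le_iff, Real.norm_eq_abs] at hv hv'
  obtain ⟨vg, vz, vm⟩ := hv
  obtain ⟨vg', vz', vm'⟩ := hv'
  set δ := ‖((g, z, m) : VSpace) - (g', z', m')‖ with hδ
  have hδ' : δ ≤ δ := le_rfl
  conv at hδ' => lhs; rw [hδ]
  simp only [Prod.mk_sub_mk, Prod.norm_def, sup_le_iff, Real.norm_eq_abs] at hδ'
  obtain ⟨dg, dz, dm⟩ := hδ'
  have hδ0 : 0 ≤ δ := (abs_nonneg _).trans dg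
  have hH : 0 ≤ H := (abs_nonneg _).trans vg
  have hε₁ : 0 ≤ ε₁ := (abs_nonneg _).trans h1
  have hε₂ : 0 ≤ ε₂ := (abs_nonneg _).trans (hc 0 (by decide) (by decide) (by decide))
  have lin : ∀ {k ε s s' : ℝ}, |k| ≤ ε → |s - s'| ≤ δ → |k * s - k * s'| ≤ ε * δ := by
    intro k ε s s' hk hs
    rw [← mul_sub, abs_mul]
    exact mul_le_mul hk hs (abs_nonneg _) ((abs_nonneg _).trans hk)
  have quad : ∀ {k s t s' t' : ℝ}, |k| ≤ ε₂ → |s| ≤ H → |t'| ≤ H → |s - s'| ≤ δ → |t - t'| ≤ δ →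
      |k * (s * t) - k * (s' * t')| ≤ ε₂ * (2 * H * δ) := by
    intro k s t s' t' hk hs ht hds hdt
    rw [← mul_sub, abs_mul]
    exact mul_le_mul hk (abs_mul_sub_mul_le hs ht hds hdt) (abs_nonneg _) hε₂
  have q0 := quad (hc 0 (by decide) (by decide) (by decide)) vg vg' dg dg
  have l1 := lin h1 dg
  have q2 := quad (hc 2 (by decide) (by decide) (by decide)) vg vg' dg dg
  have q3 := quad (hc 3 (by decide) (by decide) (by decide)) vg vz' dg dz
  have l4 := lin h4 dg
  have l5 := lin h5 dz
  have l6 := lin (hc 6 (by decide) (by decide) (by decide)) dm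
  have q7 := quad (hc 7 (by decide) (by decide) (by decide)) vg vg' dg dg
  have q8 := quad (hc 8 (by decide) (by decide) (by decide)) vg vz' dg dz
  have q9 := quad (hc 9 (by decide) (by decide) (by decide)) vg vm' dg dm
  have q10 := quad (hc 10 (by decide) (by decide) (by decide)) vz vz' dz dz
  have q11 := quad (hc 11 (by decide) (by decide) (by decide)) vz vm' dz dm
  have hp : 0 ≤ ε₂ * (2 * H * δ) := by positivity
  have hp1 : 0 ≤ ε₁ * δ := by positivity
  have hp2 : 0 ≤ ε₂ * δ := by positivity
  have e : (2 * ε₁ + ε₂ * (1 + 10 * H)) * δ =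
      2 * (ε₁ * δ) + ε₂ * δ + 5 * (ε₂ * (2 * H * δ)) := by ring
  rw [e]
  simp only [polyMap, Prod.mk_sub_mk, Prod.norm_def, sup_le_iff, Real.norm_eq_abs, sq]
  simp only [abs_le] at q0 l1 q2 q3 l4 l5 l6 q7 q8 q9 q10 q11 ⊢
  obtain ⟨q0a, q0b⟩ := q0
  obtain ⟨l1a, l1b⟩ := l1
  obtain ⟨q2a, q2b⟩ := q2
  obtain ⟨q3a, q3b⟩ := q3
  obtain ⟨l4a, l4b⟩ := l4
  obtain ⟨l5a, l5b⟩ := l5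
  obtain ⟨l6a, l6b⟩ := l6
  obtain ⟨q7a, q7b⟩ := q7
  obtain ⟨q8a, q8b⟩ := q8
  obtain ⟨q9a, q9b⟩ := q9
  obtain ⟨q10a, q10b⟩ := q10
  obtain ⟨q11a, q11b⟩ := q11
  refine ⟨⟨?_, ?_⟩, ⟨?_, ?_⟩, ?_, ?_⟩ <;> linarith

lemma contDiff_polyMap : ContDiff ℝ 3 fun x : (Fin 12 → ℝ) × VSpace => polyMap x.1 x.2 := by
  unfold polyMap
  fun_prop

/-- Treating the coefficients as variables gives one smooth map on a finite-dimensional space, and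
compactness of its unit ball yields a constant that is uniform in the coefficients. -/
lemma exists_lipschitz_fderiv_polyMap : ∃ C : ℝ, 0 ≤ C ∧ ∀ c : Fin 12 → ℝ, ‖c‖ ≤ 1 →
    (∀ v, DifferentiableAt ℝ (polyMap c) v) ∧
    ∀ v v' : VSpace, ‖v‖ ≤ 1 → ‖v'‖ ≤ 1 →
      ‖fderiv ℝ (polyMap c) v - fderiv ℝ (polyMap c) v'‖ ≤ C * ‖v - v'‖ := by
  set Q := fun x : (Fin 12 → ℝ) × VSpace => polyMap x.1 x.2 with hQ
  have h1 : ContDiff ℝ 1 (fderiv ℝ Q) :=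
    (contDiff_polyMap.fderiv_right (m := 2) (by norm_num)).of_le (by norm_num)
  have h2 : ContinuousOn (fun x => ‖fderiv ℝ (fderiv ℝ Q) x‖) (closedBall 0 1) :=
    (h1.continuous_fderiv one_ne_zero).norm.continuousOn
  obtain ⟨C, hC⟩ := (isCompact_closedBall (0 : (Fin 12 → ℝ) × VSpace) 1).bddAbove_image h2
  have hCb : ∀ x ∈ closedBall (0 : (Fin 12 → ℝ) × VSpace) 1,
      ‖fderiv ℝ (fderiv ℝ Q) x‖ ≤ C := fun x hx => hC ⟨x, hx, rfl⟩
  have hC0 : 0 ≤ C :=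
    (norm_nonneg (fderiv ℝ (fderiv ℝ Q) 0)).trans (hCb 0 (by simp))
  refine ⟨C, hC0, fun c hc => ?_⟩
  have hder : ∀ v, HasFDerivAt (polyMap c)
      ((fderiv ℝ Q (c, v)).comp (ContinuousLinearMap.inr ℝ (Fin 12 → ℝ) VSpace)) v := by
    intro v
    have hQd : HasFDerivAt Q (fderiv ℝ Q (c, v)) (c, v) :=
      (contDiff_polyMap.differentiable (by norm_num) _).hasFDerivAt
    exact hQd.comp v (hasFDerivAt_prodMk_right c v)
  refine ⟨fun v => (hder v).differentiableAt, fun v v' hv hv' => ?_⟩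
  rw [(hder v).fderiv, (hder v').fderiv, ← ContinuousLinearMap.sub_comp]
  have hm : ∀ v : VSpace, ‖v‖ ≤ 1 → (c, v) ∈ closedBall (0 : (Fin 12 → ℝ) × VSpace) 1 := by
    intro v hv
    rw [mem_closedBall_zero_iff, Prod.norm_def]
    exact max_le hc hv
  have h3 := (convex_closedBall (0 : (Fin 12 → ℝ) × VSpace) 1).norm_image_sub_le_of_norm_fderiv_le
    (fun x _ => h1.differentiable one_ne_zero x) hCb (hm v' hv') (hm v hv)
  have h4 : ‖((c, v) : (Fin 12 → ℝ) × VSpace) - (c, v')‖ = ‖v - v'‖ := by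
    rw [Prod.mk_sub_mk, sub_self, Prod.norm_def, norm_zero, max_eq_right (norm_nonneg _)]
  rw [h4] at h3
  refine (ContinuousLinearMap.opNorm_comp_le _ _).trans ?_
  exact (mul_le_of_le_one_right (norm_nonneg _) (ContinuousLinearMap.norm_inr_le_one ..)).trans h3

end RGFlow

/-! ### The equation for the deviation from the approximate flow -/

namespace RGFlow

open Filter Topology Metric Finset
open scoped ENNReal

universe u

/-- Multiplication of the components by constants. -/
def scaleMap (V : Type*) [NormedAddCommGroup V] [NormedSpace ℝ V] (a b c d : ℝ) :
    V × VSpace →L[ℝ] V × VSpace :=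
  (a • ContinuousLinearMap.fst ℝ V VSpace).prod
    (((b • ContinuousLinearMap.fst ℝ ℝ (ℝ × ℝ)).prod
      (((c • ContinuousLinearMap.fst ℝ ℝ ℝ).prod (d • ContinuousLinearMap.snd ℝ ℝ ℝ)).comp
        (ContinuousLinearMap.snd ℝ ℝ (ℝ × ℝ)))).comp (ContinuousLinearMap.snd ℝ V VSpace))

@[simp] lemma scaleMap_apply {V : Type*} [NormedAddCommGroup V] [NormedSpace ℝ V] (a b c d : ℝ)
    (x : V × VSpace) :
    scaleMap V a b c d x = (a • x.1, b * x.2.1, c * x.2.2.1, d * x.2.2.2) := rfl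

section Step

variable {W : ℕ → Type u} [∀ j, NormedAddCommGroup (W j)] [∀ j, NormedSpace ℝ (W j)]

/-- From weighted to original variables. -/
def Scale.up (σ : Scale) (W : ℕ → Type u) [∀ j, NormedAddCommGroup (W j)]
    [∀ j, NormedSpace ℝ (W j)] (j : ℕ) : XSpace W j →L[ℝ] XSpace W j :=
  scaleMap (W j) (σ.wK j) (σ.wg j) (σ.wz j) (σ.wμ j)

/-- From original to weighted forcing terms. -/
noncomputable def Scale.down (σ : Scale) (W : ℕ → Type u) [∀ j, NormedAddCommGroup (W j)]
    [∀ j, NormedSpace ℝ (W j)] (j : ℕ) : XSpace W (j + 1) →L[ℝ] XSpace W (j + 1) :=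
  scaleMap (W (j + 1)) (σ.wK (j + 1))⁻¹ (σ.vg j)⁻¹ (σ.vz j)⁻¹ (σ.vμ j)⁻¹

/-- The contribution of `ψ` and `ρ` to the forcing, in weighted variables. -/
noncomputable def pertStep (ψ : ∀ j, XSpace W j → W (j + 1)) (ρ : ∀ j, XSpace W j → VSpace)
    (σ : Scale) (xb : ∀ j, XSpace W j) (j : ℕ) (y : XSpace W j) : XSpace W (j + 1) :=
  σ.down W j (ψ j (xb j + σ.up W j y) - (xb (j + 1)).1, ρ j (xb j + σ.up W j y))

/-- The coefficients of the remainder of the quadratic flow about `V`, in weighted variables. -/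
noncomputable def quadCoeff (p : Params) (σ : Scale) (V : ℕ → VSpace) (j : ℕ) : Fin 12 → ℝ :=
  ![-(p.β j * σ.wg j ^ 2 / σ.vg j),
    -((2 * p.θ j * (V j).1 + p.ζ j * (V j).2.1) * σ.wg j / σ.vz j),
    -(p.θ j * σ.wg j ^ 2 / σ.vz j),
    -(p.ζ j * σ.wg j * σ.wz j / σ.vz j),
    (p.η j - 2 * p.υgg j * (V j).1 - p.υgz j * (V j).2.1 - p.υgμ j * (V j).2.2)
      * σ.wg j / σ.vμ j,
    (p.γ j - p.υgz j * (V j).1 - 2 * p.υzz j * (V j).2.1 - p.υzμ j * (V j).2.2)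
      * σ.wz j / σ.vμ j,
    -((p.υgμ j * (V j).1 + p.υzμ j * (V j).2.1) * σ.wμ j / σ.vμ j),
    -(p.υgg j * σ.wg j ^ 2 / σ.vμ j),
    -(p.υgz j * σ.wg j * σ.wz j / σ.vμ j),
    -(p.υgμ j * σ.wg j * σ.wμ j / σ.vμ j),
    -(p.υzz j * σ.wz j ^ 2 / σ.vμ j),
    -(p.υzμ j * σ.wz j * σ.wμ j / σ.vμ j)]

/-- The contribution of the quadratic flow to the forcing, in weighted variables. -/
noncomputable def quadStep (p : Params) (σ : Scale) (xb : ∀ j, XSpace W j) (j : ℕ)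
    (y : XSpace W j) : XSpace W (j + 1) :=
  (0, polyMap (quadCoeff p σ (fun j => (xb j).2) j) y.2)

/-- The forcing, in weighted variables. -/
noncomputable def forcing (p : Params) (ψ : ∀ j, XSpace W j → W (j + 1))
    (ρ : ∀ j, XSpace W j → VSpace) (σ : Scale) (xb : ∀ j, XSpace W j) (j : ℕ)
    (y : XSpace W j) : XSpace W (j + 1) :=
  pertStep ψ ρ σ xb j y + quadStep p σ xb j y

variable {p : Params} {ψ : ∀ j, XSpace W j → W (j + 1)} {ρ : ∀ j, XSpace W j → VSpace}
  {σ : Scale} {xb : ∀ j, XSpace W j}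

/-- The multipliers are those of the diagonal part of the linearised flow. -/
structure Scale.Adapted (σ : Scale) (p : Params) (V : ℕ → VSpace) : Prop where
  ag : ∀ j, σ.ag j = 1 - 2 * p.β j * (V j).1
  az : ∀ j, σ.az j = 1 - p.ζ j * (V j).1
  aμ : ∀ j, σ.aμ j = p.lam j

/-- Subtracting the equation of `xb` cancels the constant terms and the multipliers absorb the
diagonal linear terms. What is left of the quadratic map is precisely `polyMap` with the
coefficients `quadCoeff`. -/
lemma evolution_iff_recursion (hσ : σ.Good) (had : σ.Adapted p fun j => (xb j).2)
    (hxb : ∀ j, xb (j + 1) = evolutionBar p ψ j (xb j)) (y : ∀ j, XSpace W j) (j : ℕ) :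
    xb (j + 1) + σ.up W (j + 1) (y (j + 1)) = evolution p ψ ρ j (xb j + σ.up W j (y j)) ↔
      (y (j + 1)).1 = (forcing p ψ ρ σ xb j (y j)).1 ∧
        σ.wg (j + 1) * (y (j + 1)).2.1 =
          σ.ag j * (σ.wg j * (y j).2.1) + σ.vg j * (forcing p ψ ρ σ xb j (y j)).2.1 ∧
        σ.wz (j + 1) * (y (j + 1)).2.2.1 =
          σ.az j * (σ.wz j * (y j).2.2.1) + σ.vz j * (forcing p ψ ρ σ xb j (y j)).2.2.1 ∧
        σ.wμ (j + 1) * (y (j + 1)).2.2.2 =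
          σ.aμ j * (σ.wμ j * (y j).2.2.2) + σ.vμ j * (forcing p ψ ρ σ xb j (y j)).2.2.2 := by
  have hK := (hσ.wK_pos (j + 1)).ne'
  have hg := (hσ.vg_pos j).ne'
  have hz := (hσ.vz_pos j).ne'
  have hμ := (hσ.vμ_pos j).ne'
  have hb := congrArg Prod.snd (hxb j)
  simp only [evolutionBar, quadMap] at hb
  have hb1 := congrArg Prod.fst hb
  have hb2 := congrArg (fun v => v.2.1) hb
  have hb3 := congrArg (fun v => v.2.2) hb
  simp only at hb1 hb2 hb3
  rw [Prod.ext_iff, Prod.ext_iff, Prod.ext_iff]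
  refine and_congr ?_ (and_congr ?_ (and_congr ?_ ?_))
  · simp only [evolution, Scale.up, scaleMap_apply, Prod.fst_add, forcing, pertStep, quadStep,
      Scale.down, add_zero]
    rw [← eq_sub_iff_add_eq', eq_inv_smul_iff₀ hK]
  · simp only [evolution, quadMap, Scale.up, scaleMap_apply, Prod.fst_add, Prod.snd_add, forcing,
      pertStep, quadStep, Scale.down, had.ag, polyMap, quadCoeff, hb1, mul_add,
      mul_inv_cancel_left₀ hg, Matrix.cons_val]
    have e : σ.vg j * (-(p.β j * σ.wg j ^ 2 / σ.vg j) * (y j).2.1 ^ 2) =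
        -(p.β j * σ.wg j ^ 2 * (y j).2.1 ^ 2) := by field_simp
    rw [e]
    constructor <;> intro h <;> linear_combination h
  · simp only [evolution, quadMap, Scale.up, scaleMap_apply, Prod.fst_add, Prod.snd_add, forcing,
      pertStep, quadStep, Scale.down, had.az, polyMap, quadCoeff, hb2,
      Matrix.cons_val]
    field_simp
    constructor <;> intro h <;> linear_combination h
  · simp only [evolution, quadMap, Scale.up, scaleMap_apply, Prod.fst_add, Prod.snd_add, forcing,
      pertStep, quadStep, Scale.down, had.aμ, polyMap, quadCoeff, hb3,
      Matrix.cons_val]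
    field_simp
    constructor <;> intro h <;> linear_combination h

end Step

end RGFlow

/-! ### The perturbed flow as a fixed point -/

namespace RGFlow

open Filter Topology Metric Finset
open scoped ENNReal

universe u

/-- A box in weighted variables. -/
def box (V : Type*) [NormedAddCommGroup V] (HK Hg Hz Hμ : ℝ) : Set (V × VSpace) :=
  {y | ‖y.1‖ ≤ HK ∧ |y.2.1| ≤ Hg ∧ |y.2.2.1| ≤ Hz ∧ |y.2.2.2| ≤ Hμ}

lemma ball_subset_box {V : Type*} [NormedAddCommGroup V] {HK Hg Hz Hμ : ℝ} (hK : 1 ≤ HK)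
    (hg : 1 ≤ Hg) (hz : 1 ≤ Hz) (hμ : 1 ≤ Hμ) : ball (0 : V × VSpace) 1 ⊆ box V HK Hg Hz Hμ := by
  intro y hy
  rw [mem_ball_zero_iff] at hy
  obtain ⟨h1, h2, h3, h4⟩ := abs_comp_le y
  exact ⟨by linarith, by linarith, by linarith, by linarith⟩

section

variable {W : ℕ → Type u} [∀ j, NormedAddCommGroup (W j)] [∀ j, NormedSpace ℝ (W j)]
  {p : Params} {ψ : ∀ j, XSpace W j → W (j + 1)} {ρ : ∀ j, XSpace W j → VSpace}
  {σ : Scale} {xb : ∀ j, XSpace W j} {HK Hg Hz Hμ θ Q C : ℝ}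

/-- The bounds on the forcing that make the fixed point problem a smooth contraction. -/
structure ForcingBounds (p : Params) (ψ : ∀ j, XSpace W j → W (j + 1))
    (ρ : ∀ j, XSpace W j → VSpace) (σ : Scale) (xb : ∀ j, XSpace W j)
    (HK Hg Hz Hμ θ Q C : ℝ) : Prop where
  good : σ.Good
  adapted : σ.Adapted p fun j => (xb j).2
  flow : ∀ j, xb (j + 1) = evolutionBar p ψ j (xb j)
  hK : 1 ≤ HK
  hg : 1 ≤ Hg
  hz : 1 ≤ Hz
  hμ : 1 ≤ Hμ
  θ_pos : 0 < θ
  θ_lt : θ < 1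
  lip : ∀ j, ∀ y ∈ box (W j) HK Hg Hz Hμ, ∀ y' ∈ box (W j) HK Hg Hz Hμ,
    ‖forcing p ψ ρ σ xb j y - forcing p ψ ρ σ xb j y'‖ ≤ θ * ‖y - y'‖
  c11 : UniformC11 (forcing p ψ ρ σ xb) C
  zero : ∀ j, ‖forcing p ψ ρ σ xb j 0‖ ≤ (1 - θ) / 4
  init : ∀ j, partialProd σ.ag j / σ.wg j ≤ Q

/-- The contraction is the bounded linear solution operator, of norm at most one, after the
componentwise forcing. The solution has norm at most `1/2`, but uniqueness holds in the whole box,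
which is what the uniqueness claim needs. -/
theorem exists_perturbed_flow [∀ j, CompleteSpace (W j)]
    (h : ForcingBounds p ψ ρ σ xb HK Hg Hz Hμ θ Q C) :
    ∃ (N : Set (W 0 × ℝ)) (x : W 0 × ℝ → ∀ j, XSpace W j) (A : ℝ),
      IsOpen N ∧ ((xb 0).1, (xb 0).2.1) ∈ N ∧
      (∀ u ∈ N,
        (∀ j, x u (j + 1) = evolution p ψ ρ j (x u j)) ∧
        (x u 0).1 = u.1 ∧ (x u 0).2.1 = u.2 ∧
        (∀ j, ∃ y, ‖y‖ ≤ 1 / 2 ∧ x u j = xb j + σ.up W j y) ∧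
        (∀ j, ∃ y, ‖y‖ ≤ A * ‖u - ((xb 0).1, (xb 0).2.1)‖ ∧
          x u j = x ((xb 0).1, (xb 0).2.1) j + σ.up W j y) ∧
        (∀ x' : ∀ j, XSpace W j, (∀ j, x' (j + 1) = evolution p ψ ρ j (x' j)) →
          (x' 0).1 = u.1 → (x' 0).2.1 = u.2 →
          (∀ j, ∃ y ∈ box (W j) HK Hg Hz Hμ, x' j = xb j + σ.up W j y) → x' = x u) ∧
        |deriv (fun g => (x (u.1, g) 0).2.2.1) u.2| ≤ σ.wz 0 * (Q / (1 - θ)) ∧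
        |deriv (fun g => (x (u.1, g) 0).2.2.2) u.2| ≤ σ.wμ 0 * (Q / (1 - θ))) ∧
      ∀ j, ContDiffOn ℝ 1 (fun u => x u j) N := by
  have hθ1 : 0 < 1 - θ := by linarith [h.θ_lt]
  have hσ := h.good
  have h0θ := h.θ_pos.le
  set Box : Set (lp (fun j => XSpace W j) ∞) := {y | ∀ j, y j ∈ box (W j) HK Hg Hz Hμ} with hBoxdef
  have hball : ∀ j, ball (0 : XSpace W j) 1 ⊆ box (W j) HK Hg Hz Hμ := fun j =>
    ball_subset_box h.hK h.hg h.hz h.hμ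
  have hzero : ∀ j, (0 : XSpace W j) ∈ box (W j) HK Hg Hz Hμ := fun j => hball j (by simp)
  have hBox : ball (0 : lp (fun j => XSpace W j) ∞) 1 ⊆ Box := by
    intro y hy j
    refine hball j ?_
    rw [mem_ball_zero_iff] at hy ⊢
    exact (lp.norm_apply_le_norm ENNReal.top_ne_zero y j).trans_lt hy
  set f := forcing p ψ ρ σ xb with hf
  have hN : ∀ y ∈ Box, ∀ j, nemytskii f y j = f j (y j) := by
    intro y hy
    -- A bound uniform in `j` is required, since `nemytskii` is zero by convention where the image
    -- sequence is unbounded.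
    refine nemytskii_apply (C := (1 - θ) / 4 + θ * ‖y‖) fun j => ?_
    have h1 := h.lip j (y j) (hy j) 0 (hzero j)
    have h2 : ‖f j (y j)‖ ≤ ‖f j 0‖ + ‖f j (y j) - f j 0‖ := by
      simpa using norm_add_le (f j 0) (f j (y j) - f j 0)
    rw [sub_zero] at h1
    have h3 := mul_le_mul_of_nonneg_left (lp.norm_apply_le_norm ENNReal.top_ne_zero y j) h0θ
    exact h2.trans (add_le_add (h.zero j) (h1.trans h3))
  set G : lp (fun j => XSpace W j) ∞ → lp (fun j => XSpace W j) ∞ :=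
    fun y => solveCLM σ hσ (nemytskii f y) with hG
  have hGlip : ∀ y ∈ Box, ∀ y' ∈ Box, ‖G y - G y'‖ ≤ θ * ‖y - y'‖ := by
    intro y hy y' hy'
    simp only [hG]
    rw [← map_sub]
    refine (norm_solveCLM_apply_le hσ _).trans (lp.norm_le_of_forall_le (by positivity) fun j => ?_)
    rw [lp.coeFn_sub, Pi.sub_apply, hN y hy, hN y' hy']
    refine (h.lip j _ (hy j) _ (hy' j)).trans (mul_le_mul_of_nonneg_left ?_ h0θ)
    exact lp.norm_apply_le_norm ENNReal.top_ne_zero (y - y') j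
  have h0mem : (0 : lp (fun j => XSpace W j) ∞) ∈ Box := hBox (by simp)
  have hG0 : ‖G 0‖ ≤ (1 - θ) / 4 := by
    refine (norm_solveCLM_apply_le hσ _).trans (lp.norm_le_of_forall_le (by linarith) fun j => ?_)
    rw [hN 0 h0mem]
    exact h.zero j
  have hGsmooth : ContDiffOn ℝ 1 G (ball 0 1) := by
    refine (solveCLM σ hσ).contDiff.comp_contDiffOn (contDiffOn_nemytskii (C₁ := θ) h.zero
      (fun j y hy => ?_) h.c11)
    refine norm_fderiv_le_of_lip' ℝ h0θ ?_
    filter_upwards [isOpen_ball.mem_nhds hy] with y' hy'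
    exact h.lip j y' (hball j hy') y (hball j hy)
  set L := initCLM (W := W) σ hσ Q h.init with hL
  obtain ⟨Y, hY, hYlip, hYsmooth⟩ := exists_smooth_fixedPoint h0θ h.θ_lt hGlip hBox hGsmooth hG0 L
  set u₀ : W 0 × ℝ := ((xb 0).1, (xb 0).2.1) with hu₀
  have hYBox : ∀ u, ‖L u‖ < (1 - θ) / 4 → Y u ∈ Box := fun u hu => hBox (by
    rw [mem_ball_zero_iff]; linarith [(hY u hu).1])
  have hiff : ∀ y ∈ Box, ∀ u, y = G y + L u ↔
      (∀ j, xb (j + 1) + σ.up W (j + 1) (y (j + 1)) =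
        evolution p ψ ρ j (xb j + σ.up W j (y j))) ∧
      σ.wK 0 • (y 0).1 = u.1 ∧ σ.wg 0 * (y 0).2.1 = u.2 := by
    intro y hy u
    simp only [hG, hL]
    rw [eq_solve_add_init_iff]
    simp_rw [hN y hy]
    have := fun j => evolution_iff_recursion (ρ := ρ) hσ h.adapted h.flow (fun j => y j) j
    simp_rw [this]
    tauto
  -- The unknown is the deviation from a flow that starts at `u₀`, so the parameter of the fixed
  -- point problem is `u - u₀`.
  set N : Set (W 0 × ℝ) := {u | ‖L (u - u₀)‖ < (1 - θ) / 4} with hNdef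
  have hu₀N : ‖L (u₀ - u₀)‖ < (1 - θ) / 4 := by
    rw [sub_self, map_zero, norm_zero]; linarith
  have hNopen : IsOpen N := isOpen_lt (by fun_prop) continuous_const
  set ev : ∀ j, lp (fun j => XSpace W j) ∞ →L[ℝ] XSpace W j := fun j =>
    lp.evalCLM ℝ (fun j => XSpace W j) ∞ j with hev
  have hevapp : ∀ j y, ev j y = y j := fun j y => rfl
  have hYd : ∀ u ∈ N, HasFDerivAt (fun u => Y (u - u₀)) (fderiv ℝ Y (u - u₀)) u := by
    intro u hu
    have ho : IsOpen {u | ‖L u‖ < (1 - θ) / 4} := isOpen_lt (by fun_prop) continuous_const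
    have hd : DifferentiableAt ℝ Y (u - u₀) :=
      (hYsmooth.contDiffAt (ho.mem_nhds hu)).differentiableAt one_ne_zero
    have h1 : HasFDerivAt (fun u : W 0 × ℝ => u - u₀) (ContinuousLinearMap.id ℝ _) u :=
      (hasFDerivAt_id u).sub_const u₀
    exact hd.hasFDerivAt.comp u h1
  -- In the direction of `g` only the bound `Q` enters and not the large factor `(σ.wK 0)⁻¹`; this
  -- keeps the derivative bound uniform.
  have hLg : ‖L (0, 1)‖ ≤ Q := by
    have hQ : 0 ≤ Q := (div_pos (partialProd_pos hσ.ag_pos 0) (hσ.wg_pos 0)).le.trans (h.init 0)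
    refine lp.norm_le_of_forall_le hQ fun j => ?_
    have := norm_initFun_le hσ h.init ((0, 1) : W 0 × ℝ) j
    change ‖initFun σ ((0, 1) : W 0 × ℝ) j‖ ≤ Q
    simpa [hQ] using this
  have hder : ∀ u ∈ N, ∃ y : XSpace W 0, ‖y‖ ≤ Q / (1 - θ) ∧
      HasDerivAt (fun g => Y ((u.1, g) - u₀) 0) y u.2 := by
    intro u hu
    refine ⟨ev 0 (fderiv ℝ Y (u - u₀) (0, 1)), ?_, ?_⟩
    · rw [hevapp]
      refine (lp.norm_apply_le_norm ENNReal.top_ne_zero _ 0).trans (((hY _ hu).2.2.2 (0, 1)).trans ?_)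
      gcongr
    · have h1 : HasDerivAt (fun g : ℝ => ((u.1, g) : W 0 × ℝ)) (0, 1) u.2 :=
        (hasDerivAt_const u.2 u.1).prodMk (hasDerivAt_id u.2)
      have h2 := (hYd u hu).comp_hasDerivAt u.2 h1
      exact (ev 0).hasFDerivAt.comp_hasDerivAt u.2 h2
  refine ⟨N, fun u j => xb j + σ.up W j (Y (u - u₀) j), ‖L‖ / (1 - θ), hNopen, hu₀N,
    fun u hu => ?_, fun j => ?_⟩
  · have hyB := hYBox _ hu
    obtain ⟨e1, e2, e3⟩ := (hiff _ hyB (u - u₀)).mp (hY _ hu).2.1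
    refine ⟨e1, ?_, ?_, fun j => ⟨Y (u - u₀) j, ?_, rfl⟩,
      fun j => ⟨Y (u - u₀) j - Y (u₀ - u₀) j, ?_, ?_⟩, fun x' hx' hK hg hb => ?_, ?_, ?_⟩
    · change (xb 0).1 + σ.wK 0 • (Y (u - u₀) 0).1 = u.1
      rw [e2]
      simp [hu₀]
    · change (xb 0).2.1 + σ.wg 0 * (Y (u - u₀) 0).2.1 = u.2
      rw [e3]
      simp [hu₀]
    · exact (lp.norm_apply_le_norm ENNReal.top_ne_zero _ j).trans (hY _ hu).1
    · have h1 := hYlip _ _ hu hu₀N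
      rw [sub_sub_sub_cancel_right] at h1
      have h2 := lp.norm_apply_le_norm ENNReal.top_ne_zero (Y (u - u₀) - Y (u₀ - u₀)) j
      rw [lp.coeFn_sub, Pi.sub_apply] at h2
      refine h2.trans (h1.trans ?_)
      rw [div_mul_eq_mul_div]
      gcongr
      exact L.le_opNorm _
    · rw [map_sub, add_assoc, add_sub_cancel]
    · choose y hy hxy using hb
      -- A competing flow in the box is a bounded sequence in weighted variables, so it is a point
      -- of the space in which the contraction acts.
      have hyle : ∀ j, ‖y j‖ ≤ max (max HK Hg) (max Hz Hμ) := fun j => by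
        obtain ⟨a1, a2, a3, a4⟩ := hy j
        exact norm_xspace_le.mpr ⟨a1.trans (by simp), a2.trans (by simp), a3.trans (by simp),
          a4.trans (by simp)⟩
      set y' : lp (fun j => XSpace W j) ∞ := ⟨y, memℓp_infty_of_le hyle⟩ with hy'
      have hy'B : y' ∈ Box := hy
      have e : y' = G y' + L (u - u₀) := by
        rw [hiff y' hy'B]
        refine ⟨fun j => ?_, ?_, ?_⟩
        · change xb (j + 1) + σ.up W (j + 1) (y (j + 1)) =
            evolution p ψ ρ j (xb j + σ.up W j (y j))
          rw [← hxy, ← hxy]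
          exact hx' j
        · have := congrArg Prod.fst (hxy 0)
          change (x' 0).1 = (xb 0).1 + σ.wK 0 • (y 0).1 at this
          change σ.wK 0 • (y 0).1 = u.1 - (xb 0).1
          rw [← hK, this, add_sub_cancel_left]
        · have := congrArg (fun x => x.2.1) (hxy 0)
          change (x' 0).2.1 = (xb 0).2.1 + σ.wg 0 * (y 0).2.1 at this
          change σ.wg 0 * (y 0).2.1 = u.2 - (xb 0).2.1
          rw [← hg, this, add_sub_cancel_left]
      have e' := (hY _ hu).2.2.1 y' hy'B e
      funext j
      rw [hxy]
      exact congrArg (fun w : lp (fun j => XSpace W j) ∞ => xb j + σ.up W j (w j)) e'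
    · obtain ⟨y, hy, hd⟩ := hder u hu
      have h1 : HasDerivAt (fun g => (xb 0 + σ.up W 0 (Y ((u.1, g) - u₀) 0)).2.2.1)
          (σ.wz 0 * y.2.2.1) u.2 := by
        have h2 := ((ContinuousLinearMap.fst ℝ ℝ ℝ).comp ((ContinuousLinearMap.snd ℝ ℝ (ℝ × ℝ)).comp
          (ContinuousLinearMap.snd ℝ (W 0) VSpace))).hasFDerivAt.comp_hasDerivAt u.2 hd
        exact (h2.const_mul (σ.wz 0)).const_add (xb 0).2.2.1
      rw [h1.deriv, abs_mul, abs_of_pos (hσ.wz_pos 0)]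
      exact mul_le_mul_of_nonneg_left ((abs_comp_le y).2.2.1.trans hy) (hσ.wz_pos 0).le
    · obtain ⟨y, hy, hd⟩ := hder u hu
      have h1 : HasDerivAt (fun g => (xb 0 + σ.up W 0 (Y ((u.1, g) - u₀) 0)).2.2.2)
          (σ.wμ 0 * y.2.2.2) u.2 := by
        have h2 := ((ContinuousLinearMap.snd ℝ ℝ ℝ).comp ((ContinuousLinearMap.snd ℝ ℝ (ℝ × ℝ)).comp
          (ContinuousLinearMap.snd ℝ (W 0) VSpace))).hasFDerivAt.comp_hasDerivAt u.2 hd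
        exact (h2.const_mul (σ.wμ 0)).const_add (xb 0).2.2.2
      rw [h1.deriv, abs_mul, abs_of_pos (hσ.wμ_pos 0)]
      exact mul_le_mul_of_nonneg_left ((abs_comp_le y).2.2.2.trans hy) (hσ.wμ_pos 0).le
  · have h1 : ContDiffOn ℝ 1 (fun u => Y (u - u₀)) N :=
      hYsmooth.comp (contDiff_id.sub contDiff_const).contDiffOn fun u hu => hu
    exact contDiffOn_const.add ((σ.up W j).contDiff.comp_contDiffOn
      ((ev j).contDiff.comp_contDiffOn h1))

end

end RGFlow

/-! ### From (A3) to bounds on the forcing -/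

namespace RGFlow

open Filter Topology Metric Finset
open scoped ENNReal

universe u

section Bounds

variable {W : ℕ → Type u} [∀ j, NormedAddCommGroup (W j)]

lemma convex_domain [∀ j, NormedSpace ℝ (W j)] (p : Params) (Ω a h g₀ : ℝ) (j : ℕ) :
    Convex ℝ (domain W p Ω a h g₀ j) := by
  have key : domain W p Ω a h g₀ j =
      (closedBall (0 : W j) (a * chi Ω p.β j * gbar p g₀ j ^ 3)) ×ˢ
      ((closedBall (quadFlow p g₀ j).1 (h * gbar p g₀ j ^ 2 * |Real.log (gbar p g₀ j)|)) ×ˢ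
      ((closedBall (quadFlow p g₀ j).2.1
        (h * chi Ω p.β j * gbar p g₀ j ^ 2 * |Real.log (gbar p g₀ j)|)) ×ˢ
      (closedBall (quadFlow p g₀ j).2.2
        (h * chi Ω p.β j * gbar p g₀ j ^ 2 * |Real.log (gbar p g₀ j)|)))) := by
    ext x
    simp only [Set.mem_prod, mem_closedBall, dist_eq_norm, Real.norm_eq_abs]
    exact ⟨fun hx => ⟨hx.K_le, hx.g_le, hx.z_le, hx.μ_le⟩,
      fun ⟨h1, h2, h3, h4⟩ => ⟨h1, h2, h3, h4⟩⟩
  rw [key]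
  exact (convex_closedBall _ _).prod ((convex_closedBall _ _).prod
    ((convex_closedBall _ _).prod (convex_closedBall _ _)))

lemma domain_mem_nhds {p : Params} {Ω a h g₀ : ℝ} {j : ℕ} {x : XSpace W j}
    (hK : ‖x.1‖ < a * chi Ω p.β j * gbar p g₀ j ^ 3)
    (hg : |x.2.1 - (quadFlow p g₀ j).1| < h * gbar p g₀ j ^ 2 * |Real.log (gbar p g₀ j)|)
    (hz : |x.2.2.1 - (quadFlow p g₀ j).2.1| <
      h * chi Ω p.β j * gbar p g₀ j ^ 2 * |Real.log (gbar p g₀ j)|)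
    (hμ : |x.2.2.2 - (quadFlow p g₀ j).2.2| <
      h * chi Ω p.β j * gbar p g₀ j ^ 2 * |Real.log (gbar p g₀ j)|) :
    domain W p Ω a h g₀ j ∈ 𝓝 x := by
  have c1 : ContinuousAt (fun x : XSpace W j => ‖x.1‖) x := by fun_prop
  have c2 : ContinuousAt (fun x : XSpace W j => |x.2.1 - (quadFlow p g₀ j).1|) x := by fun_prop
  have c3 : ContinuousAt (fun x : XSpace W j => |x.2.2.1 - (quadFlow p g₀ j).2.1|) x := by fun_prop
  have c4 : ContinuousAt (fun x : XSpace W j => |x.2.2.2 - (quadFlow p g₀ j).2.2|) x := by fun_prop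
  filter_upwards [c1.eventually_lt_const hK, c2.eventually_lt_const hg, c3.eventually_lt_const hz,
    c4.eventually_lt_const hμ] with y h1 h2 h3 h4
  exact ⟨by simpa using h1.le, h2.le, h3.le, h4.le⟩

variable [∀ j, NormedSpace ℝ (W j)]
  {p : Params} {ψ : ∀ j, XSpace W j → W (j + 1)} {ρ : ∀ j, XSpace W j → VSpace}
  {σ : Scale} {xb : ∀ j, XSpace W j} {Ω a h κ R M g₀ θ H C ε₁ ε₂ : ℝ} {wV : ℕ → ℝ}

/-- The numerical relations between the scales and the bounds in (A3). -/
structure ScaleBounds (p : Params) (σ : Scale) (V : ℕ → VSpace) (wV : ℕ → ℝ)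
    (Ω κ M g₀ θ H ε₁ ε₂ C : ℝ) : Prop where
  wg_le : ∀ j, σ.wg j ≤ wV j
  wz_le : ∀ j, σ.wz j ≤ wV j
  wμ_le : ∀ j, σ.wμ j ≤ wV j
  vz_ge : ∀ j, σ.vg j ≤ σ.vz j
  vμ_ge : ∀ j, σ.vg j ≤ σ.vμ j
  pert_K : ∀ j, κ * σ.wK j + M * chi Ω p.β (j + 1) * gbar p g₀ (j + 1) ^ 2 * wV j ≤
    θ * σ.wK (j + 1)
  pert_V : ∀ j, M * σ.wK j + M * chi Ω p.β (j + 1) * gbar p g₀ (j + 1) ^ 2 * wV j ≤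
    θ / 2 * σ.vg j
  pert_zero : ∀ j, M * chi Ω p.β (j + 1) * gbar p g₀ (j + 1) ^ 3 ≤ (1 - θ) / 4 * σ.vg j
  coeff₁ : ∀ j, |quadCoeff p σ V j 1| ≤ ε₁ ∧ |quadCoeff p σ V j 4| ≤ ε₁ ∧
    |quadCoeff p σ V j 5| ≤ ε₁
  coeff₂ : ∀ j i, i ≠ 1 → i ≠ 4 → i ≠ 5 → |quadCoeff p σ V j i| ≤ ε₂
  ε₁_le : ε₁ ≤ 1
  ε₂_le : ε₂ ≤ 1
  ε_le : 2 * ε₁ + ε₂ * (1 + 10 * H) ≤ θ / 2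
  C_nonneg : 0 ≤ C
  A_pos : ∀ j, 0 < chi Ω p.β (j + 1) * gbar p g₀ (j + 1) ^ 3
  G_pos : ∀ j, 0 < gbar p g₀ (j + 1) ^ 2 * |Real.log (gbar p g₀ (j + 1))|
  A_le_wK : ∀ j, chi Ω p.β (j + 1) * gbar p g₀ (j + 1) ^ 3 ≤ C * σ.wK (j + 1)
  A_le_vg : ∀ j, chi Ω p.β (j + 1) * gbar p g₀ (j + 1) ^ 3 ≤ C * σ.vg j
  wK_le_A : ∀ j, σ.wK j ≤ C * (chi Ω p.β (j + 1) * gbar p g₀ (j + 1) ^ 3)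
  wV_le_G : ∀ j, wV j ≤ C * (gbar p g₀ (j + 1) ^ 2 * |Real.log (gbar p g₀ (j + 1))|)

lemma norm_up_le (hσ : σ.Good) (hV : ∀ j, σ.wg j ≤ wV j ∧ σ.wz j ≤ wV j ∧ σ.wμ j ≤ wV j) (j : ℕ)
    (y : XSpace W j) : ‖(σ.up W j y).1‖ ≤ σ.wK j * ‖y‖ ∧ ‖(σ.up W j y).2‖ ≤ wV j * ‖y‖ := by
  obtain ⟨h1, h2, h3, h4⟩ := abs_comp_le y
  have hn := norm_nonneg y
  have hwV : 0 ≤ wV j := (hσ.wg_pos j).le.trans (hV j).1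
  simp only [Scale.up, scaleMap_apply]
  refine ⟨?_, ?_⟩
  · rw [norm_smul, Real.norm_eq_abs, abs_of_pos (hσ.wK_pos j)]
    exact mul_le_mul_of_nonneg_left h1 (hσ.wK_pos j).le
  · simp only [Prod.norm_def, Real.norm_eq_abs, abs_mul, abs_of_pos (hσ.wg_pos j),
      abs_of_pos (hσ.wz_pos j), abs_of_pos (hσ.wμ_pos j), sup_le_iff]
    simp only [Prod.norm_def] at h2 h3 h4 hn ⊢
    exact ⟨mul_le_mul (hV j).1 h2 (abs_nonneg _) hwV,
      mul_le_mul (hV j).2.1 h3 (abs_nonneg _) hwV, mul_le_mul (hV j).2.2 h4 (abs_nonneg _) hwV⟩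

lemma norm_down_le (hσ : σ.Good) (hv : ∀ j, σ.vg j ≤ σ.vz j ∧ σ.vg j ≤ σ.vμ j) (j : ℕ)
    (r : XSpace W (j + 1)) :
    ‖(σ.down W j r).1‖ = (σ.wK (j + 1))⁻¹ * ‖r.1‖ ∧
      ‖(σ.down W j r).2‖ ≤ (σ.vg j)⁻¹ * ‖r.2‖ := by
  have hg := hσ.vg_pos j
  obtain ⟨r1, r2, r3, r4⟩ := r
  simp only [Scale.down, scaleMap_apply]
  refine ⟨by rw [norm_smul, norm_inv, Real.norm_eq_abs, abs_of_pos (hσ.wK_pos _)], ?_⟩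
  have h : ‖((r2, r3, r4) : VSpace)‖ ≤ ‖((r2, r3, r4) : VSpace)‖ := le_rfl
  conv at h => lhs; rw [Prod.norm_def, Prod.norm_def]
  simp only [sup_le_iff, Real.norm_eq_abs] at h
  obtain ⟨h2, h3, h4⟩ := h
  rw [Prod.norm_def, Prod.norm_def]
  simp only [sup_le_iff, Real.norm_eq_abs, abs_mul, abs_inv, abs_of_pos hg,
    abs_of_pos (hσ.vz_pos j), abs_of_pos (hσ.vμ_pos j)]
  have i1 : (σ.vz j)⁻¹ ≤ (σ.vg j)⁻¹ := inv_anti₀ hg (hv j).1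
  have i2 : (σ.vμ j)⁻¹ ≤ (σ.vg j)⁻¹ := inv_anti₀ hg (hv j).2
  have i0 : 0 ≤ (σ.vg j)⁻¹ := (inv_pos.mpr hg).le
  exact ⟨mul_le_mul_of_nonneg_left h2 i0, mul_le_mul i1 h3 (abs_nonneg _) i0,
    mul_le_mul i2 h4 (abs_nonneg _) i0⟩

lemma norm_quadStep_sub_le (hB : ScaleBounds p σ (fun j => (xb j).2) wV Ω κ M g₀ θ H ε₁ ε₂ C)
    (j : ℕ) {y y' : XSpace W j} (hy : ‖y.2‖ ≤ H) (hy' : ‖y'.2‖ ≤ H) :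
    ‖(quadStep p σ xb j y - quadStep p σ xb j y').2‖ ≤ θ / 2 * ‖y - y'‖ := by
  obtain ⟨c1, c4, c5⟩ := hB.coeff₁ j
  have h1 := norm_polyMap_sub_le c1 c4 c5 (hB.coeff₂ j) hy hy'
  have h2 : ‖y.2 - y'.2‖ ≤ ‖y - y'‖ := norm_snd_le (y - y')
  have hε₁ : 0 ≤ ε₁ := (abs_nonneg _).trans c1
  have hε₂ : 0 ≤ ε₂ := (abs_nonneg _).trans (hB.coeff₂ j 0 (by decide) (by decide) (by decide))
  have hH : 0 ≤ H := (norm_nonneg _).trans hy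
  refine h1.trans ((mul_le_mul_of_nonneg_left h2 (by positivity)).trans ?_)
  exact mul_le_mul_of_nonneg_right hB.ε_le (norm_nonneg _)

lemma norm_pertStep_sub_le (hA : AssumptionA3 p Ω a h κ R M g₀ ψ ρ) (hκ : 0 ≤ κ) (hM : 0 ≤ M)
    (hσ : σ.Good)
    (hB : ScaleBounds p σ (fun j => (xb j).2) wV Ω κ M g₀ θ H ε₁ ε₂ C) (j : ℕ)
    {y y' : XSpace W j} (hy : xb j + σ.up W j y ∈ domain W p Ω a h g₀ j)
    (hy' : xb j + σ.up W j y' ∈ domain W p Ω a h g₀ j) :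
    ‖(pertStep ψ ρ σ xb j y - pertStep ψ ρ σ xb j y').1‖ ≤ θ * ‖y - y'‖ ∧
      ‖(pertStep ψ ρ σ xb j y - pertStep ψ ρ σ xb j y').2‖ ≤ θ / 2 * ‖y - y'‖ := by
  have hconv := convex_domain (W := W) p Ω a h g₀ j
  have hψ := norm_sub_le_of_partial_derivs hconv ((hA.ψ_smooth j).differentiableOn (by norm_num))
    (hA.ψ_derivK_le j) (hA.ψ_derivV_le j) hy hy'
  have hρ := norm_sub_le_of_partial_derivs hconv ((hA.ρ_smooth j).differentiableOn (by norm_num))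
    (hA.ρ_derivK_le j) (hA.ρ_derivV_le j) hy hy'
  have e1 : (xb j + σ.up W j y).1 - (xb j + σ.up W j y').1 = (σ.up W j (y - y')).1 := by
    rw [map_sub]; simp
  have e2 : (xb j + σ.up W j y).2 - (xb j + σ.up W j y').2 = (σ.up W j (y - y')).2 := by
    rw [map_sub]; simp
  rw [e1, e2] at hψ hρ
  obtain ⟨u1, u2⟩ := norm_up_le hσ (fun j => ⟨hB.wg_le j, hB.wz_le j, hB.wμ_le j⟩) j (y - y')
  have e3 : pertStep ψ ρ σ xb j y - pertStep ψ ρ σ xb j y' =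
      σ.down W j (ψ j (xb j + σ.up W j y) - ψ j (xb j + σ.up W j y'),
        ρ j (xb j + σ.up W j y) - ρ j (xb j + σ.up W j y')) := by
    rw [pertStep, pertStep, ← map_sub]
    simp
  obtain ⟨d1, d2⟩ := norm_down_le hσ (fun j => ⟨hB.vz_ge j, hB.vμ_ge j⟩) j
    (ψ j (xb j + σ.up W j y) - ψ j (xb j + σ.up W j y'),
        ρ j (xb j + σ.up W j y) - ρ j (xb j + σ.up W j y'))
  have he : 0 ≤ M * chi Ω p.β (j + 1) * gbar p g₀ (j + 1) ^ 2 :=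
    (norm_nonneg _).trans (hA.ψ_derivV_le j _ hy)
  have hn := norm_nonneg (y - y')
  rw [e3]
  constructor
  · rw [d1, inv_mul_le_iff₀ (hσ.wK_pos _)]
    have := mul_le_mul_of_nonneg_right (hB.pert_K j) hn
    have := mul_le_mul_of_nonneg_left u1 hκ
    have := mul_le_mul_of_nonneg_left u2 he
    simp only
    linarith
  · refine d2.trans ?_
    rw [inv_mul_le_iff₀ (hσ.vg_pos _)]
    have := mul_le_mul_of_nonneg_right (hB.pert_V j) hn
    have := mul_le_mul_of_nonneg_left u1 hM
    have := mul_le_mul_of_nonneg_left u2 he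
    simp only
    linarith

/-- The `K`-component receives no quadratic part and may use all of `θ`; in the `V`-component `ρ`
and the quadratic part use `θ/2` each. -/
lemma norm_forcing_sub_le (hA : AssumptionA3 p Ω a h κ R M g₀ ψ ρ) (hκ : 0 ≤ κ) (hM : 0 ≤ M)
    (hσ : σ.Good)
    (hB : ScaleBounds p σ (fun j => (xb j).2) wV Ω κ M g₀ θ H ε₁ ε₂ C) (j : ℕ)
    {y y' : XSpace W j} (hy : xb j + σ.up W j y ∈ domain W p Ω a h g₀ j)
    (hy' : xb j + σ.up W j y' ∈ domain W p Ω a h g₀ j) (hyH : ‖y.2‖ ≤ H) (hyH' : ‖y'.2‖ ≤ H) :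
    ‖forcing p ψ ρ σ xb j y - forcing p ψ ρ σ xb j y'‖ ≤ θ * ‖y - y'‖ := by
  obtain ⟨h1, h2⟩ := norm_pertStep_sub_le hA hκ hM hσ hB j hy hy'
  have h3 := norm_quadStep_sub_le hB j hyH hyH'
  have e : forcing p ψ ρ σ xb j y - forcing p ψ ρ σ xb j y' =
      (pertStep ψ ρ σ xb j y - pertStep ψ ρ σ xb j y') +
        (quadStep p σ xb j y - quadStep p σ xb j y') := by
    simp only [forcing]; abel
  rw [e, Prod.norm_def]
  refine max_le ?_ ?_
  · have : (quadStep p σ xb j y - quadStep p σ xb j y').1 = 0 := by simp [quadStep]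
    rw [Prod.fst_add, this, add_zero]
    exact h1
  · rw [Prod.snd_add]
    refine (norm_add_le _ _).trans ?_
    linarith

/-- At the centre the `K`-equation is satisfied exactly and the polynomial part vanishes, so only
`ρ` remains. -/
lemma norm_forcing_zero_le (hA : AssumptionA3 p Ω a h κ R M g₀ ψ ρ) (hσ : σ.Good)
    (hB : ScaleBounds p σ (fun j => (xb j).2) wV Ω κ M g₀ θ H ε₁ ε₂ C) (hθ : θ ≤ 1)
    (hxb : ∀ j, xb (j + 1) = evolutionBar p ψ j (xb j)) (j : ℕ)
    (hy : xb j ∈ domain W p Ω a h g₀ j) : ‖forcing p ψ ρ σ xb j 0‖ ≤ (1 - θ) / 4 := by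
  have e1 : (xb (j + 1)).1 = ψ j (xb j) := by rw [hxb]; rfl
  have e : forcing p ψ ρ σ xb j 0 = σ.down W j (0, ρ j (xb j)) := by
    simp only [forcing, pertStep, quadStep, map_zero, add_zero, e1, sub_self]
    simp [polyMap]
  obtain ⟨d1, d2⟩ := norm_down_le hσ (fun j => ⟨hB.vz_ge j, hB.vμ_ge j⟩) j
    ((0, ρ j (xb j)) : XSpace W (j + 1))
  rw [e, Prod.norm_def]
  refine max_le ?_ (d2.trans ?_)
  · rw [d1, norm_zero, mul_zero]
    linarith
  · rw [inv_mul_le_iff₀ (hσ.vg_pos _), mul_comm]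
    exact (hA.ρ_le j _ hy).trans (hB.pert_zero j)

/-- Write `A` for the `K`-weight and `G` for the `V`-weight. The second derivatives of type `KK`,
`VK`, `VV` have size `A⁻¹`, `G⁻¹`, `A G⁻²`; with increments of size `A` and `G` each contributes
`A`, the weight by which the forcing is divided up to constants. -/
lemma norm_fderiv_diff_apply_le {F : Type*} [NormedAddCommGroup F] [NormedSpace ℝ F]
    (hσ : σ.Good) (hM : 0 ≤ M)
    (hB : ScaleBounds p σ (fun j => (xb j).2) wV Ω κ M g₀ θ H ε₁ ε₂ C) (j : ℕ)
    {φ : XSpace W j → F} (hφ : ContDiffOn ℝ 3 φ (domain W p Ω a h g₀ j))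
    (hder : ∀ m n : ℕ, 2 ≤ n + m → n + m ≤ 3 → ∀ x ∈ domain W p Ω a h g₀ j,
      ‖derivVK m n φ (domain W p Ω a h g₀ j) x‖ ≤
        M * (chi Ω p.β (j + 1) * gbar p g₀ (j + 1) ^ 3) ^ (1 - (n : ℤ))
          * (gbar p g₀ (j + 1) ^ 2 * |Real.log (gbar p g₀ (j + 1))|) ^ (-(m : ℤ)))
    (hint : ∀ y ∈ ball (0 : XSpace W j) 1, domain W p Ω a h g₀ j ∈ 𝓝 (xb j + σ.up W j y))
    {y y' : XSpace W j} (hy : y ∈ ball (0 : XSpace W j) 1) (hy' : y' ∈ ball (0 : XSpace W j) 1)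
    (q : XSpace W j) :
    ‖(fderiv ℝ φ (xb j + σ.up W j y) - fderiv ℝ φ (xb j + σ.up W j y')) (σ.up W j q)‖ ≤
      4 * M * C ^ 2 * (chi Ω p.β (j + 1) * gbar p g₀ (j + 1) ^ 3) * (‖y - y'‖ * ‖q‖) := by
  set D := domain W p Ω a h g₀ j with hD
  set A := chi Ω p.β (j + 1) * gbar p g₀ (j + 1) ^ 3 with hAdef
  set G := gbar p g₀ (j + 1) ^ 2 * |Real.log (gbar p g₀ (j + 1))| with hGdef
  have hApos : 0 < A := hB.A_pos j
  have hGpos : 0 < G := hB.G_pos j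
  have hC := hB.C_nonneg
  set U : Set (XSpace W j) := (fun y => xb j + σ.up W j y) '' ball 0 1 with hU
  -- The mean value argument takes place in the image of the unit ball, which stays in the interior
  -- of the domain.
  have hUconv : Convex ℝ U := by
    have h1 := ((convex_ball (0 : XSpace W j) 1).linear_image (σ.up W j).toLinearMap).translate (xb j)
    rw [Set.image_image] at h1
    exact h1
  have h02 : ∀ x ∈ D, ‖derivVK 0 2 φ D x‖ ≤ M * A⁻¹ := fun x hx => by
    have := hder 0 2 (by norm_num) (by norm_num) x hx
    norm_num at this
    exact this
  have h11 : ∀ x ∈ D, ‖derivVK 1 1 φ D x‖ ≤ M * G⁻¹ := fun x hx => by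
    have := hder 1 1 (by norm_num) (by norm_num) x hx
    rw [Nat.cast_one, sub_self, zpow_zero, mul_one, zpow_neg_one] at this
    exact this
  have h20 : ∀ x ∈ D, ‖derivVK 2 0 φ D x‖ ≤ M * A * (G ^ 2)⁻¹ := fun x hx => by
    have := hder 2 0 (by norm_num) (by norm_num) x hx
    rw [Nat.cast_zero, sub_zero, zpow_one, zpow_neg, zpow_natCast] at this
    exact this
  have key := norm_fderiv_sub_apply_le (hφ.of_le (by norm_num)) hUconv
    (by rintro _ ⟨y, hy, rfl⟩; exact hint y hy) h02 h11 h20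
    (Set.mem_image_of_mem _ hy) (Set.mem_image_of_mem _ hy') (σ.up W j q)
  have e : xb j + σ.up W j y - (xb j + σ.up W j y') = σ.up W j (y - y') := by
    rw [map_sub]; abel
  simp only [e] at key
  obtain ⟨u1, u2⟩ := norm_up_le hσ (fun j => ⟨hB.wg_le j, hB.wz_le j, hB.wμ_le j⟩) j (y - y')
  obtain ⟨q1, q2⟩ := norm_up_le hσ (fun j => ⟨hB.wg_le j, hB.wz_le j, hB.wμ_le j⟩) j q
  have hn := norm_nonneg (y - y')
  have hq := norm_nonneg q
  have u1' := u1.trans (mul_le_mul_of_nonneg_right (hB.wK_le_A j) hn)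
  have u2' := u2.trans (mul_le_mul_of_nonneg_right (hB.wV_le_G j) hn)
  have q1' := q1.trans (mul_le_mul_of_nonneg_right (hB.wK_le_A j) hq)
  have q2' := q2.trans (mul_le_mul_of_nonneg_right (hB.wV_le_G j) hq)
  rw [← hAdef] at u1' q1'
  rw [← hGdef] at u2' q2'
  refine key.trans ?_
  have t1 : M * A⁻¹ * (‖(σ.up W j (y - y')).1‖ * ‖(σ.up W j q).1‖) ≤
      M * A⁻¹ * ((C * A * ‖y - y'‖) * (C * A * ‖q‖)) := by gcongr
  have t2 : M * G⁻¹ * (‖(σ.up W j (y - y')).2‖ * ‖(σ.up W j q).1‖ +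
      ‖(σ.up W j (y - y')).1‖ * ‖(σ.up W j q).2‖) ≤
      M * G⁻¹ * ((C * G * ‖y - y'‖) * (C * A * ‖q‖) + (C * A * ‖y - y'‖) * (C * G * ‖q‖)) := by
    gcongr
  have t3 : M * A * (G ^ 2)⁻¹ * (‖(σ.up W j (y - y')).2‖ * ‖(σ.up W j q).2‖) ≤
      M * A * (G ^ 2)⁻¹ * ((C * G * ‖y - y'‖) * (C * G * ‖q‖)) := by gcongr
  refine (add_le_add (add_le_add t1 t2) t3).trans (le_of_eq ?_)
  field_simp
  ring

lemma uniformC11_pertStep (hA : AssumptionA3 p Ω a h κ R M g₀ ψ ρ) (hM : 0 ≤ M) (hσ : σ.Good)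
    (hB : ScaleBounds p σ (fun j => (xb j).2) wV Ω κ M g₀ θ H ε₁ ε₂ C)
    (hint : ∀ j, ∀ y ∈ ball (0 : XSpace W j) 1,
      domain W p Ω a h g₀ j ∈ 𝓝 (xb j + σ.up W j y)) :
    UniformC11 (pertStep ψ ρ σ xb) (4 * M * C ^ 2 * C) := by
  have hC := hB.C_nonneg
  have hder : ∀ j, ∀ y ∈ ball (0 : XSpace W j) 1, HasFDerivAt (pertStep ψ ρ σ xb j)
      ((σ.down W j).comp (((fderiv ℝ (ψ j) (xb j + σ.up W j y)).prod
        (fderiv ℝ (ρ j) (xb j + σ.up W j y))).comp (σ.up W j))) y := by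
    intro j y hy
    have hn := hint j y hy
    have h1 : DifferentiableAt ℝ (ψ j) (xb j + σ.up W j y) :=
      ((hA.ψ_smooth j).contDiffAt hn).differentiableAt (by norm_num)
    have h2 : DifferentiableAt ℝ (ρ j) (xb j + σ.up W j y) :=
      ((hA.ρ_smooth j).contDiffAt hn).differentiableAt (by norm_num)
    have h3 : HasFDerivAt (fun y => xb j + σ.up W j y) (σ.up W j) y :=
      (σ.up W j).hasFDerivAt.const_add (xb j)
    have h4 := (h1.hasFDerivAt.comp y h3).sub_const (xb (j + 1)).1
    have h5 := h2.hasFDerivAt.comp y h3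
    exact (σ.down W j).hasFDerivAt.comp y (h4.prodMk h5)
  refine ⟨fun j y hy => (hder j y hy).differentiableAt, fun j y hy y' hy' => ?_⟩
  rw [(hder j y hy).fderiv, (hder j y' hy').fderiv]
  refine ContinuousLinearMap.opNorm_le_bound _ (by positivity) fun q => ?_
  have e : ((σ.down W j).comp (((fderiv ℝ (ψ j) (xb j + σ.up W j y)).prod
        (fderiv ℝ (ρ j) (xb j + σ.up W j y))).comp (σ.up W j)) -
      (σ.down W j).comp (((fderiv ℝ (ψ j) (xb j + σ.up W j y')).prod
        (fderiv ℝ (ρ j) (xb j + σ.up W j y'))).comp (σ.up W j))) q =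
      σ.down W j
        ((fderiv ℝ (ψ j) (xb j + σ.up W j y) - fderiv ℝ (ψ j) (xb j + σ.up W j y')) (σ.up W j q),
        (fderiv ℝ (ρ j) (xb j + σ.up W j y) - fderiv ℝ (ρ j) (xb j + σ.up W j y')) (σ.up W j q)) := by
    simp only [sub_apply, ContinuousLinearMap.comp_apply, ContinuousLinearMap.prod_apply]
    rw [← map_sub, Prod.mk_sub_mk]
  have kψ := norm_fderiv_diff_apply_le hσ hM hB j (hA.ψ_smooth j)
    (fun m n h1 h2 => hA.ψ_derivVK_le m n h1 h2 j) (hint j) hy hy' q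
  have kρ := norm_fderiv_diff_apply_le hσ hM hB j (hA.ρ_smooth j)
    (fun m n h1 h2 => hA.ρ_derivVK_le m n h1 h2 j) (hint j) hy hy' q
  obtain ⟨d1, d2⟩ := norm_down_le hσ (fun j => ⟨hB.vz_ge j, hB.vμ_ge j⟩) j
    (((fderiv ℝ (ψ j) (xb j + σ.up W j y) - fderiv ℝ (ψ j) (xb j + σ.up W j y')) (σ.up W j q),
        (fderiv ℝ (ρ j) (xb j + σ.up W j y) - fderiv ℝ (ρ j) (xb j + σ.up W j y'))
          (σ.up W j q)) : XSpace W (j + 1))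
  have hP : 0 ≤ 4 * M * C ^ 2 * (‖y - y'‖ * ‖q‖) := by positivity
  rw [e, Prod.norm_def]
  refine max_le ?_ (d2.trans ?_)
  · rw [d1, inv_mul_le_iff₀ (hσ.wK_pos _)]
    refine kψ.trans ?_
    have := mul_le_mul_of_nonneg_right (hB.A_le_wK j) hP
    linarith
  · rw [inv_mul_le_iff₀ (hσ.vg_pos _)]
    refine kρ.trans ?_
    have := mul_le_mul_of_nonneg_right (hB.A_le_vg j) hP
    linarith

lemma uniformC11_quadStep (hB : ScaleBounds p σ (fun j => (xb j).2) wV Ω κ M g₀ θ H ε₁ ε₂ C) :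
    ∃ C', UniformC11 (quadStep p σ xb) C' := by
  obtain ⟨C', hC', hpoly⟩ := exists_lipschitz_fderiv_polyMap
  have hc : ∀ j, ‖quadCoeff p σ (fun j => (xb j).2) j‖ ≤ 1 := by
    intro j
    rw [pi_norm_le_iff_of_nonneg zero_le_one]
    intro i
    rw [Real.norm_eq_abs]
    obtain ⟨c1, c4, c5⟩ := hB.coeff₁ j
    by_cases h1 : i = 1
    · rw [h1]; exact c1.trans hB.ε₁_le
    by_cases h4 : i = 4
    · rw [h4]; exact c4.trans hB.ε₁_le
    by_cases h5 : i = 5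
    · rw [h5]; exact c5.trans hB.ε₁_le
    exact (hB.coeff₂ j i h1 h4 h5).trans hB.ε₂_le
  have hder : ∀ j (y : XSpace W j), HasFDerivAt (quadStep p σ xb j)
      ((ContinuousLinearMap.inr ℝ (W (j + 1)) VSpace).comp
        ((fderiv ℝ (polyMap (quadCoeff p σ (fun j => (xb j).2) j)) y.2).comp
          (ContinuousLinearMap.snd ℝ (W j) VSpace))) y := by
    intro j y
    have h1 := ((hpoly _ (hc j)).1 y.2).hasFDerivAt
    have h2 := h1.comp y (ContinuousLinearMap.snd ℝ (W j) VSpace).hasFDerivAt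
    exact (ContinuousLinearMap.inr ℝ (W (j + 1)) VSpace).hasFDerivAt.comp y h2
  refine ⟨C', fun j y _ => (hder j y).differentiableAt, fun j y hy y' hy' => ?_⟩
  rw [mem_ball_zero_iff] at hy hy'
  rw [(hder j y).fderiv, (hder j y').fderiv]
  refine ContinuousLinearMap.opNorm_le_bound _ (by positivity) fun q => ?_
  simp only [sub_apply, ContinuousLinearMap.comp_apply, ContinuousLinearMap.coe_snd',
    ContinuousLinearMap.inr_apply, Prod.mk_sub_mk, sub_self]
  rw [norm_prod_zero_left]
  have h1 := (hpoly _ (hc j)).2 y.2 y'.2 ((norm_snd_le y).trans hy.le) ((norm_snd_le y').trans hy'.le)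
  have h2 : ‖y.2 - y'.2‖ ≤ ‖y - y'‖ := norm_snd_le (y - y')
  have h3 := ContinuousLinearMap.le_of_opNorm_le _ (h1.trans (mul_le_mul_of_nonneg_left h2 hC')) q.2
  exact h3.trans (mul_le_mul_of_nonneg_left (norm_snd_le q) (by positivity))

/-- The scale bounds imply the bounds on the forcing. -/
theorem ScaleBounds.forcingBounds (hA : AssumptionA3 p Ω a h κ R M g₀ ψ ρ) (hκ : 0 ≤ κ)
    (hM : 0 ≤ M) (hσ : σ.Good) (had : σ.Adapted p fun j => (xb j).2)
    (hB : ScaleBounds p σ (fun j => (xb j).2) wV Ω κ M g₀ θ H ε₁ ε₂ C) (hθ0 : 0 < θ) (hθ : θ < 1)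
    (hxb : ∀ j, xb (j + 1) = evolutionBar p ψ j (xb j)) {HK Hg Hz Hμ Q : ℝ}
    (hK1 : 1 ≤ HK) (hg1 : 1 ≤ Hg) (hz1 : 1 ≤ Hz) (hμ1 : 1 ≤ Hμ)
    (hgH : Hg ≤ H) (hzH : Hz ≤ H) (hμH : Hμ ≤ H)
    (hbox : ∀ j, ∀ y ∈ box (W j) HK Hg Hz Hμ, xb j + σ.up W j y ∈ domain W p Ω a h g₀ j)
    (hint : ∀ j, ∀ y ∈ ball (0 : XSpace W j) 1,
      domain W p Ω a h g₀ j ∈ 𝓝 (xb j + σ.up W j y))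
    (hQ : ∀ j, partialProd σ.ag j / σ.wg j ≤ Q) :
    ∃ C', ForcingBounds p ψ ρ σ xb HK Hg Hz Hμ θ Q C' := by
  obtain ⟨C', hC'⟩ := uniformC11_quadStep hB
  have hnorm : ∀ j, ∀ y ∈ box (W j) HK Hg Hz Hμ, ‖y.2‖ ≤ H := by
    intro j y hy
    simp only [Prod.norm_def, sup_le_iff, Real.norm_eq_abs]
    exact ⟨hy.2.1.trans hgH, hy.2.2.1.trans hzH, hy.2.2.2.trans hμH⟩
  refine ⟨_, ⟨hσ, had, hxb, hK1, hg1, hz1, hμ1, hθ0, hθ, fun j y hy y' hy' => ?_,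
    (uniformC11_pertStep hA hM hσ hB hint).add hC', fun j => ?_, hQ⟩⟩
  · exact norm_forcing_sub_le hA hκ hM hσ hB j (hbox j y hy) (hbox j y' hy') (hnorm j y hy)
      (hnorm j y' hy')
  · refine norm_forcing_zero_le hA hσ hB hθ.le hxb j ?_
    have := hbox j 0 (ball_subset_box hK1 hg1 hz1 hμ1 (by simp))
    simpa using this

end Bounds

end RGFlow

/-! ### The weights and the bounded linear solution operator -/

namespace RGFlow

open Filter Topology Metric Finset

/-- The scales of the problem with constants `rK`, `rg`, `rz`, `rμ`. -/
noncomputable def rgScale (p : Params) (Ω g₀ S rK rg rz rμ : ℝ) : Scale where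
  wK j := rK * (chi Ω p.β j * gbar p g₀ j ^ 3)
  wg j := rg * (gbar p g₀ j ^ 2 * -Real.log (gbar p g₀ j))
  wz j := rz * (chi Ω p.β j * gbar p g₀ j ^ 2 * -Real.log (gbar p g₀ j))
  wμ j := rμ * (chi Ω p.β j * gbar p g₀ j ^ 2 * -Real.log (gbar p g₀ j))
  vg j := rg / S * (chi Ω p.β j * gbar p g₀ j ^ 3)
  vz j := rz / S * (chi Ω p.β j * gbar p g₀ j ^ 3 * -Real.log (gbar p g₀ j))
  vμ j := rμ / S * (chi Ω p.β j * gbar p g₀ j ^ 2 * -Real.log (gbar p g₀ j))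
  ag j := 1 - 2 * p.β j * gbar p g₀ j
  az j := 1 - p.ζ j * gbar p g₀ j
  aμ j := p.lam j

section

variable {Ω B c D lam₀ C₀ g₀ : ℝ} {p : Params} {d e g χ β : ℕ → ℝ}

lemma gmult_pos (hc : 0 < c) (hC : Control Ω B c D β χ d) (hg : IsGSeq B D g₀ β g) (j : ℕ) :
    0 < 1 - 2 * β j * g j := by
  have h1 := hg.pos hc hC j
  have h2 := hg.le_two hc hC j
  have h3 := abs_le.mp (hC.β_le j)
  have hB := hC.B_nonneg
  have h4 : β j ≤ B := by nlinarith [hC.chi_le_one j]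
  have := hg.smallB
  nlinarith

/-- Because `1 - 2 β g ≤ (1 - β g)²`, each multiplier is at most the ratio of consecutive values of
`g²`. -/
lemma gmult_ratio (hc : 0 < c) (hC : Control Ω B c D β χ d) (hg : IsGSeq B D g₀ β g) {l j : ℕ}
    (hlj : l ≤ j) :
    partialProd (fun k => 1 - 2 * β k * g k) j * g l ^ 2 ≤
      partialProd (fun k => 1 - 2 * β k * g k) l * g j ^ 2 := by
  have hp := partialProd_pos (gmult_pos hc hC hg)
  induction j, hlj using Nat.le_induction with
  | base => rfl
  | succ j hj ih =>
    have ha := gmult_pos hc hC hg j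
    rw [partialProd_succ]
    have h1 : (1 - 2 * β j * g j) * g j ^ 2 ≤ g (j + 1) ^ 2 := by
      rw [hg.step]
      nlinarith [sq_nonneg (β j * g j ^ 2)]
    calc (1 - 2 * β j * g j) * partialProd (fun k => 1 - 2 * β k * g k) j * g l ^ 2
        = (1 - 2 * β j * g j) * (partialProd (fun k => 1 - 2 * β k * g k) j * g l ^ 2) := by ring
      _ ≤ (1 - 2 * β j * g j) * (partialProd (fun k => 1 - 2 * β k * g k) l * g j ^ 2) :=
          mul_le_mul_of_nonneg_left ih ha.le
      _ = partialProd (fun k => 1 - 2 * β k * g k) l * ((1 - 2 * β j * g j) * g j ^ 2) := by ring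
      _ ≤ _ := mul_le_mul_of_nonneg_left h1 (hp l).le

/-- By `gmult_ratio`, a forcing `χ_l g_l³` at time `l` is transported to at most `4 g_j² χ_l g_l` at
time `j`. Summing over `l` gives `g_j² |log g_j|` by `IsGSeq.sum_le_log`, which is the weight of
`g`. -/
lemma forwardKernel_bound (hc : 0 < c) (hC : Control Ω B c D β χ d) (hg : IsGSeq B D g₀ β g)
    {S r : ℝ} (hS : 8 / c ≤ S) (hr : 0 < r) :
    KernelBound (forwardKernel (fun j => r * (g j ^ 2 * -Real.log (g j)))
      (fun j => r / S * (χ j * g j ^ 3)) fun j => 1 - 2 * β j * g j) := by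
  intro j n
  have hp := partialProd_pos (gmult_pos hc hC hg)
  have hS0 : 0 < S := lt_of_lt_of_le (by positivity) hS
  have hgj := hg.pos hc hC j
  have hlj : 0 < -Real.log (g j) := by linarith [hg.log_le hc hC j]
  have hterm : ∀ l, |forwardKernel (fun j => r * (g j ^ 2 * -Real.log (g j)))
      (fun j => r / S * (χ j * g j ^ 3)) (fun j => 1 - 2 * β j * g j) j l| ≤
      if l < j then 4 / (S * -Real.log (g j)) * (χ l * g l) else 0 := by
    intro l
    rw [forwardKernel]
    split_ifs with hl
    · have hgl := hg.pos hc hC l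
      have hgl1 := hg.pos hc hC (l + 1)
      have hχ := hC.pos l
      rw [abs_of_pos (by
        have := hp j
        have := hp (l + 1)
        positivity)]
      have h1 := gmult_ratio hc hC hg (Nat.succ_le_of_lt hl)
      have h2 := hg.le_two_succ hc hC l
      have h3 : partialProd (fun k => 1 - 2 * β k * g k) j /
          partialProd (fun k => 1 - 2 * β k * g k) (l + 1) ≤ 4 * g j ^ 2 / g l ^ 2 := by
        rw [div_le_div_iff₀ (hp _) (by positivity)]
        have h4 : g l ^ 2 ≤ 4 * g (l + 1) ^ 2 := by nlinarith
        calc partialProd (fun k => 1 - 2 * β k * g k) j * g l ^ 2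
            ≤ partialProd (fun k => 1 - 2 * β k * g k) j * (4 * g (l + 1) ^ 2) :=
              mul_le_mul_of_nonneg_left h4 (hp j).le
          _ = 4 * (partialProd (fun k => 1 - 2 * β k * g k) j * g (l + 1) ^ 2) := by ring
          _ ≤ 4 * (partialProd (fun k => 1 - 2 * β k * g k) (l + 1) * g j ^ 2) := by
              linarith [h1]
          _ = _ := by ring
      have e1 : partialProd (fun k => 1 - 2 * β k * g k) j / (r * (g j ^ 2 * -Real.log (g j))) *
          (r / S * (χ l * g l ^ 3) / partialProd (fun k => 1 - 2 * β k * g k) (l + 1)) =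
          (partialProd (fun k => 1 - 2 * β k * g k) j /
          partialProd (fun k => 1 - 2 * β k * g k) (l + 1)) *
          (χ l * g l ^ 3 / (S * (g j ^ 2 * -Real.log (g j)))) := by
        have := (hp (l + 1)).ne'
        field_simp
      rw [e1]
      refine (mul_le_mul_of_nonneg_right h3 (by positivity)).trans (le_of_eq ?_)
      field_simp
    · simp
  refine (sum_le_sum fun l _ => hterm l).trans ?_
  rw [← sum_filter]
  have hsub : ∑ l ∈ range n with l < j, 4 / (S * -Real.log (g j)) * (χ l * g l) ≤
      ∑ l ∈ range j, 4 / (S * -Real.log (g j)) * (χ l * g l) := by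
    refine sum_le_sum_of_subset_of_nonneg (fun l hl => ?_) fun l _ _ => ?_
    · simp only [mem_filter] at hl
      exact mem_range.mpr hl.2
    · have := hg.pos hc hC l
      have := hC.pos l
      positivity
  refine hsub.trans ?_
  rw [← mul_sum]
  refine (mul_le_mul_of_nonneg_left (hg.sum_le_log hc hC j) (by positivity)).trans ?_
  have e2 : 4 / (S * -Real.log (g j)) * (1 / c * -Real.log (g j)) = 4 / c / S := by
    have hne : Real.log (g j) ≠ 0 := fun h0 => by linarith
    field_simp
  rw [e2, div_le_one hS0]
  refine le_trans ?_ hS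
  gcongr
  norm_num

lemma backwardKernel_bound {w v a : ℕ → ℝ} (ha : ∀ k, 0 < a k) (hw : ∀ j, 0 < w j)
    (hv : ∀ j, 0 < v j)
    (h : ∀ j n, ∑ l ∈ Ico j n, v l * (partialProd a j / partialProd a (l + 1)) ≤ w j) :
    KernelBound (backwardKernel w v a) := by
  intro j n
  have hp := partialProd_pos ha
  have e : ∀ l ∈ range n, |backwardKernel w v a j l| =
      if j ≤ l then (w j)⁻¹ * (v l * (partialProd a j / partialProd a (l + 1))) else 0 := by
    intro l _
    rw [backwardKernel]
    split_ifs
    · rw [abs_neg, abs_of_pos (mul_pos (div_pos (hp j) (hw j)) (div_pos (hv l) (hp _)))]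
      have := (hp (l + 1)).ne'
      have := (hw j).ne'
      field_simp
    · simp
  rw [sum_congr rfl e, ← sum_filter, ← mul_sum, inv_mul_le_iff₀ (hw j), mul_one]
  refine le_trans (le_of_eq (sum_congr ?_ fun _ _ => rfl)) (h j n)
  ext l
  simp [and_comm]

lemma mul_log_sq_almost_anti (hc : 0 < c) (hC : Control Ω B c D β χ d)
    (hg : IsGSeq B D g₀ β g) {j l : ℕ} (hjl : j ≤ l) :
    χ l * g l ^ 2 * -Real.log (g l) ≤ 4 * (χ j * g j ^ 2 * -Real.log (g j)) := by
  have h1 := hg.almost_anti hc hC hjl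
  have h2 := hg.mul_log_almost_anti hc hC hjl
  have h3 := hC.chi_anti hjl
  have hgl := hg.pos hc hC l
  have hgj := hg.pos hc hC j
  have hll : 0 < -Real.log (g l) := by linarith [hg.log_le hc hC l]
  have hlj : 0 < -Real.log (g j) := by linarith [hg.log_le hc hC j]
  calc χ l * g l ^ 2 * -Real.log (g l) = χ l * (g l * (g l * -Real.log (g l))) := by ring
    _ ≤ χ j * ((2 * g j) * (2 * (g j * -Real.log (g j)))) := by
        refine mul_le_mul h3 ?_ (by positivity) (hC.pos j).le
        exact mul_le_mul h1 h2 (by positivity) (by positivity)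
    _ = _ := by ring

/-- The norm of the linear solution operator before normalisation. -/
noncomputable def solveConst (c lam₀ : ℝ) : ℝ := 8 / c + 4 / (lam₀ - 1)

lemma tendsto_chi_sq_log (hc : 0 < c) (hC : Control Ω B c D β χ d) (hg : IsGSeq B D g₀ β g)
    (hgl : ∀ j, g j * -Real.log (g j) ≤ 1) {r : ℝ} (hr : 0 < r) :
    Tendsto (fun j => r * (χ j * g j ^ 2 * -Real.log (g j))) atTop (𝓝 0) := by
  have h1 := (hg.tendsto_chi_mul hc hC).const_mul r
  rw [mul_zero] at h1
  have hp : ∀ j, 0 < χ j * g j := fun j => mul_pos (hC.pos j) (hg.pos hc hC j)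
  have e : ∀ j, χ j * g j ^ 2 * -Real.log (g j) = χ j * g j * (g j * -Real.log (g j)) :=
    fun j => by ring
  refine squeeze_zero (fun j => ?_) (fun j => ?_) h1
  · have : 0 < g j * -Real.log (g j) :=
      mul_pos (hg.pos hc hC j) (by linarith [hg.log_le hc hC j])
    rw [e]
    exact (mul_pos hr (mul_pos (hp j) this)).le
  · rw [e]
    exact mul_le_mul_of_nonneg_left (mul_le_of_le_one_right (hp j).le (hgl j)) hr.le

/-- The forcing weights are what each equation can integrate. For `g` this is `forwardKernel_bound`;
for `z`, one power of `g` is gained by `IsGSeq.sum_cube_log_le`; for `μ`, expansion makes forcing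
and solution of the same size. The division by `solveConst` normalises the row sums to at most one.
-/
theorem rgScale_good (hc : 0 < c) (hlam : 1 < lam₀) (hF : FlowControl Ω B c D lam₀ C₀ p d e)
    (hg : IsGSeq B D g₀ p.β (gbar p g₀)) (hgl : ∀ j, gbar p g₀ j * -Real.log (gbar p g₀ j) ≤ 1)
    {rK rg rz rμ : ℝ} (hrK : 0 < rK) (hrg : 0 < rg) (hrz : 0 < rz) (hrμ : 0 < rμ) :
    (rgScale p Ω g₀ (solveConst c lam₀) rK rg rz rμ).Good := by
  have hC := hF.ctl
  have hgp := hg.pos hc hC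
  have hχ := hC.pos
  have hl : 0 < lam₀ - 1 := by linarith
  have hlp : ∀ j, 0 < -Real.log (gbar p g₀ j) := fun j => by linarith [hg.log_le hc hC j]
  have hS : 0 < solveConst c lam₀ := by unfold solveConst; positivity
  have hS1 : 8 / c ≤ solveConst c lam₀ := by
    unfold solveConst
    have : 0 < 4 / (lam₀ - 1) := by positivity
    linarith
  have hS2 : 4 / (lam₀ - 1) ≤ solveConst c lam₀ := by
    unfold solveConst
    have : 0 < 8 / c := by positivity
    linarith
  obtain ⟨hzp, hz2⟩ := zeta_mult_bounds hc hF hg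
  have hA : ∀ j, 0 < chi Ω p.β j * gbar p g₀ j ^ 2 * -Real.log (gbar p g₀ j) := fun j => by
    have := hgp j
    have := hχ j
    have := hlp j
    positivity
  have hA3 : ∀ j, 0 < chi Ω p.β j * gbar p g₀ j ^ 3 * -Real.log (gbar p g₀ j) := fun j => by
    have := hgp j
    have := hχ j
    have := hlp j
    positivity
  have hlamp : ∀ k, 0 < p.lam k := fun k => by linarith [hF.A2.lam_ge k]
  have hlim : ∀ r : ℝ, 0 < r → Tendsto (fun j => r * (chi Ω p.β j * gbar p g₀ j ^ 2 *
      -Real.log (gbar p g₀ j))) atTop (𝓝 0) := fun r hr => tendsto_chi_sq_log hc hC hg hgl hr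
  refine ⟨fun j => ?_, fun j => ?_, fun j => mul_pos hrz (hA j), fun j => mul_pos hrμ (hA j),
    fun j => ?_, fun j => mul_pos (div_pos hrz hS) (hA3 j),
    fun j => mul_pos (div_pos hrμ hS) (hA j), gmult_pos hc hC hg, hzp, hlamp,
    forwardKernel_bound hc hC hg hS1 hrg, ?_, ?_, ?_, ?_⟩
  · exact mul_pos hrK (mul_pos (hχ j) (pow_pos (hgp j) 3))
  · exact mul_pos hrg (mul_pos (pow_pos (hgp j) 2) (hlp j))
  · exact mul_pos (div_pos hrg hS) (mul_pos (hχ j) (pow_pos (hgp j) 3))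
  · refine backwardKernel_bound hzp (fun j => mul_pos hrz (hA j))
      (fun j => mul_pos (div_pos hrz hS) (hA3 j)) fun j n => ?_
    refine (sum_zeta_ratio_le hc hF hg
      (fun l => (mul_pos (div_pos hrz hS) (hA3 l)).le) j n).trans ?_
    simp only [rgScale]
    rw [← mul_sum]
    have h1 := mul_le_mul_of_nonneg_left (hg.sum_cube_log_le hc hC j n) (div_pos hrz hS).le
    have h2 : 2 * (rz / solveConst c lam₀ *
        (4 / c * (chi Ω p.β j * gbar p g₀ j ^ 2 * -Real.log (gbar p g₀ j)))) =
        (8 / c / solveConst c lam₀) *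
          (rz * (chi Ω p.β j * gbar p g₀ j ^ 2 * -Real.log (gbar p g₀ j))) := by
      field_simp
      ring
    have h3 : 8 / c / solveConst c lam₀ ≤ 1 := (div_le_one hS).mpr hS1
    have h4 := mul_le_mul_of_nonneg_right h3 (mul_pos hrz (hA j)).le
    linarith
  · refine backwardKernel_bound hlamp (fun j => mul_pos hrμ (hA j))
      (fun j => mul_pos (div_pos hrμ hS) (hA j)) fun j n => ?_
    refine (sum_expanding_ratio_le (M := rμ / solveConst c lam₀ *
      (4 * (chi Ω p.β j * gbar p g₀ j ^ 2 * -Real.log (gbar p g₀ j)))) hlam hF.A2.lam_ge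
      (fun l hl => mul_le_mul_of_nonneg_left (mul_log_sq_almost_anti hc hC hg hl)
        (div_pos hrμ hS).le) ?_ n).trans ?_
    · have := hA j
      positivity
    · simp only [rgScale]
      have h2 : rμ / solveConst c lam₀ *
          (4 * (chi Ω p.β j * gbar p g₀ j ^ 2 * -Real.log (gbar p g₀ j))) * (1 / (lam₀ - 1)) =
          (4 / (lam₀ - 1) / solveConst c lam₀) *
          (rμ * (chi Ω p.β j * gbar p g₀ j ^ 2 * -Real.log (gbar p g₀ j))) := by
        field_simp
      rw [h2]
      exact mul_le_of_le_one_left (mul_pos hrμ (hA j)).le ((div_le_one hS).mpr hS2)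
  · refine tendsto_div_partialProd (K := 1 / 2) (by norm_num) (fun j => ?_) (hlim rz hrz)
    have := hz2 0 j (Nat.zero_le j)
    rw [partialProd_zero] at this
    simp only [rgScale]
    linarith
  · exact tendsto_div_partialProd one_pos
      (one_le_partialProd fun k => by simp only [rgScale]; linarith [hF.A2.lam_ge k]) (hlim rμ hrμ)

/-- A change of the initial value spreads at most like `g_j² / g₀²`, and `|log g₀| ≤ 2 |log g_j|`.
-/
lemma rgScale_init_le (hc : 0 < c) (hC : Control Ω B c D p.β χ d)
    (hg : IsGSeq B D g₀ p.β (gbar p g₀)) {S rK rg rz rμ : ℝ} (hrg : 0 < rg) (j : ℕ) :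
    partialProd (rgScale p Ω g₀ S rK rg rz rμ).ag j / (rgScale p Ω g₀ S rK rg rz rμ).wg j ≤
      2 / (rg * (g₀ ^ 2 * -Real.log g₀)) := by
  have hgj := hg.pos hc hC j
  have hlj : 0 < -Real.log (gbar p g₀ j) := by linarith [hg.log_le hc hC j]
  have hl0 : 0 < -Real.log g₀ := by
    have := hg.log_le hc hC 0
    rw [hg.init] at this
    linarith
  have hg0 := hg.pos₀
  have h1 := gmult_ratio hc hC hg (Nat.zero_le j)
  rw [partialProd_zero, hg.init, one_mul] at h1
  have h2 := hg.log_init_le hc hC j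
  simp only [rgScale]
  rw [div_le_div_iff₀ (by positivity) (by positivity)]
  calc partialProd (fun k => 1 - 2 * p.β k * gbar p g₀ k) j * (rg * (g₀ ^ 2 * -Real.log g₀))
      = (partialProd (fun k => 1 - 2 * p.β k * gbar p g₀ k) j * g₀ ^ 2) *
          (rg * -Real.log g₀) := by ring
    _ ≤ gbar p g₀ j ^ 2 * (rg * (2 * -Real.log (gbar p g₀ j))) := by
        refine mul_le_mul h1 (mul_le_mul_of_nonneg_left h2 hrg.le) (by positivity) (by positivity)
    _ = _ := by ring

end

end RGFlow

/-! ### Choice of constants: the numerical bounds -/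

namespace RGFlow

open Filter Topology Metric Finset

/-- Relations between the constants in the scales. -/
structure ScaleConsts (B c lam₀ C₀ κΩ M θ t ε₁ ε₂ rK rg rz rμ : ℝ) : Prop where
  rK_pos : 0 < rK
  rg_pos : 0 < rg
  rg_le : rg ≤ rz
  rz_le : rz ≤ rμ
  one_le : 1 ≤ rμ
  ε₂_pos : 0 < ε₂
  t_pos : 0 < t
  t_le : t ≤ 1
  κΩ_lt : κΩ < θ
  κΩ_nonneg : 0 ≤ κΩ
  contraction : κΩ * (1 + t) ≤ (κΩ + θ) / 2
  pert_le : M * rK + 1 ≤ θ / 2 * (rg / solveConst c lam₀)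
  zero_le : 8 * M ≤ (1 - θ) / 4 * (rg / solveConst c lam₀)
  lin_z : C₀ * (2 + zConst c C₀) * solveConst c lam₀ * rg ≤ ε₁ * rz
  lin_μ : 2 * C₀ * solveConst c lam₀ * rz ≤ ε₁ * rμ

/-- The smallness constant for the perturbed flow. -/
noncomputable def pertConst (B c D lam₀ C₀ κΩ M θ t ε₂ rK rμ : ℝ) : ℝ :=
  flowConst B c D lam₀ C₀ + 6 * B / t + 4 * M * rμ / (rK * (θ - κΩ)) + 4 * M * rμ +
    (B + C₀ * (1 + zConst c C₀)) * solveConst c lam₀ * rμ / ε₂ +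
    (2 + 2 * zConst c C₀ + μConst c lam₀ C₀) + 2

lemma solveConst_pos {c lam₀ : ℝ} (hc : 0 < c) (hlam : 1 < lam₀) : 0 < solveConst c lam₀ := by
  have : 0 < lam₀ - 1 := by linarith
  unfold solveConst
  positivity

lemma zConst_nonneg {c C₀ : ℝ} (hc : 0 < c) (hC : 0 ≤ C₀) : 0 ≤ zConst c C₀ := by
  unfold zConst
  positivity

lemma μConst_nonneg {c lam₀ C₀ : ℝ} (hc : 0 < c) (hlam : 1 < lam₀) (hC : 0 ≤ C₀) :
    0 ≤ μConst c lam₀ C₀ := by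
  have : 0 < lam₀ - 1 := by linarith
  have := zConst_nonneg hc hC
  unfold μConst
  positivity

lemma flowConst_nonneg {B c D lam₀ C₀ : ℝ} (hc : 0 < c) (hlam : 1 < lam₀) (hC : 0 ≤ C₀)
    (hB : 0 ≤ B) (hD : 0 ≤ D) : 0 ≤ flowConst B c D lam₀ C₀ := by
  have : 0 < lam₀ - 1 := by linarith
  have := zConst_nonneg hc hC
  unfold flowConst
  positivity

lemma abs_mul_div_le {k N v K T ε : ℝ} (hk : |k| ≤ K) (hN : 0 ≤ N) (hv : 0 < v)
    (e : K * N = T * v) (hT : T ≤ ε) : |k * N / v| ≤ ε := by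
  rw [abs_div, abs_mul, abs_of_nonneg hN, abs_of_pos hv, div_le_iff₀ hv]
  calc |k| * N ≤ K * N := mul_le_mul_of_nonneg_right hk hN
    _ = T * v := e
    _ ≤ ε * v := mul_le_mul_of_nonneg_right hT hv.le

lemma ScaleConsts.flowConst_le {B c D lam₀ C₀ κΩ M θ t ε₁ ε₂ rK rg rz rμ : ℝ} (hc : 0 < c)
    (hlam : 1 < lam₀) (hC : 0 ≤ C₀) (hB : 0 ≤ B) (hM : 0 ≤ M)
    (hk : ScaleConsts B c lam₀ C₀ κΩ M θ t ε₁ ε₂ rK rg rz rμ) :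
    flowConst B c D lam₀ C₀ ≤ pertConst B c D lam₀ C₀ κΩ M θ t ε₂ rK rμ := by
  have hδ : 0 < θ - κΩ := by linarith [hk.κΩ_lt]
  have hrμ : 0 < rμ := by linarith [hk.one_le]
  have hrK := hk.rK_pos
  have hε := hk.ε₂_pos
  have ht := hk.t_pos
  have hSc := solveConst_pos hc hlam
  have hz := zConst_nonneg hc hC
  have hμ := μConst_nonneg hc hlam hC
  have h : 0 ≤ 6 * B / t + 4 * M * rμ / (rK * (θ - κΩ)) + 4 * M * rμ +
    (B + C₀ * (1 + zConst c C₀)) * solveConst c lam₀ * rμ / ε₂ +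
    (2 + 2 * zConst c C₀ + μConst c lam₀ C₀) + 2 := by positivity
  unfold pertConst
  linarith

section

variable {Ω B c D lam₀ C₀ κ M θ t ε₁ ε₂ rK rg rz rμ g₀ : ℝ} {p : Params} {d e : ℕ → ℝ}

/-- Smallness of a coupling constant relative to the constants in the scales. -/
structure Weak (B c lam₀ C₀ κΩ M θ t ε₂ rK rμ g : ℝ) : Prop where
  pos : 0 < g
  le_one : g ≤ 1
  log_ge : 1 ≤ -Real.log g
  mul_log_le : g * -Real.log g ≤ 1
  ratio : 6 * (B * g) ≤ t
  pert_K : 2 * M * rμ * (g * -Real.log g) ≤ rK * ((θ - κΩ) / 2)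
  pert_V : 4 * M * rμ * (g * -Real.log g) ≤ 1
  quad : (B + C₀ * (1 + zConst c C₀)) * solveConst c lam₀ * rμ * (g * Real.log g ^ 2) ≤ ε₂
  lin : (2 + 2 * zConst c C₀ + μConst c lam₀ C₀) * g ≤ 1

lemma weak_of_small (hc : 0 < c) (hlam : 1 < lam₀) (hC : 0 ≤ C₀) (hB : 0 ≤ B) (hD : 0 ≤ D)
    (hM : 0 ≤ M) {κΩ : ℝ} (hk : ScaleConsts B c lam₀ C₀ κΩ M θ t ε₁ ε₂ rK rg rz rμ)
    {x₀ g : ℝ} (hS : Small (pertConst B c D lam₀ C₀ κΩ M θ t ε₂ rK rμ) x₀) (hg : 0 < g)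
    (hgx : g ≤ x₀) : Weak B c lam₀ C₀ κΩ M θ t ε₂ rK rμ g := by
  have hδ : 0 < θ - κΩ := by linarith [hk.κΩ_lt]
  have hrμ : 0 < rμ := by linarith [hk.one_le]
  have hrK := hk.rK_pos
  have hε := hk.ε₂_pos
  have ht := hk.t_pos
  have hSc := solveConst_pos hc hlam
  have hz := zConst_nonneg hc hC
  have hμ := μConst_nonneg hc hlam hC
  have hf := flowConst_nonneg hc hlam hC hB hD
  have n1 : 0 ≤ 6 * B / t := by positivity
  have n2 : 0 ≤ 4 * M * rμ / (rK * (θ - κΩ)) := by positivity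
  have n3 : 0 ≤ 4 * M * rμ := by positivity
  have n4 : 0 ≤ (B + C₀ * (1 + zConst c C₀)) * solveConst c lam₀ * rμ / ε₂ := by positivity
  have n5 : 0 ≤ 2 + 2 * zConst c C₀ + μConst c lam₀ C₀ := by positivity
  have key : ∀ A, 0 ≤ A → A ≤ pertConst B c D lam₀ C₀ κΩ M θ t ε₂ rK rμ →
      A * g ≤ 1 / 4 ∧ A * (g * -Real.log g) ≤ 1 / 2 := fun A hA hA' =>
    (hS.mono hA' le_rfl).linear hA hg hgx
  have hlog : 2 ≤ -Real.log g := by linarith [(hS g hg hgx).2]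
  refine ⟨hg, ?_, by linarith, ?_, ?_, ?_, ?_, ?_, ?_⟩
  · have := (key 2 (by norm_num) (by unfold pertConst; linarith)).1
    linarith
  · have := (key 2 (by norm_num) (by unfold pertConst; linarith)).2
    linarith
  · have h1 := (key (6 * B / t) n1 (by unfold pertConst; linarith)).1
    have h2 : 6 * (B * g) = t * (6 * B / t * g) := by field_simp
    rw [h2]
    nlinarith
  · have h1 := (key _ n2 (by unfold pertConst; linarith)).2
    have h2 : 2 * M * rμ * (g * -Real.log g) = rK * ((θ - κΩ) / 2) *
        (4 * M * rμ / (rK * (θ - κΩ)) * (g * -Real.log g)) := by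
      field_simp
      ring
    rw [h2]
    exact mul_le_of_le_one_right (by positivity) (by linarith)
  · have h1 := (key _ n3 (by unfold pertConst; linarith)).2
    linarith
  · have h1 := (hS.mono (A' := (B + C₀ * (1 + zConst c C₀)) * solveConst c lam₀ * rμ / ε₂)
      (by unfold pertConst; linarith) le_rfl g hg hgx).1
    rw [div_mul_eq_mul_div, div_le_one hε] at h1
    exact h1
  · have h1 := (key _ n5 (by unfold pertConst; linarith)).1
    linarith

/-- A comparison with constant near one is needed here, since only a factor less than `1 / (κ Ω)`
can be lost in the `K`-equation. -/
lemma IsGSeq.cube_le (hc : 0 < c) {β χ g : ℕ → ℝ} (hC : Control Ω B c D β χ d)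
    (hg : IsGSeq B D g₀ β g) (ht0 : 0 ≤ t) (ht : t ≤ 1) {j : ℕ} (h : 6 * (B * g j) ≤ t) :
    g j ^ 3 ≤ (1 + t) * g (j + 1) ^ 3 := by
  have h1 := hg.le_succ hc hC j
  have hp := hg.pos hc hC j
  have hp' := hg.pos hc hC (j + 1)
  set s := B * g j
  have hs0 : 0 ≤ s := mul_nonneg hC.B_nonneg hp.le
  have hs1 : s ≤ 1 / 6 := by linarith
  have h2 : ((1 - s) * g j) ^ 3 ≤ g (j + 1) ^ 3 :=
    pow_le_pow_left₀ (mul_nonneg (by linarith) hp.le) h1 3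
  have h3 : 1 ≤ (1 + t) * (1 - s) ^ 3 := by
    have : 1 - 3 * s ≤ (1 - s) ^ 3 := by
      have := mul_nonneg (sq_nonneg s) (show 0 ≤ 3 - s by linarith)
      linarith
    -- From `s ≤ t/6` the product is at least `(1 + t) (1 - t/2)`, which is at least one for `t ≤
    -- 1`.
    have h5 : 1 ≤ (1 + t) * (1 - 3 * s) := by nlinarith
    exact h5.trans (mul_le_mul_of_nonneg_left this (by linarith))
  calc g j ^ 3 ≤ (1 + t) * (1 - s) ^ 3 * g j ^ 3 := le_mul_of_one_le_left (by positivity) h3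
    _ = (1 + t) * ((1 - s) * g j) ^ 3 := by ring
    _ ≤ _ := mul_le_mul_of_nonneg_left h2 (by linarith)

set_option maxHeartbeats 1000000 in
-- After weighting, the coefficients 1, 4 and 5 retain no power of `g`: they are bounded by
-- multiples of `rg/rz`, `rg/rμ` and `rz/rμ`, which the hierarchy of constants makes small. All
-- others keep at least one power of `g`.
lemma rgScale_coeff (hc : 0 < c) (hlam : 1 < lam₀) (hF : FlowControl Ω B c D lam₀ C₀ p d e)
    (hV : BaseFlow Ω B c D lam₀ C₀ p g₀ (quadFlow p g₀)) {κΩ : ℝ}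
    (hk : ScaleConsts B c lam₀ C₀ κΩ M θ t ε₁ ε₂ rK rg rz rμ) (j : ℕ)
    (hw : Weak B c lam₀ C₀ κΩ M θ t ε₂ rK rμ (gbar p g₀ j)) :
    (|quadCoeff p (rgScale p Ω g₀ (solveConst c lam₀) rK rg rz rμ) (quadFlow p g₀) j 1| ≤ ε₁ ∧
      |quadCoeff p (rgScale p Ω g₀ (solveConst c lam₀) rK rg rz rμ) (quadFlow p g₀) j 4| ≤ ε₁ ∧
      |quadCoeff p (rgScale p Ω g₀ (solveConst c lam₀) rK rg rz rμ) (quadFlow p g₀) j 5| ≤ ε₁) ∧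
    ∀ i, i ≠ 1 → i ≠ 4 → i ≠ 5 →
      |quadCoeff p (rgScale p Ω g₀ (solveConst c lam₀) rK rg rz rμ) (quadFlow p g₀) j i| ≤ ε₂ := by
  have hC0 := hF.C₀_nonneg
  have hB0 := hF.ctl.B_nonneg
  have hS := solveConst_pos hc hlam
  have hCz := zConst_nonneg hc hC0
  have hCm := μConst_nonneg hc hlam hC0
  have hrg := hk.rg_pos
  have hrz : 0 < rz := hrg.trans_le hk.rg_le
  have hrμ : 0 < rμ := hrz.trans_le hk.rz_le
  have hA2 := hF.A2
  have hz := hV.z_le j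
  have hμ := hV.μ_le j
  have hβ := hF.ctl.β_le j
  have hlinz := hk.lin_z
  have hlinμ := hk.lin_μ
  obtain ⟨hg, hg1, hl1, hgl, -, -, -, hq, hlin⟩ := hw
  have e0 : (quadFlow p g₀ j).1 = gbar p g₀ j := rfl
  rw [e0] at hz hμ
  have bη := hA2.η_le j
  have bγ := hA2.γ_le j
  have bθ := hA2.θ_le j
  have bζ := hA2.ζ_le j
  have bgg := hA2.υgg_le j
  have bgz := hA2.υgz_le j
  have bgμ := hA2.υgμ_le j
  have bzz := hA2.υzz_le j
  have bzμ := hA2.υzμ_le j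
  have hχ := hF.ctl.pos j
  have hχ1 := hF.ctl.chi_le_one j
  simp only [quadCoeff, rgScale, e0, Matrix.cons_val]
  generalize solveConst c lam₀ = S at *
  generalize zConst c C₀ = Cz at *
  generalize μConst c lam₀ C₀ = Cm at *
  have hlsq : Real.log (gbar p g₀ j) ^ 2 = (-Real.log (gbar p g₀ j)) ^ 2 := by ring
  rw [hlsq] at hq
  generalize -Real.log (gbar p g₀ j) = ℓ at *
  generalize gbar p g₀ j = g at *
  generalize chi Ω p.β j = χ at *
  generalize (quadFlow p g₀ j).2.1 = z at *
  generalize (quadFlow p g₀ j).2.2 = m at *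
  have hℓ : 0 < ℓ := by linarith
  have hχg : χ * g ≤ g := mul_le_of_le_one_left hg.le hχ1
  have hz' : |z| ≤ Cz * g := hz.trans (mul_le_mul_of_nonneg_left hχg hCz)
  have hm' : |m| ≤ Cm * g := hμ.trans (mul_le_mul_of_nonneg_left hχg hCm)
  have hCχ : 0 ≤ C₀ * χ := by positivity
  have mb : ∀ {a b A Bb : ℝ}, |a| ≤ A → |b| ≤ Bb → |a * b| ≤ A * Bb := by
    intro a b A Bb h1 h2
    rw [abs_mul]
    exact mul_le_mul h1 h2 (abs_nonneg _) ((abs_nonneg _).trans h1)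
  have hgabs : |g| ≤ g := (abs_of_pos hg).le
  have small : ∀ k r s : ℝ, 0 ≤ r → 0 ≤ s → k ≤ (B + C₀ * (1 + Cz)) * S → r ≤ rμ →
      s ≤ g * ℓ ^ 2 → k * r * s ≤ ε₂ := by
    intro k r s hr hs h1 h2 h3
    refine le_trans ?_ hq
    exact mul_le_mul (mul_le_mul h1 h2 hr (by positivity)) h3 hs (by positivity)
  have hℓ2 : 1 ≤ ℓ ^ 2 := one_le_pow₀ hl1
  have hs1 : g ≤ g * ℓ ^ 2 := le_mul_of_one_le_right hg.le hℓ2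
  have hs2 : g * ℓ ≤ g * ℓ ^ 2 := 
    mul_le_mul_of_nonneg_left (le_self_pow₀ hl1 two_ne_zero) hg.le
  have hs3 : g ^ 2 * ℓ ≤ g * ℓ ^ 2 := by
    have := mul_le_mul_of_nonneg_left (hg1.trans hl1) (mul_pos hg hℓ).le
    linarith
  have hkC : C₀ * S ≤ (B + C₀ * (1 + Cz)) * S := by
    refine mul_le_mul_of_nonneg_right ?_ hS.le
    linarith [mul_nonneg hC0 hCz]
  have hkB : B * S ≤ (B + C₀ * (1 + Cz)) * S := by
    refine mul_le_mul_of_nonneg_right ?_ hS.le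
    linarith [mul_nonneg hC0 hCz]
  have hkz : C₀ * (1 + Cz) * S ≤ (B + C₀ * (1 + Cz)) * S := by
    refine mul_le_mul_of_nonneg_right ?_ hS.le
    linarith
  have hrgz : rg / rz ≤ 1 := (div_le_one hrz).mpr hk.rg_le
  have hrzμ : rz / rμ ≤ 1 := (div_le_one hrμ).mpr hk.rz_le
  have hrgμ : rg / rμ ≤ 1 := (div_le_one hrμ).mpr (hk.rg_le.trans hk.rz_le)
  have hrg' : rg ≤ rμ := hk.rg_le.trans hk.rz_le
  have hrz' := hk.rz_le
  have prodle : ∀ {x y : ℝ}, 0 ≤ x → x ≤ rμ → y ≤ 1 → x * y ≤ rμ := fun h0 h1 h2 =>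
    (mul_le_of_le_one_right h0 h2).trans h1
  have hχs : ∀ {s q : ℝ}, 0 ≤ s → s ≤ q → χ * s ≤ q := fun h0 h1 =>
    (mul_le_of_le_one_left h0 hχ1).trans h1
  refine ⟨⟨?_, ?_, ?_⟩, fun i i1 i4 i5 => ?_⟩
  · rw [abs_neg]
    refine abs_mul_div_le (K := C₀ * χ * ((2 + Cz) * g)) (T := C₀ * (2 + Cz) * S * rg / rz) ?_
      (by positivity) (by positivity) ?_ ?_
    · have h1 := mb (mb (show |(2 : ℝ)| ≤ 2 by norm_num) bθ) hgabs
      have h2 := mb bζ hz'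
      refine (abs_add_le _ _).trans ?_
      linarith
    · field_simp
    · rw [div_le_iff₀ hrz]
      exact hlinz
  · refine abs_mul_div_le (K := 2 * (C₀ * χ)) (T := 2 * C₀ * S * rg / rμ) ?_
      (by positivity) (by positivity) ?_ ?_
    · have h1 := mb (mb (show |(2 : ℝ)| ≤ 2 by norm_num) bgg) hgabs
      have h2 := mb bgz hz'
      have h3 := mb bgμ hm'
      refine (abs_sub _ _).trans ?_
      have h4 := abs_sub (p.η j - 2 * p.υgg j * g) (p.υgz j * z)
      have h5 := abs_sub (p.η j) (2 * p.υgg j * g)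
      have h6 := mul_le_mul_of_nonneg_left hlin hCχ
      have h7 : 0 ≤ C₀ * χ * (Cz * g) := by positivity
      linarith
    · field_simp
    · rw [div_le_iff₀ hrμ]
      refine le_trans ?_ hlinμ
      exact mul_le_mul_of_nonneg_left hk.rg_le (by positivity)
  · refine abs_mul_div_le (K := 2 * (C₀ * χ)) (T := χ * (2 * C₀ * S * rz / rμ)) ?_
      (by positivity) (by positivity) ?_ ?_
    · have h1 := mb bgz hgabs
      have h2 := mb (mb (show |(2 : ℝ)| ≤ 2 by norm_num) bzz) hz'
      have h3 := mb bzμ hm'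
      refine (abs_sub _ _).trans ?_
      have h4 := abs_sub (p.γ j - p.υgz j * g) (2 * p.υzz j * z)
      have h5 := abs_sub (p.γ j) (p.υgz j * g)
      have h6 := mul_le_mul_of_nonneg_left hlin hCχ
      have h7 : 0 ≤ C₀ * χ * g := by positivity
      linarith
    · field_simp
    · refine (mul_le_of_le_one_left (by positivity) hχ1).trans ?_
      rw [div_le_iff₀ hrμ]
      exact hlinμ
  · fin_cases i
    -- The term `β g²` is the only one that yields `g log² g`; it is the reason why smallness is
    -- measured by that quantity.
    · simp only [Fin.zero_eta, Matrix.cons_val]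
      rw [abs_neg]
      refine abs_mul_div_le (T := B * S * rg * (g * ℓ ^ 2)) hβ
        (by positivity) (by positivity) ?_ (small _ _ _ hrg.le (by positivity) hkB hrg' le_rfl)
      field_simp
    · exact absurd rfl i1
    · simp only [Fin.reduceFinMk, Matrix.cons_val]
      rw [abs_neg]
      refine abs_mul_div_le (T := C₀ * S * (rg * (rg / rz)) * (g * ℓ)) bθ
        (by positivity) (by positivity) ?_
        (small _ _ _ (by positivity) (by positivity) hkC (prodle hrg.le hrg' hrgz) hs2)
      field_simp
    · simp only [Fin.reduceFinMk, Matrix.cons_val]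
      rw [abs_neg, mul_assoc]
      refine abs_mul_div_le (T := C₀ * S * rg * (χ * (g * ℓ))) bζ
        (by positivity) (by positivity) ?_
        (small _ _ _ (by positivity) (by positivity) hkC hrg' (hχs (by positivity) hs2))
      field_simp
    · exact absurd rfl i4
    · exact absurd rfl i5
    · simp only [Fin.reduceFinMk, Matrix.cons_val]
      rw [abs_neg]
      refine abs_mul_div_le (K := C₀ * χ * ((1 + Cz) * g))
        (T := C₀ * (1 + Cz) * S * 1 * (χ * g)) ?_
        (by positivity) (by positivity) ?_
        (small _ _ _ (by positivity) (by positivity) hkz hk.one_le (hχs hg.le hs1))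
      · have h1 := mb bgμ hgabs
        have h2 := mb bzμ hz'
        refine (abs_add_le _ _).trans ?_
        linarith
      · field_simp
    · simp only [Fin.reduceFinMk, Matrix.cons_val]
      rw [abs_neg]
      refine abs_mul_div_le (T := C₀ * S * (rg * (rg / rμ)) * (g ^ 2 * ℓ)) bgg
        (by positivity) (by positivity) ?_
        (small _ _ _ (by positivity) (by positivity) hkC (prodle hrg.le hrg' hrgμ) hs3)
      field_simp
    · simp only [Fin.reduceFinMk, Matrix.cons_val]
      rw [abs_neg, mul_assoc]
      refine abs_mul_div_le (T := C₀ * S * (rg * (rz / rμ)) * (χ * (g ^ 2 * ℓ))) bgz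
        (by positivity) (by positivity) ?_
        (small _ _ _ (by positivity) (by positivity) hkC (prodle hrg.le hrg' hrzμ)
          (hχs (by positivity) hs3))
      field_simp
    · simp only [Fin.reduceFinMk, Matrix.cons_val]
      rw [abs_neg, mul_assoc]
      refine abs_mul_div_le (T := C₀ * S * rg * (χ * (g ^ 2 * ℓ))) bgμ
        (by positivity) (by positivity) ?_
        (small _ _ _ (by positivity) (by positivity) hkC hrg' (hχs (by positivity) hs3))
      field_simp
    · simp only [Fin.reduceFinMk, Matrix.cons_val]
      rw [abs_neg]
      refine abs_mul_div_le (T := C₀ * S * (rz * (rz / rμ)) * (χ * (χ * (g ^ 2 * ℓ)))) bzz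
        (by positivity) (by positivity) ?_
        (small _ _ _ (by positivity) (by positivity) hkC (prodle hrz.le hrz' hrzμ)
          (hχs (by positivity) (hχs (by positivity) hs3)))
      field_simp
    · simp only [Fin.reduceFinMk, Matrix.cons_val]
      rw [abs_neg, mul_assoc]
      refine abs_mul_div_le (T := C₀ * S * rz * (χ * (χ * (g ^ 2 * ℓ)))) bzμ
        (by positivity) (by positivity) ?_
        (small _ _ _ (by positivity) (by positivity) hkC hrz'
          (hχs (by positivity) (hχs (by positivity) hs3)))
      field_simp

/-- Weights at consecutive times are comparable, so each relation reduces to one of the conditions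
in `ScaleConsts` together with a smallness condition in `Weak`. -/
theorem rgScale_bounds (hΩ : 1 < Ω) (hc : 0 < c) (hlam : 1 < lam₀)
    (hF : FlowControl Ω B c D lam₀ C₀ p d e)
    (hV : BaseFlow Ω B c D lam₀ C₀ p g₀ (quadFlow p g₀)) (hκ : 0 ≤ κ) (hM : 0 ≤ M)
    (hk : ScaleConsts B c lam₀ C₀ (κ * Ω) M θ t ε₁ ε₂ rK rg rz rμ) {H : ℝ}
    (hε₁ : ε₁ ≤ 1) (hε₂ : ε₂ ≤ 1) (hε : 2 * ε₁ + ε₂ * (1 + 10 * H) ≤ θ / 2)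
    (hw : ∀ j, Weak B c lam₀ C₀ (κ * Ω) M θ t ε₂ rK rμ (gbar p g₀ j)) :
    ∃ C, ScaleBounds p (rgScale p Ω g₀ (solveConst c lam₀) rK rg rz rμ) (quadFlow p g₀)
      (fun j => rμ * (gbar p g₀ j ^ 2 * -Real.log (gbar p g₀ j))) Ω κ M g₀ θ H ε₁ ε₂ C := by
  have hS := solveConst_pos hc hlam
  have hrK := hk.rK_pos
  have hrg := hk.rg_pos
  have hrz : 0 < rz := hrg.trans_le hk.rg_le
  have hrμ : 0 < rμ := hrz.trans_le hk.rz_le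
  have hG : IsGSeq B D g₀ p.β (gbar p g₀) := hV.gseq
  have hC := hF.ctl
  have hg := hG.pos hc hC
  have hχ := hC.pos
  have hχ1 := hC.chi_le_one
  have hl1 : ∀ j, 1 ≤ -Real.log (gbar p g₀ j) := fun j => (hw j).log_ge
  have hl : ∀ j, 0 < -Real.log (gbar p g₀ j) := fun j => one_pos.trans_le (hl1 j)
  have habs : ∀ j, |Real.log (gbar p g₀ j)| = -Real.log (gbar p g₀ j) := fun j =>
    abs_of_neg (by linarith [hl j])
  have hGpos : ∀ j, 0 < gbar p g₀ j ^ 2 * -Real.log (gbar p g₀ j) := fun j =>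
    mul_pos (pow_pos (hg j) 2) (hl j)
  have hApos : ∀ j, 0 < chi Ω p.β j * gbar p g₀ j ^ 3 := fun j =>
    mul_pos (hχ j) (pow_pos (hg j) 3)
  have hup : ∀ j, gbar p g₀ (j + 1) ≤ 2 * gbar p g₀ j := fun j =>
    hG.almost_anti hc hC (Nat.le_succ j)
  have hdn := hG.le_two_succ hc hC
  have hup3 : ∀ j, chi Ω p.β (j + 1) * gbar p g₀ (j + 1) ^ 3 ≤
      8 * (chi Ω p.β j * gbar p g₀ j ^ 3) := by
    intro j
    have h1 := pow_le_pow_left₀ (hg (j + 1)).le (hup j) 3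
    have := mul_le_mul (hC.anti j) h1 (by have := hg (j + 1); positivity) (hχ j).le
    linarith
  -- One step costs `Ω` in `χ` and `1 + t` in `g³`; this is where `κ Ω < 1` is decisive.
  have hdn3 : ∀ j, chi Ω p.β j * gbar p g₀ j ^ 3 ≤
      Ω * (1 + t) * (chi Ω p.β (j + 1) * gbar p g₀ (j + 1) ^ 3) := by
    intro j
    have h1 := hG.cube_le hc hC hk.t_pos.le hk.t_le (hw j).ratio
    have := mul_le_mul (hC.ratio j) h1 (by have := hg j; positivity)
      (by have := hχ (j + 1); positivity)
    linarith
  -- One summand for each of `A_le_wK`, `A_le_vg`, `wK_le_A` and `wV_le_G`.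
  refine ⟨1 / rK + 8 * solveConst c lam₀ / rg + rK * (Ω * (1 + t)) + 4 * rμ, ?_⟩
  have n1 : 0 < 1 / rK := by positivity
  have n2 : 0 < 8 * solveConst c lam₀ / rg := by positivity
  have n3 : 0 < rK * (Ω * (1 + t)) := by have := hk.t_pos; positivity
  have hwχ : ∀ r, 0 < r → r ≤ rμ → ∀ j,
      r * (chi Ω p.β j * gbar p g₀ j ^ 2 * -Real.log (gbar p g₀ j)) ≤
      rμ * (gbar p g₀ j ^ 2 * -Real.log (gbar p g₀ j)) := by
    intro r h0 hr j
    rw [mul_assoc (chi Ω p.β j)]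
    exact mul_le_mul hr (mul_le_of_le_one_left (hGpos j).le (hχ1 j))
      (mul_pos (hχ j) (hGpos j)).le hrμ.le
  refine ⟨fun j => ?_, hwχ rz hrz hk.rz_le, hwχ rμ hrμ le_rfl, fun j => ?_, fun j => ?_,
    fun j => ?_, fun j => ?_, fun j => ?_, fun j => (rgScale_coeff hc hlam hF hV hk j (hw j)).1,
    fun j => (rgScale_coeff hc hlam hF hV hk j (hw j)).2, hε₁, hε₂, hε, by linarith,
    fun j => hApos _, fun j => ?_, fun j => ?_, fun j => ?_, fun j => ?_, fun j => ?_⟩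
  · exact mul_le_mul_of_nonneg_right (hk.rg_le.trans hk.rz_le) (hGpos j).le
  · refine mul_le_mul (div_le_div_of_nonneg_right hk.rg_le hS.le) ?_ (hApos j).le (by positivity)
    exact le_mul_of_one_le_right (hApos j).le (hl1 j)
  · refine mul_le_mul (div_le_div_of_nonneg_right (hk.rg_le.trans hk.rz_le) hS.le) ?_
      (hApos j).le (by positivity)
    rw [mul_assoc]
    refine mul_le_mul_of_nonneg_left ?_ (hχ j).le
    rw [pow_succ]
    exact mul_le_mul_of_nonneg_left ((hw j).le_one.trans (hl1 j)) (by have := hg j; positivity)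
  · simp only [rgScale]
    have h1 := mul_le_mul_of_nonneg_left (hdn3 j) (show 0 ≤ κ * rK by positivity)
    have h2 := mul_le_mul_of_nonneg_right hk.contraction
      (mul_pos hrK (hApos (j + 1))).le
    have h3 := mul_le_mul_of_nonneg_right (hw j).pert_K (hApos (j + 1)).le
    have h4 : M * chi Ω p.β (j + 1) * gbar p g₀ (j + 1) ^ 2 *
        (rμ * (gbar p g₀ j ^ 2 * -Real.log (gbar p g₀ j))) ≤
        2 * M * rμ * (gbar p g₀ j * -Real.log (gbar p g₀ j)) *
          (chi Ω p.β (j + 1) * gbar p g₀ (j + 1) ^ 3) := by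
      have h5 := mul_le_mul_of_nonneg_left (hdn j)
        (show 0 ≤ M * chi Ω p.β (j + 1) * gbar p g₀ (j + 1) ^ 2 *
          (rμ * (gbar p g₀ j * -Real.log (gbar p g₀ j))) by
          have := hg j
          have := hχ (j + 1)
          have := hl j
          positivity)
      linarith
    linarith
  · simp only [rgScale]
    have h1 := mul_le_mul_of_nonneg_right hk.pert_le (hApos j).le
    have h3 := mul_le_mul_of_nonneg_right (hw j).pert_V (hApos j).le
    have h4 : M * chi Ω p.β (j + 1) * gbar p g₀ (j + 1) ^ 2 *
        (rμ * (gbar p g₀ j ^ 2 * -Real.log (gbar p g₀ j))) ≤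
        4 * M * rμ * (gbar p g₀ j * -Real.log (gbar p g₀ j)) *
          (chi Ω p.β j * gbar p g₀ j ^ 3) := by
      have h6 := pow_le_pow_left₀ (hg (j + 1)).le (hup j) 2
      have h7 := mul_le_mul (hC.anti j) h6 (by have := hg (j + 1); positivity) (hχ j).le
      have h5 := mul_le_mul_of_nonneg_left h7
        (show 0 ≤ M * (rμ * (gbar p g₀ j ^ 2 * -Real.log (gbar p g₀ j))) by
          have := hGpos j
          positivity)
      linarith
    linarith
  · simp only [rgScale]
    have h1 := mul_le_mul_of_nonneg_left (hup3 j) hM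
    have h2 := mul_le_mul_of_nonneg_right hk.zero_le (hApos j).le
    linarith
  · rw [habs]
    exact hGpos _
  · simp only [rgScale]
    rw [← mul_assoc]
    refine le_mul_of_one_le_left (hApos _).le ?_
    have : 1 / rK * rK = 1 := by field_simp
    nlinarith
  · simp only [rgScale]
    refine (hup3 j).trans ?_
    rw [← mul_assoc _ (rg / solveConst c lam₀)]
    refine mul_le_mul_of_nonneg_right ?_ (hApos j).le
    have h8 : 8 * solveConst c lam₀ / rg * (rg / solveConst c lam₀) = 8 := by field_simp
    have h9 : 0 < rg / solveConst c lam₀ := by positivity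
    nlinarith
  · simp only [rgScale]
    have h1 := mul_le_mul_of_nonneg_left (hdn3 j) hrK.le
    refine h1.trans ?_
    rw [← mul_assoc]
    refine mul_le_mul_of_nonneg_right ?_ (hApos _).le
    linarith
  · rw [habs]
    have h1 := mul_neg_log_le (hg j) (hg (j + 1)) (hdn j) (hG.log_two_le hc hC (j + 1))
    have h2 := mul_le_mul (hdn j) h1 (mul_pos (hg j) (hl j)).le (by have := hg (j + 1); positivity)
    have h3 := mul_le_mul_of_nonneg_left h2 hrμ.le
    have h4 : 4 * rμ * (gbar p g₀ (j + 1) ^ 2 * -Real.log (gbar p g₀ (j + 1))) ≤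
        (1 / rK + 8 * solveConst c lam₀ / rg + rK * (Ω * (1 + t)) + 4 * rμ) *
          (gbar p g₀ (j + 1) ^ 2 * -Real.log (gbar p g₀ (j + 1))) :=
      mul_le_mul_of_nonneg_right (by linarith) (hGpos _).le
    refine le_trans ?_ h4
    linarith

end

end RGFlow

/-! ### Changes of centre and of weights -/

namespace RGFlow

open Filter Topology Metric Finset

universe u

section

variable {W : ℕ → Type u} [∀ j, NormedAddCommGroup (W j)]
  {p : Params} {Ω A A' H H' g₀ g₁ q : ℝ} {j : ℕ} {x y z : XSpace W j}

lemma WeightedClose.symm (h : WeightedClose p Ω A H g₀ j x y) : WeightedClose p Ω A H g₀ j y x :=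
  ⟨by rw [norm_sub_rev]; exact h.K_le, by rw [abs_sub_comm]; exact h.g_le,
    by rw [abs_sub_comm]; exact h.z_le, by rw [abs_sub_comm]; exact h.μ_le⟩

lemma WeightedClose.trans (h : WeightedClose p Ω A H g₀ j x y)
    (h' : WeightedClose p Ω A' H' g₀ j y z) : WeightedClose p Ω (A + A') (H + H') g₀ j x z := by
  refine ⟨?_, ?_, ?_, ?_⟩
  · have := norm_sub_le_norm_sub_add_norm_sub x.1 y.1 z.1
    linarith [h.K_le, h'.K_le]
  · have := abs_sub_le x.2.1 y.2.1 z.2.1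
    linarith [h.g_le, h'.g_le]
  · have := abs_sub_le x.2.2.1 y.2.2.1 z.2.2.1
    linarith [h.z_le, h'.z_le]
  · have := abs_sub_le x.2.2.2 y.2.2.2 z.2.2.2
    linarith [h.μ_le, h'.μ_le]

lemma WeightedClose.mono (hχ : 0 ≤ chi Ω p.β j) (hg : 0 ≤ gbar p g₀ j) (hA : A ≤ A') (hH : H ≤ H')
    (h : WeightedClose p Ω A H g₀ j x y) : WeightedClose p Ω A' H' g₀ j x y :=
  ⟨h.K_le.trans (by gcongr), h.g_le.trans (by gcongr), h.z_le.trans (by gcongr),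
    h.μ_le.trans (by gcongr)⟩

/-- The two couplings have comparable weights. -/
structure Comparable (q g g' : ℝ) : Prop where
  cube : g ^ 3 ≤ q * g' ^ 3
  sq_log : g ^ 2 * |Real.log g| ≤ q * (g' ^ 2 * |Real.log g'|)

lemma WeightedClose.change_base (hχ : 0 ≤ chi Ω p.β j) (hA : 0 ≤ A) (hH : 0 ≤ H)
    (hq : Comparable q (gbar p g₀ j) (gbar p g₁ j)) (h : WeightedClose p Ω A H g₀ j x y) :
    WeightedClose p Ω (q * A) (q * H) g₁ j x y := by
  have h1 := mul_le_mul_of_nonneg_left hq.cube (mul_nonneg hA hχ)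
  have h2 := mul_le_mul_of_nonneg_left hq.sq_log hH
  have h3 := mul_le_mul_of_nonneg_left hq.sq_log (mul_nonneg hH hχ)
  refine ⟨h.K_le.trans ?_, h.g_le.trans ?_, h.z_le.trans ?_, h.μ_le.trans ?_⟩ <;> linarith

/-- Nearby couplings have comparable weights. -/
lemma exists_comparable {q : ℝ} (hq : 1 < q) : ∃ τ, 0 < τ ∧ ∀ g g' : ℝ, 0 < g' →
    Real.log g' ≤ -1 → |g - g'| ≤ τ * g' → Comparable q g g' ∧ Comparable q g' g := by
  have hlq := Real.log_pos hq
  -- The logarithms of the two couplings differ by at most `2 τ`, so the cubes change by a factor of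
  -- at most `exp (6 τ)` and the other weights by at most `exp (8 τ)`.
  refine ⟨min (1 / 4) (Real.log q / 8), lt_min (by norm_num) (by positivity), ?_⟩
  intro g g' hg' hl hgg
  set τ := min (1 / 4) (Real.log q / 8) with hτ
  have hτ4 : τ ≤ 1 / 4 := min_le_left _ _
  have hτq : 8 * τ ≤ Real.log q := by
    have : τ ≤ Real.log q / 8 := min_le_right _ _
    linarith
  have hτ0 : 0 < τ := lt_min (by norm_num) (by positivity)
  obtain ⟨h1, h2⟩ := abs_le.mp hgg
  have hg : 0 < g := by nlinarith
  set s := Real.log g - Real.log g' with hs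
  have hs1 : s ≤ 2 * τ := by
    have h3 := Real.log_le_sub_one_of_pos (div_pos hg hg')
    rw [Real.log_div hg.ne' hg'.ne'] at h3
    have h4 : g / g' ≤ 1 + τ := by rw [div_le_iff₀ hg']; linarith
    linarith
  have hs2 : -s ≤ 2 * τ := by
    have h3 := Real.log_le_sub_one_of_pos (div_pos hg' hg)
    rw [Real.log_div hg'.ne' hg.ne'] at h3
    have h4 : g' / g ≤ 1 + 2 * τ := by
      rw [div_le_iff₀ hg]
      have h5 : (1 + 2 * τ) * ((1 - τ) * g') ≤ (1 + 2 * τ) * g :=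
        mul_le_mul_of_nonneg_left (by linarith) (by linarith)
      have h6 : 1 ≤ (1 + 2 * τ) * (1 - τ) := by nlinarith
      have h7 := mul_le_mul_of_nonneg_right h6 hg'.le
      linarith
    linarith
  have hqe : ∀ v, v ≤ 8 * τ → Real.exp v ≤ q := fun v hv => by
    rw [← Real.le_log_iff_exp_le (by linarith)]
    linarith
  have eg : g = Real.exp s * g' := by
    rw [hs, Real.exp_sub, Real.exp_log hg, Real.exp_log hg']
    field_simp
  have eg' : g' = Real.exp (-s) * g := by
    rw [hs, Real.exp_neg, Real.exp_sub, Real.exp_log hg, Real.exp_log hg']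
    field_simp
  -- The additive error `2 τ` of the logarithm becomes a factor `exp (2 τ)` because `|log g'| ≥ 1`,
  -- and `exp (4 τ)` in the other direction because `|log g| ≥ 1/2`.
  have hlg : Real.log g ≤ -(1 / 2) := by linarith
  have hll : |Real.log g| ≤ Real.exp (2 * τ) * |Real.log g'| := by
    rw [abs_of_neg (by linarith : Real.log g < 0), abs_of_neg (by linarith : Real.log g' < 0)]
    have h3 := Real.add_one_le_exp (2 * τ)
    have h4 := mul_le_mul_of_nonneg_right h3 (show 0 ≤ -Real.log g' by linarith)
    nlinarith
  have hll' : |Real.log g'| ≤ Real.exp (4 * τ) * |Real.log g| := by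
    rw [abs_of_neg (by linarith : Real.log g < 0), abs_of_neg (by linarith : Real.log g' < 0)]
    have h3 := Real.add_one_le_exp (4 * τ)
    have h4 := mul_le_mul_of_nonneg_right h3 (show 0 ≤ -Real.log g by linarith)
    nlinarith
  have cube : ∀ {v : ℝ}, v ≤ 2 * τ → Real.exp v ^ 3 ≤ q := fun hv => by
    rw [← Real.exp_nat_mul]
    refine hqe _ ?_
    push_cast
    linarith
  have sq : ∀ {v : ℝ}, v ≤ 2 * τ → Real.exp v ^ 2 * Real.exp (4 * τ) ≤ q := fun hv => by
    rw [← Real.exp_nat_mul, ← Real.exp_add]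
    refine hqe _ ?_
    push_cast
    linarith
  have sq' : ∀ {v : ℝ}, v ≤ 2 * τ → Real.exp v ^ 2 * Real.exp (2 * τ) ≤ q := fun hv => by
    rw [← Real.exp_nat_mul, ← Real.exp_add]
    refine hqe _ ?_
    push_cast
    linarith
  refine ⟨⟨?_, ?_⟩, ?_, ?_⟩
  · have : g ^ 3 = Real.exp s ^ 3 * g' ^ 3 := by rw [← mul_pow, ← eg]
    rw [this]
    exact mul_le_mul_of_nonneg_right (cube hs1) (by positivity)
  · have : g ^ 2 = Real.exp s ^ 2 * g' ^ 2 := by rw [← mul_pow, ← eg]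
    rw [this]
    calc Real.exp s ^ 2 * g' ^ 2 * |Real.log g|
        ≤ Real.exp s ^ 2 * g' ^ 2 * (Real.exp (2 * τ) * |Real.log g'|) :=
          mul_le_mul_of_nonneg_left hll (by positivity)
      _ = (Real.exp s ^ 2 * Real.exp (2 * τ)) * (g' ^ 2 * |Real.log g'|) := by ring
      _ ≤ _ := mul_le_mul_of_nonneg_right (sq' hs1) (by positivity)
  · have : g' ^ 3 = Real.exp (-s) ^ 3 * g ^ 3 := by rw [← mul_pow, ← eg']
    rw [this]
    exact mul_le_mul_of_nonneg_right (cube hs2) (by positivity)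
  · have : g' ^ 2 = Real.exp (-s) ^ 2 * g ^ 2 := by rw [← mul_pow, ← eg']
    rw [this]
    calc Real.exp (-s) ^ 2 * g ^ 2 * |Real.log g'|
        ≤ Real.exp (-s) ^ 2 * g ^ 2 * (Real.exp (4 * τ) * |Real.log g|) :=
          mul_le_mul_of_nonneg_left hll' (by positivity)
      _ = (Real.exp (-s) ^ 2 * Real.exp (4 * τ)) * (g ^ 2 * |Real.log g|) := by ring
      _ ≤ _ := mul_le_mul_of_nonneg_right (sq hs2) (by positivity)

end

section

variable {W : ℕ → Type u}
  {p : Params} {ψ : ∀ j, XSpace W j → W (j + 1)} {ρ : ∀ j, XSpace W j → VSpace}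
  {Ω a h κ R M g₀ : ℝ}

lemma isFlow_evolutionBar {u : W 0 × ℝ} (h : IsQuadFlow p u.2 (quadFlow p u.2)) :
    IsFlow (evolutionBar p ψ) u (approxFlow p ψ u) :=
  ⟨fun j => Prod.ext rfl (h.step j), rfl, h.init, h.z_lim, h.μ_lim⟩

lemma IsFlow.eq_approxFlow {u : W 0 × ℝ}
    (huniq : ∀ V, IsQuadFlow p u.2 V → V = quadFlow p u.2) {y : ∀ j, XSpace W j}
    (hy : IsFlow (evolutionBar p ψ) u y) : y = approxFlow p ψ u := by
  have h1 := huniq (fun j => (y j).2)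
    ⟨fun j => congrArg Prod.snd (hy.step j), hy.g_init, hy.z_lim, hy.μ_lim⟩
  have h2 : ∀ j, (y j).2 = quadFlow p u.2 j := fun j => congrFun h1 j
  funext j
  refine Prod.ext ?_ (h2 j)
  induction j with
  | zero => exact hy.K_init
  | succ j ih =>
    have h3 : (y (j + 1)).1 = ψ j (y j) := congrArg Prod.fst (hy.step j)
    have h4 : y j = (Kbar p ψ u j, quadFlow p u.2 j) := Prod.ext ih (h2 j)
    rw [h3, h4]
    rfl

lemma evolution_zero : evolution p ψ (fun _ _ => 0) = evolutionBar p ψ := by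
  funext j x
  simp [evolution, evolutionBar]

variable [∀ j, NormedAddCommGroup (W j)] [∀ j, NormedSpace ℝ (W j)]

/-- With `ρ = 0` the map `Φ` becomes `Φ̄`. Results on perturbed flows then apply to the approximate
flow itself. -/
lemma AssumptionA3.zero (hA : AssumptionA3 p Ω a h κ R M g₀ ψ ρ) (hM : 0 ≤ M)
    (hχ : ∀ j, 0 ≤ chi Ω p.β j) (hg : ∀ j, 0 ≤ gbar p g₀ j) :
    AssumptionA3 p Ω a h κ R M g₀ ψ (fun _ _ => 0) := by
  have h1 : ∀ j, ∀ x ∈ domain W p Ω a h g₀ j,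
      fderivWithin ℝ (fun _ : XSpace W j => (0 : VSpace)) (domain W p Ω a h g₀ j) x = 0 :=
    fun j x _ => by simp
  refine ⟨hA.ψ_smooth, fun j => contDiffOn_const, hA.ψ_le, fun j x _ => ?_, hA.ψ_derivK_le,
    fun j x hx => ?_, hA.ψ_derivV_le, fun j x hx => ?_, hA.ψ_derivVK_le, fun m n _ _ j x _ => ?_⟩
  · rw [norm_zero]
    have := hχ (j + 1)
    have := hg (j + 1)
    positivity
  · rw [derivK, h1 j x hx]
    simpa using hM
  · rw [derivV, h1 j x hx]
    have := hχ (j + 1)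
    have := hg (j + 1)
    rw [ContinuousLinearMap.zero_comp, norm_zero]
    positivity
  · have h2 : derivVK m n (fun _ : XSpace W j => (0 : VSpace)) (domain W p Ω a h g₀ j) x = 0 := by
      refine ContinuousMultilinearMap.ext fun v => ?_
      simp only [derivVK, ContinuousMultilinearMap.compContinuousLinearMap_apply]
      have h3 : iteratedFDerivWithin ℝ (m + n) (fun _ : XSpace W j => (0 : VSpace))
          (domain W p Ω a h g₀ j) = 0 := iteratedFDerivWithin_fun_zero
      rw [h3]
      rfl
    rw [h2, norm_zero]
    have := hχ (j + 1)
    have := hg (j + 1)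
    positivity

/-- In weighted form the `K`-equation reads `A ↦ κ s A + R`, which preserves the bound `aStar`. -/
lemma norm_Kbar_le (hA : AssumptionA3 p Ω a h κ R M g₀ ψ ρ) (hκ : 0 ≤ κ) (hh : 0 ≤ h)
    {aStar s : ℝ} (haS : aStar ≤ a) (hχ : ∀ j, 0 < chi Ω p.β j)
    (hg : ∀ j, 0 < gbar p g₀ j)
    (hs : ∀ j, chi Ω p.β j * gbar p g₀ j ^ 3 ≤ s * (chi Ω p.β (j + 1) * gbar p g₀ (j + 1) ^ 3))
    (haS0 : 0 ≤ aStar) (hR : κ * s * aStar + R ≤ aStar) {K₀ : W 0}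
    (hK : ‖K₀‖ ≤ aStar * (chi Ω p.β 0 * gbar p g₀ 0 ^ 3)) (j : ℕ) :
    ‖Kbar p ψ (K₀, g₀) j‖ ≤ aStar * (chi Ω p.β j * gbar p g₀ j ^ 3) := by
  have hw : ∀ j, 0 < chi Ω p.β j * gbar p g₀ j ^ 3 := fun j => mul_pos (hχ j) (pow_pos (hg j) 3)
  induction j with
  | zero => exact hK
  | succ j ih =>
    have hmem : ∀ K : W j, ‖K‖ ≤ aStar * (chi Ω p.β j * gbar p g₀ j ^ 3) →
        (K, quadFlow p g₀ j) ∈ domain W p Ω a h g₀ j := by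
      intro K hK
      have := hχ j
      have := hg j
      refine ⟨?_, ?_, ?_, ?_⟩
      · simp only [sub_zero]
        refine hK.trans ?_
        rw [mul_assoc]
        exact mul_le_mul_of_nonneg_right haS (hw j).le
      all_goals
        simp only [sub_self, abs_zero]
        positivity
    have h0 := hmem 0 (by rw [norm_zero]; exact mul_nonneg haS0 (hw j).le)
    have h1 := norm_sub_le_of_partial_derivs (convex_domain (W := W) p Ω a h g₀ j)
      ((hA.ψ_smooth j).differentiableOn (by norm_num)) (hA.ψ_derivK_le j) (hA.ψ_derivV_le j)
      (hmem _ ih) h0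
    simp only [sub_zero, sub_self, norm_zero, mul_zero, add_zero] at h1
    have h2 := hA.ψ_le j _ h0
    simp only at h2
    have h3 : Kbar p ψ (K₀, g₀) (j + 1) = ψ j (Kbar p ψ (K₀, g₀) j, quadFlow p g₀ j) := rfl
    rw [h3]
    have h4 := norm_le_norm_add_norm_sub' (ψ j (Kbar p ψ (K₀, g₀) j, quadFlow p g₀ j))
      (ψ j (0, quadFlow p g₀ j))
    have h5 := mul_le_mul_of_nonneg_left (ih.trans (mul_le_mul_of_nonneg_left (hs j) haS0)) hκ
    have h6 := mul_le_mul_of_nonneg_right hR (hw (j + 1)).le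
    linarith

variable {S rK rg rz rμ A H : ℝ} {j : ℕ}

lemma weightedClose_up (hrK : 0 ≤ rK) (hrg : 0 ≤ rg) (hrz : 0 ≤ rz) (hrμ : 0 ≤ rμ)
    (hχ : 0 ≤ chi Ω p.β j) (hg : 0 ≤ gbar p g₀ j) (hl : Real.log (gbar p g₀ j) ≤ 0)
    {HK Hg Hz Hμ : ℝ} (hK : rK * HK ≤ A) (hgH : rg * Hg ≤ H) (hzH : rz * Hz ≤ H)
    (hμH : rμ * Hμ ≤ H) (x y : XSpace W j) (hy : y ∈ box (W j) HK Hg Hz Hμ) :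
    WeightedClose p Ω A H g₀ j (x + (rgScale p Ω g₀ S rK rg rz rμ).up W j y) x := by
  obtain ⟨h1, h2, h3, h4⟩ := hy
  have hl' : 0 ≤ -Real.log (gbar p g₀ j) := by linarith
  have eK : 0 ≤ chi Ω p.β j * gbar p g₀ j ^ 3 := by positivity
  have eg : 0 ≤ gbar p g₀ j ^ 2 * -Real.log (gbar p g₀ j) := by positivity
  have ez : 0 ≤ chi Ω p.β j * gbar p g₀ j ^ 2 * -Real.log (gbar p g₀ j) := by positivity
  have gen : ∀ {r w v T E : ℝ}, 0 ≤ r → 0 ≤ w → |v| ≤ T → r * T ≤ E → |r * w * v| ≤ E * w := by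
    intro r w v T E hr hw hv hE
    rw [abs_mul, abs_of_nonneg (mul_nonneg hr hw)]
    have := mul_le_mul_of_nonneg_left hv (mul_nonneg hr hw)
    have := mul_le_mul_of_nonneg_right hE hw
    linarith
  refine ⟨?_, ?_, ?_, ?_⟩ <;>
    simp only [Scale.up, scaleMap_apply, rgScale, Prod.fst_add, Prod.snd_add, add_sub_cancel_left]
  · rw [norm_smul, Real.norm_eq_abs, ← abs_of_nonneg (norm_nonneg y.1), ← abs_mul]
    refine (gen hrK eK (T := HK) (by rwa [abs_of_nonneg (norm_nonneg y.1)]) hK).trans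
      (le_of_eq (by ring))
  · rw [abs_of_nonpos hl]
    exact (gen hrg eg h2 hgH).trans (le_of_eq (by ring))
  · rw [abs_of_nonpos hl]
    exact (gen hrz ez h3 hzH).trans (le_of_eq (by ring))
  · rw [abs_of_nonpos hl]
    exact (gen hrμ ez h4 hμH).trans (le_of_eq (by ring))

lemma WeightedClose.exists_up (hrK : 0 < rK) (hrg : 0 < rg) (hrz : 0 < rz) (hrμ : 0 < rμ)
    (hχ : 0 < chi Ω p.β j) (hg : 0 < gbar p g₀ j) (hl : Real.log (gbar p g₀ j) < 0)
    {x x' : XSpace W j} (h : WeightedClose p Ω A H g₀ j x' x) :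
    ∃ y ∈ box (W j) (A / rK) (H / rg) (H / rz) (H / rμ),
      x' = x + (rgScale p Ω g₀ S rK rg rz rμ).up W j y := by
  have hl' : 0 < -Real.log (gbar p g₀ j) := by linarith
  have eK : 0 < rK * (chi Ω p.β j * gbar p g₀ j ^ 3) := by positivity
  have eg : 0 < gbar p g₀ j ^ 2 * -Real.log (gbar p g₀ j) := by positivity
  have ez : 0 < chi Ω p.β j * gbar p g₀ j ^ 2 * -Real.log (gbar p g₀ j) := by positivity
  obtain ⟨h1, h2, h3, h4⟩ := h
  rw [abs_of_neg hl] at h2 h3 h4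
  have gen : ∀ {r w v E : ℝ}, 0 < r → 0 < w → |v| ≤ E * w → |(r * w)⁻¹ * v| ≤ E / r := by
    intro r w v E hr hw hv
    rw [abs_mul, abs_inv, abs_of_pos (mul_pos hr hw), inv_mul_le_iff₀ (mul_pos hr hw)]
    refine hv.trans (le_of_eq ?_)
    field_simp
  refine ⟨((rK * (chi Ω p.β j * gbar p g₀ j ^ 3))⁻¹ • (x'.1 - x.1),
    (rg * (gbar p g₀ j ^ 2 * -Real.log (gbar p g₀ j)))⁻¹ * (x'.2.1 - x.2.1),
    (rz * (chi Ω p.β j * gbar p g₀ j ^ 2 * -Real.log (gbar p g₀ j)))⁻¹ * (x'.2.2.1 - x.2.2.1),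
    (rμ * (chi Ω p.β j * gbar p g₀ j ^ 2 * -Real.log (gbar p g₀ j)))⁻¹ * (x'.2.2.2 - x.2.2.2)),
    ⟨?_, gen hrg eg (h2.trans (le_of_eq (by ring))), gen hrz ez (h3.trans (le_of_eq (by ring))),
      gen hrμ ez (h4.trans (le_of_eq (by ring)))⟩, ?_⟩
  · rw [norm_smul, norm_inv, Real.norm_eq_abs, abs_of_pos eK, inv_mul_le_iff₀ eK]
    refine h1.trans (le_of_eq ?_)
    field_simp
  · simp only [Scale.up, scaleMap_apply, rgScale]
    rw [smul_inv_smul₀ eK.ne', mul_inv_cancel_left₀ (by positivity),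
      mul_inv_cancel_left₀ (by positivity), mul_inv_cancel_left₀ (by positivity)]
    ext <;> simp

end

end RGFlow

/-! ### The approximate flow and its dependence on the initial condition -/

namespace RGFlow

open Filter Topology Metric Finset

universe u

section

variable {W : ℕ → Type u} [∀ j, NormedAddCommGroup (W j)]
  {p : Params} {ψ : ∀ j, XSpace W j → W (j + 1)} {ρ : ∀ j, XSpace W j → VSpace}
  {Ω B c D lam₀ C₀ a h κ R M θ t ε₁ ε₂ rK rg rz rμ g₀ aStar H : ℝ} {d e : ℕ → ℝ} {K₀ : W 0}

lemma domain_mem_nhds_of_weightedClose {A' H' : ℝ} {j : ℕ} {x : XSpace W j}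
    (hχ : 0 < chi Ω p.β j) (hg : 0 < gbar p g₀ j) (hl : Real.log (gbar p g₀ j) < 0)
    (hA : A' < a) (hH : H' < h) (hx : WeightedClose p Ω A' H' g₀ j x (0, quadFlow p g₀ j)) :
    domain W p Ω a h g₀ j ∈ 𝓝 x := by
  have hl' : 0 < |Real.log (gbar p g₀ j)| := abs_pos.mpr hl.ne
  have h1 := hx.K_le
  rw [sub_zero] at h1
  refine domain_mem_nhds (h1.trans_lt ?_) (hx.g_le.trans_lt ?_) (hx.z_le.trans_lt ?_)
    (hx.μ_le.trans_lt ?_)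
  all_goals gcongr

variable [∀ j, NormedSpace ℝ (W j)]

/-- The approximate flow at the centre of the neighbourhood stays well inside the domains. -/
lemma approxFlow_weightedClose (hc : 0 < c) (hF : FlowControl Ω B c D lam₀ C₀ p d e)
    (hV : BaseFlow Ω B c D lam₀ C₀ p g₀ (quadFlow p g₀)) (hκ : 0 ≤ κ) (hh : 0 ≤ h)
    (hk : ScaleConsts B c lam₀ C₀ (κ * Ω) M θ t ε₁ ε₂ rK rg rz rμ)
    (hw : ∀ j, Weak B c lam₀ C₀ (κ * Ω) M θ t ε₂ rK rμ (gbar p g₀ j))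
    (hA : AssumptionA3 p Ω a h κ R M g₀ ψ ρ) (haS0 : 0 ≤ aStar) (haS : aStar ≤ a)
    (hR : κ * Ω * (1 + t) * aStar + R ≤ aStar) (hK₀ : ‖K₀‖ ≤ aStar * g₀ ^ 3) (j : ℕ) :
    WeightedClose p Ω aStar 0 g₀ j (approxFlow p ψ (K₀, g₀) j) (0, quadFlow p g₀ j) := by
  have hG : IsGSeq B D g₀ p.β (gbar p g₀) := hV.gseq
  have hg := hG.pos hc hF.ctl
  have h1 := norm_Kbar_le (s := Ω * (1 + t)) (K₀ := K₀) hA hκ hh haS hF.ctl.pos hg (fun j => ?_)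
    haS0 (by linarith) ?_ j
  · refine ⟨?_, ?_, ?_, ?_⟩ <;> simp only [approxFlow, sub_zero, sub_self, abs_zero, zero_mul]
    · linarith
    all_goals exact le_rfl
  · have h1 := hG.cube_le hc hF.ctl hk.t_pos.le hk.t_le (hw j).ratio
    have := mul_le_mul (hF.ctl.ratio j) h1 (by have := hg j; positivity)
      ((hF.ctl.pos j).le.trans (hF.ctl.ratio j))
    linarith
  · rw [hF.ctl.zero, hG.init, one_mul]
    exact hK₀

/-- The box is as large as the domain permits around the approximate flow: `a - aStar` in `K`, where
`aStar` is already used up, and the full `h` in `V`, whose centre is exact. -/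
lemma rgScale_forcingBounds (hΩ : 1 < Ω) (hc : 0 < c) (hlam : 1 < lam₀)
    (hF : FlowControl Ω B c D lam₀ C₀ p d e)
    (hV : BaseFlow Ω B c D lam₀ C₀ p g₀ (quadFlow p g₀)) (hκ : 0 ≤ κ) (hM : 0 ≤ M)
    (hk : ScaleConsts B c lam₀ C₀ (κ * Ω) M θ t ε₁ ε₂ rK rg rz rμ)
    (hε₁ : ε₁ ≤ 1) (hε₂ : ε₂ ≤ 1) (hε : 2 * ε₁ + ε₂ * (1 + 10 * (h / rg)) ≤ θ / 2)
    (hw : ∀ j, Weak B c lam₀ C₀ (κ * Ω) M θ t ε₂ rK rμ (gbar p g₀ j))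
    (hA : AssumptionA3 p Ω a h κ R M g₀ ψ ρ)
    (hcl : ∀ j, WeightedClose p Ω aStar 0 g₀ j (approxFlow p ψ (K₀, g₀) j) (0, quadFlow p g₀ j))
    (hrK : rK ≤ a - aStar) (hrμ : rμ ≤ h) (hθ : θ < 1) :
    ∃ C', ForcingBounds p ψ ρ (rgScale p Ω g₀ (solveConst c lam₀) rK rg rz rμ)
      (approxFlow p ψ (K₀, g₀)) ((a - aStar) / rK) (h / rg) (h / rz) (h / rμ) θ
      (2 / (rg * (g₀ ^ 2 * -Real.log g₀))) C' := by
  have hK0 := hk.rK_pos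
  have hrg := hk.rg_pos
  have hrz : 0 < rz := hrg.trans_le hk.rg_le
  have hrμ0 : 0 < rμ := hrz.trans_le hk.rz_le
  have hh : 0 < h := hrμ0.trans_le hrμ
  have hG : IsGSeq B D g₀ p.β (gbar p g₀) := hV.gseq
  have hg := hG.pos hc hF.ctl
  have hχ := hF.ctl.pos
  have hl : ∀ j, Real.log (gbar p g₀ j) < 0 := fun j => by linarith [(hw j).log_ge]
  obtain ⟨C, hC⟩ := rgScale_bounds hΩ hc hlam hF hV hκ hM hk hε₁ hε₂ hε hw
  have hσ := rgScale_good hc hlam hF hG (fun j => (hw j).mul_log_le) hK0 hrg hrz hrμ0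
  have hθ0 : 0 < θ := hk.κΩ_nonneg.trans_lt hk.κΩ_lt
  refine ScaleBounds.forcingBounds (xb := approxFlow p ψ (K₀, g₀)) hA hκ hM hσ
    ⟨fun j => rfl, fun j => rfl, fun j => rfl⟩ hC hθ0 hθ
    (isFlow_evolutionBar (u := (K₀, g₀)) hV.isFlow).step
    ((one_le_div hK0).mpr hrK) ((one_le_div hrg).mpr ?_) ((one_le_div hrz).mpr ?_)
    ((one_le_div hrμ0).mpr hrμ) le_rfl (div_le_div_of_nonneg_left hh.le hrg hk.rg_le)
    (div_le_div_of_nonneg_left hh.le hrg (hk.rg_le.trans hk.rz_le)) (fun j y hy => ?_)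
    (fun j y hy => ?_) (rgScale_init_le hc hF.ctl hG hrg)
  · exact (hk.rg_le.trans hk.rz_le).trans hrμ
  · exact hk.rz_le.trans hrμ
  · have h1 := weightedClose_up (A := a - aStar) (H := h) (S := solveConst c lam₀) hK0.le hrg.le
      hrz.le hrμ0.le (hχ j).le (hg j).le (hl j).le
      (le_of_eq (by field_simp)) (le_of_eq (by field_simp)) (le_of_eq (by field_simp))
      (le_of_eq (by field_simp)) (approxFlow p ψ (K₀, g₀) j) y hy
    have h2 := h1.trans (hcl j)
    rwa [sub_add_cancel, add_zero] at h2
  · rw [mem_ball_zero_iff] at hy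
    have h1 := weightedClose_up (A := rK * ‖y‖) (H := rμ * ‖y‖) (S := solveConst c lam₀) hK0.le
      hrg.le hrz.le hrμ0.le (hχ j).le (hg j).le (hl j).le le_rfl
      (mul_le_mul_of_nonneg_right (hk.rg_le.trans hk.rz_le) (norm_nonneg y))
      (mul_le_mul_of_nonneg_right hk.rz_le (norm_nonneg y)) le_rfl
      (approxFlow p ψ (K₀, g₀) j) y (abs_comp_le y)
    refine domain_mem_nhds_of_weightedClose (hχ j) (hg j) (hl j) ?_ ?_ (h1.trans (hcl j))
    · have := mul_lt_mul_of_pos_left hy hK0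
      linarith
    · have := mul_lt_mul_of_pos_left hy hrμ0
      linarith

/-- The approximate flow depends continuously on the initial condition, in weighted norm. -/
lemma approxFlow_close [∀ j, CompleteSpace (W j)] (hc : 0 < c) (hlam : 1 < lam₀)
    (hF : FlowControl Ω B c D lam₀ C₀ p d e) (hg₀ : 0 < g₀)
    (hS : Small (flowConst B c D lam₀ C₀) (8 * g₀))
    {σ : Scale} {HK Hg Hz Hμ Q C s : ℝ} (hs : 0 < s)
    (hz : Tendsto σ.wz atTop (𝓝 0)) (hμ : Tendsto σ.wμ atTop (𝓝 0))
    (hFB : ForcingBounds p ψ (fun _ _ => 0) σ (approxFlow p ψ (K₀, g₀)) HK Hg Hz Hμ θ Q C) :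
    ∀ᶠ u in 𝓝 (K₀, g₀), 0 < u.2 ∧ Small (flowConst B c D lam₀ C₀) (4 * u.2) ∧
      ∀ j, ∃ y, ‖y‖ ≤ s ∧ approxFlow p ψ u j = approxFlow p ψ (K₀, g₀) j + σ.up W j y := by
  -- With `ρ = 0` this yields flows of `Φ̄` that are Lipschitz in `u`, uniformly in time.
  -- Uniqueness, in `key`, identifies them with `approxFlow p ψ u`.
  obtain ⟨N, x, A, hN, hmem, hx, -⟩ := exists_perturbed_flow hFB
  have e0 : (((approxFlow p ψ (K₀, g₀)) 0).1, ((approxFlow p ψ (K₀, g₀)) 0).2.1) = (K₀, g₀) := by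
    have h1 := (quadFlow_spec hc hlam hF hg₀ (hS.mono le_rfl (by linarith))).1.isFlow.init
    simp only [approxFlow, Kbar, h1]
  have hbase := (quadFlow_spec hc hlam hF hg₀ (hS.mono le_rfl (by linarith))).1.isFlow
  rw [e0] at hmem hx
  have key : ∀ u ∈ N, 0 < u.2 → Small (flowConst B c D lam₀ C₀) (4 * u.2) →
      x u = approxFlow p ψ u := by
    intro u hu h0 hsm
    obtain ⟨h1, h2, h3, h4, -⟩ := hx u hu
    refine IsFlow.eq_approxFlow (quadFlow_spec hc hlam hF h0 hsm).2
      ⟨fun j => by rw [h1 j, evolution_zero], h2, h3, ?_, ?_⟩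
    · choose y hy hy' using h4
      have h5 : Tendsto (fun j => σ.wz j * (y j).2.2.1) atTop (𝓝 0) := by
        refine hz.zero_mul_isBoundedUnder_le ⟨1 / 2, ?_⟩
        refine eventually_map.mpr (Eventually.of_forall fun j => ?_)
        exact (abs_comp_le (y j)).2.2.1.trans (hy j)
      have h6 := hbase.z_lim.add h5
      rw [add_zero] at h6
      refine h6.congr fun j => ?_
      rw [hy' j]
      rfl
    · choose y hy hy' using h4
      have h5 : Tendsto (fun j => σ.wμ j * (y j).2.2.2) atTop (𝓝 0) := by
        refine hμ.zero_mul_isBoundedUnder_le ⟨1 / 2, ?_⟩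
        refine eventually_map.mpr (Eventually.of_forall fun j => ?_)
        exact (abs_comp_le (y j)).2.2.2.trans (hy j)
      have h6 := hbase.μ_lim.add h5
      rw [add_zero] at h6
      refine h6.congr fun j => ?_
      rw [hy' j]
      rfl
  have t1 : Tendsto (fun u : W 0 × ℝ => A * ‖u - (K₀, g₀)‖) (𝓝 (K₀, g₀)) (𝓝 0) := by
    have : Continuous fun u : W 0 × ℝ => A * ‖u - (K₀, g₀)‖ := by fun_prop
    have h := this.tendsto (K₀, g₀)
    simpa using h
  have t2 : Tendsto (fun u : W 0 × ℝ => u.2) (𝓝 (K₀, g₀)) (𝓝 g₀) := continuous_snd.tendsto _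
  filter_upwards [hN.mem_nhds hmem, t1.eventually_le_const hs, t2.eventually_const_lt hg₀,
    t2.eventually_lt_const (show g₀ < 2 * g₀ by linarith)] with u hu h1 h2 h3
  have hsm : Small (flowConst B c D lam₀ C₀) (4 * u.2) := hS.mono le_rfl (by linarith)
  refine ⟨h2, hsm, fun j => ?_⟩
  obtain ⟨y, hy, hy'⟩ := (hx u hu).2.2.2.2.1 j
  refine ⟨y, hy.trans h1, ?_⟩
  rw [← key u hu h2 hsm, hy', key _ hmem hg₀ (hS.mono le_rfl (by linarith))]

end

end RGFlow

/-! ### Flows near a given initial condition -/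

namespace RGFlow

open Filter Topology Metric Finset

universe u

/-- The weight of `z_0` and `μ_0` cancels the inverse weight in the bound on the initial condition,
so the derivatives at time zero are bounded uniformly in `g₀`. -/
lemma initial_weight_le {p : Params} {Ω g₀ rg rμ r θ : ℝ} (hg0 : gbar p g₀ 0 = g₀)
    (hl : Real.log (gbar p g₀ 0) < 0) (hg₀ : 0 < g₀) (hχ : chi Ω p.β 0 = 1) (hrg : 0 < rg)
    (hθ : θ < 1) (hr : r ≤ rμ) :
    r * (chi Ω p.β 0 * gbar p g₀ 0 ^ 2 * -Real.log (gbar p g₀ 0)) *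
      (2 / (rg * (g₀ ^ 2 * -Real.log g₀)) / (1 - θ)) ≤ 2 * rμ / (rg * (1 - θ)) := by
  rw [hg0] at hl ⊢
  have h1θ : 0 < 1 - θ := by linarith
  have h3 : r * (1 * g₀ ^ 2 * -Real.log g₀) *
      (2 / (rg * (g₀ ^ 2 * -Real.log g₀)) / (1 - θ)) = 2 * r / (rg * (1 - θ)) := by
    have := hl.ne
    field_simp
  rw [hχ, h3]
  gcongr

variable {W : ℕ → Type u} [∀ j, NormedAddCommGroup (W j)] [∀ j, NormedSpace ℝ (W j)]
  {p : Params} {ψ : ∀ j, XSpace W j → W (j + 1)} {ρ : ∀ j, XSpace W j → VSpace}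
  {Ω B c D lam₀ C₀ a b h κ R M θ t ε₁ ε₂ rK rg rz rμ g₀ aStar : ℝ} {d e : ℕ → ℝ} {K₀ : W 0}

set_option maxHeartbeats 1000000 in
-- The weights are scaled so that norm one corresponds to at most the tolerance `b`. The fixed point
-- uses half of it; the rest allows the centre and the weights to move from `(K₀, g₀)` to `u`.
theorem exists_local_flows [∀ j, CompleteSpace (W j)] (hΩ : 1 < Ω) (hc : 0 < c) (hlam : 1 < lam₀)
    (hF : FlowControl Ω B c D lam₀ C₀ p d e) (hg₀ : 0 < g₀)
    (hS : Small (pertConst B c D lam₀ C₀ (κ * Ω) M θ t ε₂ rK rμ) (8 * g₀))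
    (hκ : 0 ≤ κ) (hM : 0 ≤ M)
    (hk : ScaleConsts B c lam₀ C₀ (κ * Ω) M θ t ε₁ ε₂ rK rg rz rμ)
    (hε₁ : ε₁ ≤ 1) (hε₂ : ε₂ ≤ 1) (hε : 2 * ε₁ + ε₂ * (1 + 10 * (h / rg)) ≤ θ / 2)
    (hA : AssumptionA3 p Ω a h κ R M g₀ ψ ρ) (haS0 : 0 ≤ aStar) (haS : aStar < a)
    (hR : κ * Ω * (1 + t) * aStar + R ≤ aStar) (hK₀ : ‖K₀‖ ≤ aStar * g₀ ^ 3)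
    (hb0 : 0 < b) (hb1 : b < 1) (hrK : rK = b * (a - aStar)) (hrμ : rμ ≤ b * h) (hθ : θ < 1) :
    ∃ N : Set (W 0 × ℝ), IsOpen N ∧ (K₀, g₀) ∈ N ∧
      ∃ x : W 0 × ℝ → ∀ j, XSpace W j,
        (∀ u ∈ N,
          (IsFlow (evolutionBar p ψ) u (approxFlow p ψ u) ∧
            (∀ j, approxFlow p ψ u j ∈ domain W p Ω a h g₀ j) ∧
            ∀ y : ∀ j, XSpace W j, IsFlow (evolutionBar p ψ) u y → y = approxFlow p ψ u) ∧
          IsFlow (evolution p ψ ρ) u (x u) ∧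
          (∀ j, x u j ∈ domain W p Ω a h g₀ j) ∧
          (∀ j, WeightedClose p Ω (b * (a - aStar)) (b * h) u.2 j (x u j)
            (approxFlow p ψ u j)) ∧
          (∀ y : ∀ j, XSpace W j, IsFlow (evolution p ψ ρ) u y →
            (∀ j, WeightedClose p Ω (b * (a - aStar)) (b * h) u.2 j (y j)
              (approxFlow p ψ u j)) → y = x u)) ∧
        (∀ j, ContDiffOn ℝ 1 (fun u => x u j) N) ∧
        (∀ u ∈ N,
          |deriv (fun g => (x (u.1, g) 0).2.2.1) u.2| ≤ 2 * rμ / (rg * (1 - θ)) ∧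
          |deriv (fun g => (x (u.1, g) 0).2.2.2) u.2| ≤ 2 * rμ / (rg * (1 - θ))) := by
  have hC0 := hF.C₀_nonneg
  have hB0 := hF.ctl.B_nonneg
  have hD0 := hF.ctl.D_nonneg
  have hK0 := hk.rK_pos
  have hrg := hk.rg_pos
  have hrz : 0 < rz := hrg.trans_le hk.rg_le
  have hrμ0 : 0 < rμ := hrz.trans_le hk.rz_le
  have hrgμ : rg ≤ rμ := hk.rg_le.trans hk.rz_le
  have hh : 0 < h := by
    by_contra hneg
    have := mul_nonpos_of_nonneg_of_nonpos hb0.le (not_lt.mp hneg)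
    linarith
  have hrμh : rμ ≤ h := hrμ.trans (mul_le_of_le_one_left hh.le hb1.le)
  have haS' : 0 < a - aStar := by linarith
  have hrK' : rK ≤ a - aStar := by
    rw [hrK]
    exact mul_le_of_le_one_left haS'.le hb1.le
  have hSf : Small (flowConst B c D lam₀ C₀) (8 * g₀) :=
    hS.mono (hk.flowConst_le hc hlam hC0 hB0 hM) le_rfl
  have hV := (quadFlow_spec hc hlam hF hg₀ (hSf.mono le_rfl (by linarith))).1
  have hG : IsGSeq B D g₀ p.β (gbar p g₀) := hV.gseq
  have hg := hG.pos hc hF.ctl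
  have hχ := hF.ctl.pos
  have hw : ∀ j, Weak B c lam₀ C₀ (κ * Ω) M θ t ε₂ rK rμ (gbar p g₀ j) := fun j =>
    weak_of_small hc hlam hC0 hB0 hD0 hM hk hS (hg j)
      ((hG.le_two hc hF.ctl j).trans (by linarith))
  have hl : ∀ j, Real.log (gbar p g₀ j) < 0 := fun j => by linarith [(hw j).log_ge]
  have hgl : ∀ j, gbar p g₀ j * -Real.log (gbar p g₀ j) ≤ 1 := fun j => (hw j).mul_log_le
  have hcl := approxFlow_weightedClose (K₀ := K₀) hc hF hV hκ hh.le hk hw hA haS0 haS.le hR hK₀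
  obtain ⟨C₁, hFB⟩ := rgScale_forcingBounds hΩ hc hlam hF hV hκ hM hk hε₁ hε₂ hε hw hA hcl hrK'
    hrμh hθ
  obtain ⟨C₂, hFB₀⟩ := rgScale_forcingBounds hΩ hc hlam hF hV hκ hM hk hε₁ hε₂ hε hw
    (hA.zero hM (fun j => (hχ j).le) fun j => (hg j).le) hcl hrK' hrμh hθ
  -- The first bound on `ε` gives `hfac`, used for the estimate on `x u`. The second gives `hbε`,
  -- used for uniqueness.
  set ε := min (1 / 4) ((1 - b) / 2) with hεdef
  have hε0 : 0 < ε := lt_min (by norm_num) (by linarith)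
  have hε4 : ε ≤ 1 / 4 := min_le_left _ _
  have hεb : ε ≤ (1 - b) / 2 := min_le_right _ _
  have hε1 : ε ≤ 1 := by linarith
  have hfac : (1 + ε) * (1 / 2 + ε) ≤ 1 := by
    refine (mul_le_mul (show 1 + ε ≤ 5 / 4 by linarith) (show 1 / 2 + ε ≤ 3 / 4 by linarith)
      (by linarith) (by norm_num)).trans (by norm_num)
  have hbε : (1 + ε) * b + b * ε ≤ 1 := by
    have := mul_le_mul_of_nonneg_left hεb hb0.le
    have := mul_le_of_le_one_left (show 0 ≤ 1 - b by linarith) hb1.le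
    linarith
  obtain ⟨τ, hτ, hcomp⟩ := exists_comparable (q := 1 + ε) (by linarith)
  -- Weighted distance `τ / rg` keeps the couplings within relative distance `τ`, as `g |log g| ≤
  -- 1`.
  have hs0 : 0 < min ε (τ / rg) := lt_min hε0 (by positivity)
  have hzlim := tendsto_chi_sq_log hc hF.ctl hG hgl hrz
  have hμlim := tendsto_chi_sq_log hc hF.ctl hG hgl hrμ0
  have hev := approxFlow_close hc hlam hF hg₀ hSf hs0 hzlim hμlim hFB₀
  obtain ⟨N₂, hN₂, hN₂o, hN₂m⟩ := _root_.eventually_nhds_iff.mp hev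
  obtain ⟨N₁, x, A, hN₁o, hN₁m, hx, hsmooth⟩ := exists_perturbed_flow hFB
  have e0 : (((approxFlow p ψ (K₀, g₀)) 0).1, ((approxFlow p ψ (K₀, g₀)) 0).2.1) = (K₀, g₀) := by
    have h1 := hV.isFlow.init
    simp only [approxFlow, Kbar, h1]
  rw [e0] at hN₁m hx
  have close_of_norm : ∀ {r : ℝ} {j : ℕ} (x' y : XSpace W j), ‖y‖ ≤ r →
      WeightedClose p Ω (rK * r) (rμ * r) g₀ j
        (x' + (rgScale p Ω g₀ (solveConst c lam₀) rK rg rz rμ).up W j y) x' := by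
    intro r j x' y hy
    have hr : 0 ≤ r := (norm_nonneg y).trans hy
    obtain ⟨c1, c2, c3, c4⟩ := abs_comp_le y
    exact weightedClose_up hK0.le hrg.le hrz.le hrμ0.le (hχ j).le (hg j).le (hl j).le le_rfl
      (mul_le_mul_of_nonneg_right hrgμ hr) (mul_le_mul_of_nonneg_right hk.rz_le hr) le_rfl x' y
      ⟨c1.trans hy, c2.trans hy, c3.trans hy, c4.trans hy⟩
  refine ⟨N₁ ∩ N₂, hN₁o.inter hN₂o, ⟨hN₁m, hN₂m⟩, x, fun u hu => ?_,
    fun j => (hsmooth j).mono Set.inter_subset_left, fun u hu => ?_⟩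
  · obtain ⟨hu0, husm, huy⟩ := hN₂ u hu.2
    obtain ⟨hxstep, hxK, hxg, hxy, -, hxuniq, -, -⟩ := hx u hu.1
    obtain ⟨hVu, huniq⟩ := quadFlow_spec hc hlam hF hu0 husm
    have hGu : IsGSeq B D u.2 p.β (gbar p u.2) := hVu.gseq
    have hgu := hGu.pos hc hF.ctl
    have hnear : ∀ j, WeightedClose p Ω (rK * ε) (rμ * ε) g₀ j (approxFlow p ψ u j)
        (approxFlow p ψ (K₀, g₀) j) := by
      intro j
      obtain ⟨y, hy, hy'⟩ := huy j
      rw [hy']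
      exact close_of_norm _ y (hy.trans (min_le_left _ _))
    have hcmp : ∀ j, Comparable (1 + ε) (gbar p u.2 j) (gbar p g₀ j) ∧
        Comparable (1 + ε) (gbar p g₀ j) (gbar p u.2 j) := by
      intro j
      refine hcomp _ _ (hg j) (by linarith [(hw j).log_ge]) ?_
      obtain ⟨y, hy, hy'⟩ := huy j
      have h1 : gbar p u.2 j - gbar p g₀ j =
          rg * (gbar p g₀ j ^ 2 * -Real.log (gbar p g₀ j)) * y.2.1 := by
        have := congrArg (fun v : XSpace W j => v.2.1) hy'
        simp only [approxFlow, Scale.up, scaleMap_apply, rgScale, Prod.snd_add, Prod.fst_add]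
          at this
        simp only [gbar] at this ⊢
        rw [this, add_sub_cancel_left]
      have h2 : |y.2.1| ≤ τ / rg := (abs_comp_le y).2.1.trans (hy.trans (min_le_right _ _))
      have h3 : 0 < rg * (gbar p g₀ j * (gbar p g₀ j * -Real.log (gbar p g₀ j))) :=
        mul_pos hrg (mul_pos (hg j) (mul_pos (hg j) (by linarith [hl j])))
      have h4 : rg * (gbar p g₀ j ^ 2 * -Real.log (gbar p g₀ j)) =
          rg * (gbar p g₀ j * (gbar p g₀ j * -Real.log (gbar p g₀ j))) := by ring
      rw [h1, h4, abs_mul, abs_of_pos h3]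
      calc rg * (gbar p g₀ j * (gbar p g₀ j * -Real.log (gbar p g₀ j))) * |y.2.1|
          ≤ rg * (gbar p g₀ j * 1) * (τ / rg) := by
            refine mul_le_mul ?_ h2 (abs_nonneg _) (mul_pos hrg (by linarith [hg j])).le
            exact mul_le_mul_of_nonneg_left
              (mul_le_mul_of_nonneg_left (hgl j) (hg j).le) hrg.le
        _ = τ * gbar p g₀ j := by field_simp
    have hxnear : ∀ j, WeightedClose p Ω (rK * (1 / 2)) (rμ * (1 / 2)) g₀ j (x u j)
        (approxFlow p ψ (K₀, g₀) j) := by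
      intro j
      obtain ⟨y, hy, hy'⟩ := hxy j
      rw [hy']
      exact close_of_norm _ y hy
    refine ⟨⟨isFlow_evolutionBar hVu.isFlow, fun j => ?_, fun y hy => hy.eq_approxFlow huniq⟩,
      ⟨hxstep, hxK, hxg, ?_, ?_⟩, fun j => ?_, fun j => ?_, fun y hy hyc => ?_⟩
    · refine ((hnear j).trans (hcl j)).mono (hχ j).le (hg j).le ?_ ?_
      · linarith [mul_le_of_le_one_right hK0.le hε1]
      · linarith [mul_le_of_le_one_right hrμ0.le hε1]
    · have h1 : Tendsto (fun j => b * h * chi Ω p.β j * gbar p g₀ j ^ 2 *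
          |Real.log (gbar p g₀ j)|) atTop (𝓝 0) := by
        refine (tendsto_chi_sq_log hc hF.ctl hG hgl (mul_pos hb0 hh)).congr fun j => ?_
        rw [abs_of_neg (hl j)]
        ring
      have h2 : Tendsto (fun j => (x u j).2.2.1 - (quadFlow p g₀ j).2.1) atTop (𝓝 0) :=
        squeeze_zero_norm (fun j => ((hxnear j).mono (hχ j).le (hg j).le le_rfl
          (by linarith : rμ * (1 / 2) ≤ b * h)).z_le) h1
      simpa using h2.add hV.isFlow.z_lim
    · have h1 : Tendsto (fun j => b * h * chi Ω p.β j * gbar p g₀ j ^ 2 *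
          |Real.log (gbar p g₀ j)|) atTop (𝓝 0) := by
        refine (tendsto_chi_sq_log hc hF.ctl hG hgl (mul_pos hb0 hh)).congr fun j => ?_
        rw [abs_of_neg (hl j)]
        ring
      have h2 : Tendsto (fun j => (x u j).2.2.2 - (quadFlow p g₀ j).2.2) atTop (𝓝 0) :=
        squeeze_zero_norm (fun j => ((hxnear j).mono (hχ j).le (hg j).le le_rfl
          (by linarith : rμ * (1 / 2) ≤ b * h)).μ_le) h1
      simpa using h2.add hV.isFlow.μ_lim
    · exact ((hxnear j).trans (hcl j)).mono (hχ j).le (hg j).le (by linarith) (by linarith)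
    · have h1 := ((hxnear j).trans (hnear j).symm).change_base (hχ j).le (by positivity)
        (by positivity) (hcmp j).2
      have h2 := mul_le_mul_of_nonneg_left hfac hK0.le
      have h3 := mul_le_mul_of_nonneg_left hfac hrμ0.le
      refine h1.mono (hχ j).le (hgu j).le ?_ ?_
      · rw [← hrK]
        linarith
      · linarith
    -- A competitor within `b` of the approximate flow at `u` is, in the weights at `g₀`, within `(1
    -- + ε) b + b ε ≤ 1` of the one at the centre, hence in the box of uniqueness.
    · refine hxuniq y hy.step hy.K_init hy.g_init fun j => ?_
      have h1 := ((hyc j).change_base (hχ j).le (by positivity) (by positivity)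
        (hcmp j).1).trans (hnear j)
      have h2 : WeightedClose p Ω (a - aStar) h g₀ j (y j) (approxFlow p ψ (K₀, g₀) j) := by
        refine h1.mono (hχ j).le (hg j).le ?_ ?_
        · rw [hrK]
          have := mul_le_mul_of_nonneg_right hbε haS'.le
          linarith
        · have := mul_le_mul_of_nonneg_right hbε hh.le
          have := mul_le_mul_of_nonneg_right hrμ hε0.le
          linarith
      exact h2.exists_up hK0 hrg hrz hrμ0 (hχ j) (hg j) (hl j)
  · obtain ⟨-, -, -, -, -, -, h1, h2⟩ := hx u hu.1
    exact ⟨h1.trans (initial_weight_le hG.init (hl 0) hg₀ hF.ctl.zero hrg hθ hk.rz_le),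
      h2.trans (initial_weight_le hG.init (hl 0) hg₀ hF.ctl.zero hrg hθ le_rfl)⟩

end RGFlow

/-! ### Existence of the constants -/

namespace RGFlow

/-- Suitable constants in the scales exist. -/
lemma exists_scaleConsts {c lam₀ C₀ κΩ R M rK aStar : ℝ} (B : ℝ) (hc : 0 < c) (hlam : 1 < lam₀)
    (hC : 0 ≤ C₀) (hκ0 : 0 < κΩ) (hκ1 : κΩ < 1) (hM : 0 < M) (hrK : 0 < rK) (haS : 0 < aStar)
    (hR : R < aStar * (1 - κΩ)) :
    ∃ θ t ε₁ rg rz rμ, θ < 1 ∧ ε₁ ≤ 1 ∧ κΩ * (1 + t) * aStar + R ≤ aStar ∧ 0 < rμ ∧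
      ∀ H, 0 ≤ H → ∃ ε₂, ε₂ ≤ 1 ∧ 2 * ε₁ + ε₂ * (1 + 10 * (H / rg)) ≤ θ / 2 ∧
        ScaleConsts B c lam₀ C₀ κΩ M θ t ε₁ ε₂ rK rg rz rμ := by
  have hS := solveConst_pos hc hlam
  have hCz := zConst_nonneg hc hC
  -- Any contraction rate strictly between `κΩ` and one would do.
  set θ := (1 + κΩ) / 2 with hθ
  have hθ0 : 0 < θ := by linarith
  have hθ1 : θ < 1 := by linarith
  have h1θ : 0 < 1 - θ := by linarith
  set S := solveConst c lam₀
  -- The two summands serve `pert_le` and `zero_le`. Then `rz` and `rμ` are enlarged in turn to meet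
  -- `lin_z` and `lin_μ` with `ε₁ = θ/8`.
  set rg := 2 * S * (M * rK + 1) / θ + 32 * M * S / (1 - θ) with hrg
  have hrg0 : 0 < rg := by positivity
  set rz := rg + C₀ * (2 + zConst c C₀) * S * rg / (θ / 8) with hrz
  have hrgz : rg ≤ rz := by
    have : 0 ≤ C₀ * (2 + zConst c C₀) * S * rg / (θ / 8) := by positivity
    linarith
  have hrz0 : 0 < rz := hrg0.trans_le hrgz
  set rμ := rz + 2 * C₀ * S * rz / (θ / 8) + 1 with hrμ
  have hn : 0 ≤ 2 * C₀ * S * rz / (θ / 8) := by positivity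
  set t := min 1 (min ((θ - κΩ) / (2 * κΩ)) ((aStar * (1 - κΩ) - R) / (κΩ * aStar))) with ht
  have ht1 : t ≤ 1 := min_le_left _ _
  have ht2 : t ≤ (θ - κΩ) / (2 * κΩ) := (min_le_right _ _).trans (min_le_left _ _)
  have ht3 : t ≤ (aStar * (1 - κΩ) - R) / (κΩ * aStar) :=
    (min_le_right _ _).trans (min_le_right _ _)
  have ht0 : 0 < t := lt_min one_pos (lt_min (div_pos (by linarith) (by linarith))
    (div_pos (by linarith) (by positivity)))
  rw [le_div_iff₀ (by positivity)] at ht2 ht3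
  refine ⟨θ, t, θ / 8, rg, rz, rμ, hθ1, by linarith, by linarith, by linarith, fun H hH => ?_⟩
  have hH' : 0 < 1 + 10 * (H / rg) := by positivity
  have hH1 : 1 ≤ 1 + 10 * (H / rg) := by
    have : 0 ≤ H / rg := by positivity
    linarith
  -- Only `ε₂` depends on the size `H` of the box; the budget is `2 (θ/8) + θ/4 = θ/2`.
  refine ⟨θ / 4 / (1 + 10 * (H / rg)), ?_, ?_, ?_⟩
  · rw [div_le_one hH']
    linarith
  · rw [div_mul_cancel₀ _ hH'.ne']
    linarith
  · have hrgS : rg / S = 2 * (M * rK + 1) / θ + 32 * M / (1 - θ) := by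
      rw [hrg]
      field_simp
    refine ⟨hrK, hrg0, hrgz, by linarith, by linarith, by positivity, ht0, ht1, by linarith,
      hκ0.le, by linarith, ?_, ?_, ?_, ?_⟩
    · rw [hrgS]
      have e1 : θ / 2 * (2 * (M * rK + 1) / θ) = M * rK + 1 := by field_simp
      have e2 : 0 ≤ θ / 2 * (32 * M / (1 - θ)) := by positivity
      rw [mul_add, e1]
      linarith
    · rw [hrgS]
      have e1 : (1 - θ) / 4 * (32 * M / (1 - θ)) = 8 * M := by
        field_simp
        norm_num
      have e2 : 0 ≤ (1 - θ) / 4 * (2 * (M * rK + 1) / θ) := by positivity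
      rw [mul_add, e1]
      linarith
    · have e1 : θ / 8 * (C₀ * (2 + zConst c C₀) * S * rg / (θ / 8)) =
          C₀ * (2 + zConst c C₀) * S * rg := by field_simp
      have e2 : θ / 8 * rz = θ / 8 * rg + C₀ * (2 + zConst c C₀) * S * rg := by
        rw [← e1, ← mul_add]
      have : 0 < θ / 8 * rg := by positivity
      linarith
    · have e1 : θ / 8 * (2 * C₀ * S * rz / (θ / 8)) = 2 * C₀ * S * rz := by field_simp
      have e2 : θ / 8 * rμ = θ / 8 * rz + 2 * C₀ * S * rz + θ / 8 := by
        rw [← e1, hrμ]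
        ring
      have : 0 < θ / 8 * rz := by positivity
      linarith

end RGFlow

/-! ### Assembly of the main theorem -/

theorem theorem1p3
    (Ω B c lam₀ C₀ a κ R M aStar b : ℝ)
    (hΩ : 1 < Ω) (hc : 0 < c) (hlam : 1 < lam₀)
    (ha : 0 < a) (hκ : κ ∈ Set.Ioo 0 Ω⁻¹) (hR : R ∈ Set.Ioo 0 (a * (1 - κ * Ω))) (hM : 0 < M)
    (haStar : aStar ∈ Set.Ioo (R / (1 - κ * Ω)) a) (hb : b ∈ Set.Ioo (0 : ℝ) 1) :
    ∃ hStar : ℝ, 0 < hStar ∧ ∀ h : ℝ, hStar ≤ h →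
    ∃ gStar : ℝ, 0 < gStar ∧ ∃ C : ℝ,
    ∀ (W : ℕ → Type*) [∀ j, NormedAddCommGroup (W j)] [∀ j, NormedSpace ℝ (W j)]
      [∀ j, CompleteSpace (W j)]
      (p : Params) (ψ : ∀ j, XSpace W j → W (j + 1)) (ρ : ∀ j, XSpace W j → VSpace)
      (K₀' : W 0) (g₀' : ℝ),
      AssumptionA1 Ω B c p → AssumptionA2 Ω c lam₀ C₀ p →
      AssumptionA3 p Ω a h κ R M g₀' ψ ρ →
      g₀' ∈ Set.Ioc 0 gStar → ‖K₀'‖ ≤ aStar * g₀' ^ 3 →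
      ∃ N : Set (W 0 × ℝ), IsOpen N ∧ (K₀', g₀') ∈ N ∧
      ∃ x : W 0 × ℝ → ∀ j, XSpace W j,
        (∀ u ∈ N,
          -- `x̄(u)` is the unique flow of `Φ̄` with these boundary conditions
          (IsFlow (evolutionBar p ψ) u (approxFlow p ψ u) ∧
            (∀ j, approxFlow p ψ u j ∈ domain W p Ω a h g₀' j) ∧
            ∀ y : ∀ j, XSpace W j, IsFlow (evolutionBar p ψ) u y → y = approxFlow p ψ u) ∧
          -- `x(u)` is a flow of `Φ` that satisfies the bounds
          IsFlow (evolution p ψ ρ) u (x u) ∧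
          (∀ j, x u j ∈ domain W p Ω a h g₀' j) ∧
          (∀ j, WeightedClose p Ω (b * (a - aStar)) (b * h) u.2 j (x u j)
            (approxFlow p ψ u j)) ∧
          -- and it is the only one
          (∀ y : ∀ j, XSpace W j, IsFlow (evolution p ψ ρ) u y →
            (∀ j, WeightedClose p Ω (b * (a - aStar)) (b * h) u.2 j (y j)
              (approxFlow p ψ u j)) → y = x u)) ∧
        (∀ j, ContDiffOn ℝ 1 (fun u => x u j) N) ∧
        (∀ u ∈ N,
          |deriv (fun g => (x (u.1, g) 0).2.2.1) u.2| ≤ C ∧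
          |deriv (fun g => (x (u.1, g) 0).2.2.2) u.2| ≤ C) := by
  obtain ⟨hκ0, hκ1⟩ := hκ
  obtain ⟨hR0, -⟩ := hR
  obtain ⟨haS1, haS2⟩ := haStar
  obtain ⟨hb0, hb1⟩ := hb
  -- Since `χ_0 = 1`, a negative `C₀` contradicts (A2).
  by_cases hC : 0 ≤ C₀
  swap
  · refine ⟨1, one_pos, fun h _ => ⟨1, one_pos, 0, ?_⟩⟩
    intro W _ _ _ p ψ ρ K₀' g₀' hA1 hA2
    obtain ⟨d, e, hF⟩ := exists_flowControl hΩ hc hA1 hA2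
    exact absurd hF.C₀_nonneg hC
  have hΩ0 : 0 < Ω := by linarith
  have hκΩ0 : 0 < κ * Ω := by positivity
  have hκΩ1 : κ * Ω < 1 := by
    rwa [← one_div, lt_div_iff₀ hΩ0] at hκ1
  have haS0 : 0 < aStar := (div_pos hR0 (by linarith)).trans haS1
  rw [div_lt_iff₀ (by linarith)] at haS1
  have hrK : 0 < b * (a - aStar) := mul_pos hb0 (by linarith)
  obtain ⟨θ, t, ε₁, rg, rz, rμ, hθ, hε₁, hRt, hrμ, hconst⟩ :=
    exists_scaleConsts B hc hlam hC hκΩ0 hκΩ1 hM hrK haS0 haS1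
  -- This threshold is the requirement `rμ ≤ b h`: the largest weight must fit into the tolerance.
  refine ⟨rμ / b, by positivity, fun h hh => ?_⟩
  rw [div_le_iff₀ hb0] at hh
  have hh0 : 0 ≤ h := by
    by_contra hneg
    nlinarith
  obtain ⟨ε₂, hε₂, hε, hk⟩ := hconst h hh0
  obtain ⟨x₀, hx₀, hS⟩ := exists_small
    (pertConst B c (defectMass Ω B c C₀) lam₀ C₀ (κ * Ω) M θ t ε₂ (b * (a - aStar)) rμ)
  -- Nearby initial couplings are below `2 g₀`, and the quadratic flow needs smallness at four times
  -- its initial coupling; hence the factor eight.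
  refine ⟨x₀ / 8, by positivity, 2 * rμ / (rg * (1 - θ)), ?_⟩
  intro W _ _ _ p ψ ρ K₀' g₀' hA1 hA2 hA3 hg hK
  obtain ⟨d, e, hF⟩ := exists_flowControl hΩ hc hA1 hA2
  exact exists_local_flows hΩ hc hlam hF hg.1 (hS.mono le_rfl (by linarith [hg.2])) hκ0.le hM.le hk
    hε₁ hε₂ hε hA3 haS0.le haS2 hRt hK hb0 hb1 rfl (by linarith) hθ
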